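/- Let $\mathbb{F}$ be a finite field with $q$ elements, $A=\mathbb{F}[t]$, $K=\mathbb{F}(t)$, and let $\mathbb{C}_\infty$ be the completion of an algebraic closure of $K_\infty=\mathbb{F}(\!(1/t)\!)$ for the absolute value with $|t|=q$. Let $K\subseteq L\subseteq\mathbb{C}_\infty$ be an intermediate field and $(E,\phi)$ an Anderson $A$-module over $L$ of dimension $d\ge 1$, i.e. an $\mathbb{F}$-vector space scheme $E\cong\mathbb{G}_{a,L}^d$ with an $\mathbb{F}$-algebra homomorphism $\phi:A\to\operatorname{End}_{\mathbb{F},L}(E)$ such that $\partial\phi_a-a$ is nilpotent on $\operatorname{Lie}_E(L)$ for all $a\in A$. Write $\partial a=\partial\phi_a$; $\partial t$ is an automorphism of $\operatorname{Lie}_E(\mathbb{C}_\infty)$. Let $\exp_E:\operatorname{Lie}_E(\mathbb{C}_\infty)\to E(\mathbb{C}_\infty)$ be the exponential function of $E$, i.e. the $\mathbb{F}$-linear map with $\exp_E(\partial a\,x)=\phi_a(\exp_E(x))$ for all $a\in A$ that in the coordinates of any isomorphism $E\cong\mathbb{G}_{a,L}^d$ is an everywhere convergent series $x+e_1x^{(1)}+e_2x^{(2)}+\cdots$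 with $d\times d$ matrices $e_n$ over $\mathbb{C}_\infty$, where $x^{(n)}$ is the coordinatewise $q^n$-th power. Let $\Lambda_E=\ker\exp_E$, an $A$-module via $a\mapsto\partial a$. Tensor products without index are over $\mathbb{F}$. For an isomorphism $E\cong\mathbb{G}_{a,L}^d$, take the maximum norms on $E(\mathbb{C}_\infty)$ and $\operatorname{Lie}_E(\mathbb{C}_\infty)$, and let $E(\mathbb{T})=A\hat\otimes E(\mathbb{C}_\infty)$ and $\operatorname{Lie}_E(\mathbb{T})=A\hat\otimes\operatorname{Lie}_E(\mathbb{C}_\infty)$ be the completions for the norm $\|x\|=\inf\max_i|v_i|$ over all representations $x=\sum_i b_i\otimes v_i$. Let $\mathfrak{sf}(E)=\{\omega\in E(\mathbb{T}) : (a\otimes1)\omega=(1\otimes a)\omega\ \ \forall a\in A\}$. Call $u\in A$ separating if $K/\mathbb{F}(u)$ is finite and separable. For such $u$, the map $1\otimes\partial u-u\otimes1$ is bijective on $\operatorname{Lie}_E(\mathbb{T})$, and with the relative different $\mathfrak{d}_{A/\mathbb{F}[u]}\subseteq A$ there is a well-defined map $$\delta_u:\mathfrak{d}_{A/\mathbb{F}[u]}\cdot\Lambda_E\to\mathfrak{sf}(E),\qquad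 \delta_u(y)=(\operatorname{id}\hat\otimes\exp_E)\bigl((1\otimes\partial u-u\otimes1)^{-1}x\bigr),$$ where $x\in A\otimes_{\mathbb{F}[u]}\Lambda_E$ (represented by an element of $A\otimes\Lambda_E\subseteq\operatorname{Lie}_E(\mathbb{T})$) satisfies $(a\otimes1)x=(1\otimes a)x$ for all $a\in A$ and has image $y$ under multiplication $A\otimes_{\mathbb{F}[u]}\Lambda_E\to\Lambda_E$. Then for every separating $u=u(t)\in\mathbb{F}[t]$, with derivative $u'(t)$, one has $u'(t)\lambda\in\mathfrak{d}_{A/\mathbb{F}[u]}\cdot\Lambda_E$ for all $\lambda\in\Lambda_E$, and the composition $$\Lambda_E\xrightarrow{\ u'(t)\cdot\ }\mathfrak{d}_{A/\mathbb{F}[u]}\cdot\Lambda_E\xrightarrow{\ \delta_u\ }\mathfrak{sf}(E)$$ does not depend on $u$. Here $t$ is separating, $\mathfrak{d}_{A/\mathbb{F}[t]}\cdot\Lambda_E=\Lambda_E$, and the composition equals the isomorphism of $A$-modules $\delta_t:\Lambda_E\to\mathfrak{sf}(E)$, which sends a period $\lambda$ to its Anderson generating function $$(\operatorname{id}\hat\otimes\exp_E)\bigl((1\otimes\partial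 t-t\otimes1)^{-1}(1\otimes\lambda)\bigr)=\sum_{n=0}^\infty t^n\otimes\exp_E\bigl((\partial t)^{-n-1}\lambda\bigr).$$ -/

import Mathlib

open Polynomial CategoryTheory
open scoped TensorProduct NNReal

universe u

noncomputable section

namespace AndersonT

section CInfty

variable (F : Type u) [Field F] [Fintype F]

open Classical in
/-- `K_∞ = 𝔽((1/t))`, the completion of `K = 𝔽(t)` at the place `∞`. -/
def KInf : Type u := RatFunc.CompletionAtInfty F

open Classical in
instance : Field (KInf F) := inferInstanceAs (Field (RatFunc.CompletionAtInfty F))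

open Classical in
instance : Algebra (RatFunc F) (KInf F) :=
  inferInstanceAs (Algebra (RatFunc F) (RatFunc.CompletionAtInfty F))

open Classical in
instance : Valued (KInf F) (WithZero (Multiplicative ℤ)) :=
  inferInstanceAs (Valued (RatFunc.CompletionAtInfty F) (WithZero (Multiplicative ℤ)))

open Classical in
instance : CompleteSpace (KInf F) :=
  letI := (RatFunc.inftyValued F).toUniformSpace
  inferInstanceAs (CompleteSpace (UniformSpace.Completion (RatFunc F)))

theorem one_lt_card : (1 : ℝ≥0) < (Fintype.card F : ℝ≥0) := by
  exact_mod_cast Fintype.one_lt_card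

open Classical in
theorem valued_X : Valued.v (algebraMap (RatFunc F) (KInf F) RatFunc.X) =
    (WithZero.exp (1 : ℤ) : WithZero (Multiplicative ℤ)) := by
  let := RatFunc.inftyValued F
  have h := Valued.extensionValuation_apply_coe (K := RatFunc F) (RatFunc.X (K := F))
  refine Eq.trans h ?_
  exact RatFunc.inftyValuation.X F

/-- The absolute value on `K_∞` is normalized by `|t| = q`. -/
instance : Valuation.RankOne (Valued.v : Valuation (KInf F) (WithZero (Multiplicative ℤ))) where
  hom' := (WithZeroMulInt.toNNReal (one_lt_card F).ne_bot).comp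
    MonoidWithZeroHom.ValueGroup₀.embedding
  strictMono' := (WithZeroMulInt.toNNReal_strictMono (one_lt_card F)).comp
    MonoidWithZeroHom.ValueGroup₀.embedding_strictMono
  exists_val_nontrivial := ⟨algebraMap (RatFunc F) (KInf F) RatFunc.X, by
    rw [valued_X]; exact ⟨by simp, by simp⟩⟩

instance : NormedField (KInf F) := Valued.toNormedField _ (WithZero (Multiplicative ℤ))

instance : IsUltrametricDist (KInf F) :=
  ⟨fun x y z => by
    refine (Valuation.norm_add_le _ (x - y) (y - z)).trans_eq' ?_
    simp only [sub_add_sub_cancel]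
    rfl⟩

instance : NontriviallyNormedField (KInf F) where
  non_trivial := ⟨algebraMap (RatFunc F) (KInf F) RatFunc.X, by
    refine (Valued.toNormedField.one_lt_norm_iff (L := KInf F)
      (Γ₀ := WithZero (Multiplicative ℤ))).mpr ?_
    rw [valued_X, ← WithZero.exp_zero, WithZero.exp_lt_exp]
    exact one_pos⟩

instance : NormedField (AlgebraicClosure (KInf F)) :=
  spectralNorm.normedField (KInf F) (AlgebraicClosure (KInf F))

/-- `ℂ_∞`, the completion of an algebraic closure of `K_∞` for the unique extension of the absolute
value of `K_∞`. -/
def CInf : Type u := UniformSpace.Completion (AlgebraicClosure (KInf F))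

instance : NormedField (CInf F) :=
  inferInstanceAs (NormedField (UniformSpace.Completion (AlgebraicClosure (KInf F))))

instance : CompleteSpace (CInf F) :=
  inferInstanceAs (CompleteSpace (UniformSpace.Completion (AlgebraicClosure (KInf F))))

/-- The inclusion `K = 𝔽(t) ⊆ K_∞ ⊆ ℂ_∞`. -/
instance : Algebra (RatFunc F) (CInf F) :=
  RingHom.toAlgebra <|
    (UniformSpace.Completion.coeRingHom : AlgebraicClosure (KInf F) →+* CInf F).comp <|
      (algebraMap (KInf F) (AlgebraicClosure (KInf F))).comp (algebraMap (RatFunc F) (KInf F))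

instance : Algebra F (CInf F) :=
  RingHom.toAlgebra ((algebraMap (RatFunc F) (CInf F)).comp (algebraMap F (RatFunc F)))

instance : IsScalarTower F (RatFunc F) (CInf F) := IsScalarTower.of_algebraMap_eq fun _ => rfl

end CInfty

section Functors

variable (F L : Type u) [Field F] [Field L] [Algebra F L]

/-- The functor of points (on commutative `L`-algebras) of the `𝔽`-vector space scheme `𝔾_{a,L}^d`:
it sends `R` to `R^d`. -/
def Ga (d : ℕ) : CommAlgCat.{u} L ⥤ ModuleCat.{u} F where
  obj R := letI : Module F R := Module.compHom R (algebraMap F L)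
    ModuleCat.of F (Fin d → R)
  map {R S} f := letI : Module F R := Module.compHom R (algebraMap F L)
    letI : Module F S := Module.compHom S (algebraMap F L)
    ModuleCat.ofHom
      { toFun := fun v i => f.hom (v i)
        map_add' := fun v w => funext fun i => map_add f.hom (v i) (w i)
        map_smul' := fun c v => funext fun i => map_smul f.hom (algebraMap F L c) (v i) }

variable {F L}

/-- The `𝔽`-vector space `E(R)`. -/
abbrev Pts (E : CommAlgCat.{u} L ⥤ ModuleCat.{u} F) (R : Type u) [CommRing R] [Algebra L R] :
    Type u :=
  E.obj (CommAlgCat.of L R)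

/-- The map `E(R) → E'(R)` induced by a morphism `E → E'` of `𝔽`-vector space schemes. -/
def ptsMap {E E' : CommAlgCat.{u} L ⥤ ModuleCat.{u} F} (f : E ⟶ E')
    (R : Type u) [CommRing R] [Algebra L R] : Pts E R →ₗ[F] Pts E' R :=
  (f.app (CommAlgCat.of L R)).hom

/-- The map `E(R) → E(S)` induced by a homomorphism `R → S` of `L`-algebras. -/
def ptsBaseChange (E : CommAlgCat.{u} L ⥤ ModuleCat.{u} F) {R S : Type u} [CommRing R] [Algebra L R]
    [CommRing S] [Algebra L S] (g : R →ₐ[L] S) : Pts E R →ₗ[F] Pts E S :=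
  (E.map (CommAlgCat.ofHom g)).hom

theorem ptsMap_ptsBaseChange {E E' : CommAlgCat.{u} L ⥤ ModuleCat.{u} F} (f : E ⟶ E')
    {R S : Type u} [CommRing R] [Algebra L R] [CommRing S] [Algebra L S] (g : R →ₐ[L] S)
    (x : Pts E R) : ptsMap f S (ptsBaseChange E g x) = ptsBaseChange E' g (ptsMap f R x) :=
  NatTrans.naturality_apply f (CommAlgCat.ofHom g) x

/-- `Lie_E(R)`: the kernel of `E(R[ε]) → E(R)`, `ε ↦ 0`, i.e. the `R`-valued tangent vectors of `E`
at the neutral element. -/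
def Lie (E : CommAlgCat.{u} L ⥤ ModuleCat.{u} F) (R : Type u) [CommRing R] [Algebra L R] :
    Submodule F (Pts E (DualNumber R)) :=
  LinearMap.ker (ptsBaseChange E (TrivSqZeroExt.fstHom L R R))

/-- The map `∂f : Lie_E(R) → Lie_E'(R)` induced by a morphism `f : E → E'`. -/
def lieMap {E E' : CommAlgCat.{u} L ⥤ ModuleCat.{u} F} (f : E ⟶ E')
    (R : Type u) [CommRing R] [Algebra L R] : Lie E R →ₗ[F] Lie E' R :=
  (ptsMap f (DualNumber R)).restrict fun x hx => by
    have hx' : ptsBaseChange E (TrivSqZeroExt.fstHom L R R) x = 0 := hx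
    change ptsBaseChange E' (TrivSqZeroExt.fstHom L R R) (ptsMap f (DualNumber R) x) = 0
    rw [← ptsMap_ptsBaseChange, hx', map_zero]

/-- The homomorphism `R[ε] → R[ε]`, `ε ↦ c ε`. -/
def dualScale (L : Type u) [Field L] {R : Type u} [CommRing R] [Algebra L R] (c : R) :
    DualNumber R →ₐ[L] DualNumber R :=
  (TrivSqZeroExt.map (c • (LinearMap.id : R →ₗ[R] R))).restrictScalars L

/-- Scalar multiplication by `c ∈ R` on the tangent space `Lie_E(R)`, induced by `ε ↦ c ε`. -/
def lieScalar (E : CommAlgCat.{u} L ⥤ ModuleCat.{u} F) {R : Type u} [CommRing R] [Algebra L R]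
    (c : R) : Lie E R →ₗ[F] Lie E R :=
  (ptsBaseChange E (dualScale L c)).restrict fun x hx => by
    have hx' : ptsBaseChange E (TrivSqZeroExt.fstHom L R R) x = 0 := hx
    change ptsBaseChange E (TrivSqZeroExt.fstHom L R R) (ptsBaseChange E (dualScale L c) x) = 0
    have h : (TrivSqZeroExt.fstHom L R R).comp (dualScale L c) = TrivSqZeroExt.fstHom L R R := by
      ext x <;> simp [dualScale]
    have h2 : ptsBaseChange E (TrivSqZeroExt.fstHom L R R) (ptsBaseChange E (dualScale L c) x) =
        ptsBaseChange E ((TrivSqZeroExt.fstHom L R R).comp (dualScale L c)) x := by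
      simp only [ptsBaseChange, CommAlgCat.ofHom_comp, Functor.map_comp]
      rfl
    rw [h2, h, hx']

/-- The coordinates `E(R) → R^d` given by an isomorphism `κ : E ≅ 𝔾_a^d`. -/
def coord {E : CommAlgCat.{u} L ⥤ ModuleCat.{u} F} {d : ℕ} (κ : E ≅ Ga F L d)
    {R : Type u} [CommRing R] [Algebra L R] (x : Pts E R) : Fin d → R :=
  ptsMap κ.hom R x

/-- The coordinates `∂κ : Lie_E(R) → R^d` given by an isomorphism `κ : E ≅ 𝔾_a^d`; here
`v ∈ R^d` corresponds to the element `(v_1 ε, …, v_d ε)` of the kernel of `R[ε]^d → R^d`. -/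
def lieCoord {E : CommAlgCat.{u} L ⥤ ModuleCat.{u} F} {d : ℕ} (κ : E ≅ Ga F L d)
    {R : Type u} [CommRing R] [Algebra L R] (x : Lie E R) : Fin d → R :=
  fun i => (coord κ (x : Pts E (DualNumber R)) i).snd

theorem coord_add {E : CommAlgCat.{u} L ⥤ ModuleCat.{u} F} {d : ℕ} (κ : E ≅ Ga F L d)
    {R : Type u} [CommRing R] [Algebra L R] (x y : Pts E R) :
    coord κ (x + y) = coord κ x + coord κ y :=
  map_add (ptsMap κ.hom R) x y

theorem lieCoord_add {E : CommAlgCat.{u} L ⥤ ModuleCat.{u} F} {d : ℕ} (κ : E ≅ Ga F L d)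
    {R : Type u} [CommRing R] [Algebra L R] (x y : Lie E R) :
    lieCoord κ (x + y) = lieCoord κ x + lieCoord κ y := by
  funext i
  simp only [lieCoord, Submodule.coe_add, coord_add, Pi.add_apply, TrivSqZeroExt.snd_add]

end Functors

section GaussCompletion

variable {F : Type u} [Field F] (B : Type u) [CommRing B] [Algebra F B] {V : Type u}
  [AddCommGroup V] [Module F V]

/-- The values `max_i |v_i|`, for all the representations `x = ∑_i b_i ⊗ v_i`. -/
def gaussValues (ν : AddGroupSeminorm V) (x : B ⊗[F] V) : Set ℝ :=
  {r | ∃ (n : ℕ) (b : Fin n → B) (v : Fin n → V), x = ∑ i, b i ⊗ₜ[F] v i ∧ r = ⨆ i, ν (v i)}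

theorem gaussValues_nonneg (ν : AddGroupSeminorm V) (x : B ⊗[F] V) {r : ℝ}
    (h : r ∈ gaussValues B ν x) : 0 ≤ r := by
  obtain ⟨n, b, v, -, rfl⟩ := h
  exact Real.iSup_nonneg fun i => apply_nonneg ν _

theorem gaussValues_nonempty (ν : AddGroupSeminorm V) (x : B ⊗[F] V) :
    (gaussValues B ν x).Nonempty := by
  induction x using TensorProduct.induction_on with
  | zero => exact ⟨_, 0, Fin.elim0, Fin.elim0, by simp, rfl⟩
  | tmul b v => exact ⟨_, 1, fun _ => b, fun _ => v, by simp, rfl⟩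
  | add x y hx hy =>
    obtain ⟨_, n, b, v, hx, -⟩ := hx
    obtain ⟨_, m, c, w, hy, -⟩ := hy
    exact ⟨_, n + m, Fin.append b c, Fin.append v w, by simp [Fin.sum_univ_add, hx, hy], rfl⟩

theorem gaussValues_bddBelow (ν : AddGroupSeminorm V) (x : B ⊗[F] V) :
    BddBelow (gaussValues B ν x) :=
  ⟨0, fun _ h => gaussValues_nonneg B ν x h⟩

/-- The Gauss norm `‖x‖ = inf (max_i |v_i|)` on `B ⊗ V`, the infimum being taken over all the
representations `x = ∑_i b_i ⊗ v_i`. -/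
def gaussSeminorm (ν : AddGroupSeminorm V) : AddGroupSeminorm (B ⊗[F] V) where
  toFun x := sInf (gaussValues B ν x)
  map_zero' := by
    refine le_antisymm (csInf_le (gaussValues_bddBelow B ν 0) ?_)
      (Real.sInf_nonneg fun r h => gaussValues_nonneg B ν 0 h)
    exact ⟨0, Fin.elim0, Fin.elim0, by simp, by simp⟩
  add_le' x y := by
    refine le_of_forall_pos_lt_add fun ε hε => ?_
    obtain ⟨r, ⟨n, b, v, hx, rfl⟩, hr⟩ :=
      exists_lt_of_csInf_lt (gaussValues_nonempty B ν x) (lt_add_of_pos_right _ (half_pos hε))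
    obtain ⟨s, ⟨m, c, w, hy, rfl⟩, hs⟩ :=
      exists_lt_of_csInf_lt (gaussValues_nonempty B ν y) (lt_add_of_pos_right _ (half_pos hε))
    have hmem : (⨆ i, ν (Fin.append v w i)) ∈ gaussValues B ν (x + y) :=
      ⟨n + m, Fin.append b c, Fin.append v w, by simp [Fin.sum_univ_add, hx, hy], rfl⟩
    have h0v : 0 ≤ ⨆ i, ν (v i) := Real.iSup_nonneg fun i => apply_nonneg ν _
    have h0w : 0 ≤ ⨆ i, ν (w i) := Real.iSup_nonneg fun i => apply_nonneg ν _
    have hle : (⨆ i, ν (Fin.append v w i)) ≤ (⨆ i, ν (v i)) + ⨆ i, ν (w i) := by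
      refine Real.iSup_le (fun i => ?_) (add_nonneg h0v h0w)
      refine Fin.addCases (fun j => ?_) (fun j => ?_) i
      · rw [Fin.append_left]
        exact (le_ciSup (f := fun i => ν (v i)) (Set.finite_range _).bddAbove j).trans
          (le_add_of_nonneg_right h0w)
      · rw [Fin.append_right]
        exact (le_ciSup (f := fun i => ν (w i)) (Set.finite_range _).bddAbove j).trans
          (le_add_of_nonneg_left h0v)
    have := csInf_le (gaussValues_bddBelow B ν (x + y)) hmem
    linarith
  neg' x := by
    have key : ∀ y : B ⊗[F] V, gaussValues B ν y ⊆ gaussValues B ν (-y) := by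
      rintro y r ⟨n, b, v, rfl, rfl⟩
      exact ⟨n, fun i => -b i, v, by simp [TensorProduct.neg_tmul], rfl⟩
    congr 1
    refine Set.Subset.antisymm ?_ (key x)
    simpa using key (-x)

/-- `B ⊗ V`, with the topology of the Gauss norm attached to the norm `ν` on `V`. -/
def GaussTensor (_ν : AddGroupSeminorm V) : Type u := B ⊗[F] V

instance (ν : AddGroupSeminorm V) : SeminormedAddCommGroup (GaussTensor (F := F) B ν) :=
  (gaussSeminorm B ν).toSeminormedAddCommGroup

instance (ν : AddGroupSeminorm V) : Module B (GaussTensor (F := F) B ν) :=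
  inferInstanceAs (Module B (B ⊗[F] V))

theorem gauss_norm_smul_le (ν : AddGroupSeminorm V) (c : B) (x : GaussTensor (F := F) B ν) :
    ‖c • x‖ ≤ ‖x‖ := by
  refine le_csInf (gaussValues_nonempty B ν x) ?_
  rintro r ⟨n, b, v, hx, rfl⟩
  refine csInf_le (gaussValues_bddBelow B ν _) ⟨n, fun i => c * b i, v, ?_, rfl⟩
  have hx' : (c • x : GaussTensor (F := F) B ν) = c • (∑ i, b i ⊗ₜ[F] v i : B ⊗[F] V) :=
    congrArg (fun y : B ⊗[F] V => c • y) hx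
  refine hx'.trans ?_
  rw [Finset.smul_sum]
  rfl

instance (ν : AddGroupSeminorm V) : UniformContinuousConstSMul B (GaussTensor (F := F) B ν) :=
  ⟨fun c => (LipschitzWith.of_dist_le_mul (K := 1) fun x y => by
    rw [dist_eq_norm, dist_eq_norm, ← smul_sub, NNReal.coe_one, one_mul]
    exact gauss_norm_smul_le B ν c (x - y)).uniformContinuous⟩

/-- The completion `B ⊗̂ V` of `B ⊗ V` for the Gauss norm. It is a `B`-module: the action of `b` is
the continuous extension of `b ⊗ 1`. -/
abbrev GaussCompletion (ν : AddGroupSeminorm V) : Type u :=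
  UniformSpace.Completion (GaussTensor (F := F) B ν)

/-- The canonical map `B ⊗ V → B ⊗̂ V`. -/
def toGauss (ν : AddGroupSeminorm V) (x : B ⊗[F] V) : GaussCompletion (F := F) B ν :=
  UniformSpace.Completion.coe' (α := GaussTensor (F := F) B ν) x

/-- The continuous extension `id ⊗̂ f : B ⊗̂ V → B ⊗̂ W` of `id ⊗ f : B ⊗ V → B ⊗ W`, for a continuous
`𝔽`-linear map `f : V → W`. -/
def gaussMap {W : Type u} [AddCommGroup W] [Module F W] (ν : AddGroupSeminorm V)
    (μ : AddGroupSeminorm W) (f : V →ₗ[F] W) :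
    GaussCompletion (F := F) B ν → GaussCompletion (F := F) B μ :=
  UniformSpace.Completion.map (α := GaussTensor (F := F) B ν) (β := GaussTensor (F := F) B μ)
    (f.lTensor B)

end GaussCompletion

section Anderson

variable {F : Type u} [Field F] [Fintype F]

/-- An Anderson `𝔽[t]`-module `(E, φ)` of dimension `d` over `L`, where `K ⊆ L ⊆ ℂ_∞`. -/
structure AndersonModule (L : IntermediateField (RatFunc F) (CInf F)) (d : ℕ) where
  /-- The `𝔽`-vector space scheme `E`, given by its functor of points. -/
  E : CommAlgCat.{u} L ⥤ ModuleCat.{u} F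
  /-- `E` is isomorphic to `𝔾_{a,L}^d` as an `𝔽`-vector space scheme over `L`. -/
  isoGa : Nonempty (E ≅ Ga F L d)
  /-- The action `a ↦ φ_a` by endomorphisms of the `𝔽`-vector space scheme `E`. -/
  φ : F[X] →ₐ[F] End E
  /-- `∂φ_a - ℓ(a)` is nilpotent on `Lie_E(L)`. -/
  nilpotent : ∀ a : F[X], IsNilpotent
    ((lieMap (φ a) L - lieScalar E (algebraMap (RatFunc F) L (algebraMap F[X] (RatFunc F) a)) :
      Module.End F (Lie E L)))

namespace AndersonModule

variable {L : IntermediateField (RatFunc F) (CInf F)} {d : ℕ} (M : AndersonModule L d)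

/-- `E(ℂ_∞)`. -/
abbrev Points : Type u := Pts M.E (CInf F)

/-- `Lie_E(ℂ_∞)`. -/
abbrev LieC : Type u := Lie M.E (CInf F)

/-- The action of `a ∈ A` on `E(ℂ_∞)` through `φ_a`. -/
def act (a : F[X]) : M.Points →ₗ[F] M.Points := ptsMap (M.φ a) (CInf F)

/-- The action of `A` on `Lie_E(ℂ_∞)`, `a ↦ ∂a = ∂φ_a`. -/
def del : F[X] →+* Module.End F M.LieC where
  toFun a := lieMap (M.φ a) (CInf F)
  map_one' := by
    rw [map_one]
    rfl
  map_mul' a b := by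
    rw [map_mul]
    rfl
  map_zero' := by
    rw [map_zero]
    rfl
  map_add' a b := by
    rw [map_add]
    rfl

/-- The properties that characterize the exponential function of `E`:
it is an `𝔽`-linear map `Lie_E(ℂ_∞) → E(ℂ_∞)` such that `exp (∂a x) = a exp(x)`, and in the
coordinates of any isomorphism `κ : E ≅ 𝔾_a^d` it is given by an everywhere convergent series
`x + e_1 τ(x) + e_2 τ²(x) + …`. -/
def IsExponential (f : M.LieC →ₗ[F] M.Points) : Prop :=
  (∀ (a : F[X]) (x : M.LieC), f (M.del a x) = M.act a (f x)) ∧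
  ∀ κ : M.E ≅ Ga F L d, ∃ e : ℕ → Matrix (Fin d) (Fin d) (CInf F), e 0 = 1 ∧
    ∀ x : M.LieC, HasSum
      (fun n : ℕ => (e n).mulVec fun i => lieCoord κ x i ^ (Fintype.card F) ^ n) (coord κ (f x))

open Classical in
/-- The exponential function `exp_E`, the unique map with the properties above. -/
def exp : M.LieC →ₗ[F] M.Points :=
  if h : ∃ f, M.IsExponential f then h.choose else 0

theorem exp_del (a : F[X]) (x : M.LieC) : M.exp (M.del a x) = M.act a (M.exp x) := by
  unfold exp
  split_ifs with h
  · exact h.choose_spec.1 a x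
  · simp

/-- The period lattice `Λ_E = ker exp_E`. -/
def periods : Submodule F M.LieC := LinearMap.ker M.exp

/-- `Λ_E` is an `A`-module through `a ↦ ∂a`. -/
instance : Module F[X] M.periods where
  smul a x := ⟨M.del a x, by
    have hx : M.exp (x : M.LieC) = 0 := x.2
    change M.exp (M.del a x) = 0
    rw [exp_del, hx, map_zero]⟩
  one_smul x := Subtype.ext (by change M.del 1 x = x; rw [map_one]; rfl)
  mul_smul a b x := Subtype.ext (by
    change M.del (a * b) x = M.del a (M.del b x); rw [map_mul]; rfl)
  smul_zero a := Subtype.ext (map_zero (M.del a))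
  smul_add a x y := Subtype.ext (map_add (M.del a) (x : M.LieC) y)
  add_smul a b x := Subtype.ext (by
    change M.del (a + b) x = M.del a x + M.del b x; rw [map_add]; rfl)
  zero_smul x := Subtype.ext (by change M.del 0 x = 0; rw [map_zero]; rfl)

/-- The norm on `E(ℂ_∞)` induced by an isomorphism `κ : E ≅ 𝔾_a^d` and the maximum norm on
`ℂ_∞^d`. -/
def normPoints (κ : M.E ≅ Ga F L d) : AddGroupSeminorm M.Points where
  toFun x := ‖coord κ x‖
  map_zero' := by
    have h := coord_add κ (0 : M.Points) 0
    simp only [add_zero, left_eq_add] at h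
    rw [h, norm_zero]
  add_le' x y := by rw [coord_add]; exact norm_add_le _ _
  neg' x := by
    have h : coord κ (-x) = -coord κ x := map_neg (ptsMap κ.hom (CInf F)) x
    rw [h, norm_neg]

/-- The norm on `Lie_E(ℂ_∞)` induced by `∂κ` and the maximum norm on `ℂ_∞^d`. -/
def normLie (κ : M.E ≅ Ga F L d) : AddGroupSeminorm M.LieC where
  toFun x := ‖lieCoord κ x‖
  map_zero' := by
    have h := lieCoord_add κ (0 : M.LieC) 0
    simp only [add_zero, left_eq_add] at h
    rw [h, norm_zero]
  add_le' x y := by rw [lieCoord_add]; exact norm_add_le _ _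
  neg' x := by
    have h := lieCoord_add κ x (-x)
    have h0 := lieCoord_add κ (0 : M.LieC) 0
    simp only [add_zero, left_eq_add] at h0
    rw [add_neg_cancel, h0] at h
    rw [← norm_neg, eq_neg_of_add_eq_zero_right h.symm, neg_neg]

variable (κ : M.E ≅ Ga F L d)

/-- `E(𝕋) = A ⊗̂ E(ℂ_∞)`. -/
abbrev ET : Type u := GaussCompletion (F := F) F[X] (M.normPoints κ)

/-- `Lie_E(𝕋) = A ⊗̂ Lie_E(ℂ_∞)`. -/
abbrev LieT : Type u := GaussCompletion (F := F) F[X] (M.normLie κ)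

/-- The action of `1 ⊗ a` on `E(𝕋)`. -/
def actT (a : F[X]) : M.ET κ → M.ET κ := gaussMap F[X] (M.normPoints κ) (M.normPoints κ) (M.act a)

/-- The action `1 ⊗ ∂a` of `1 ⊗ a` on `Lie_E(𝕋)`. -/
def delT (a : F[X]) : M.LieT κ → M.LieT κ := gaussMap F[X] (M.normLie κ) (M.normLie κ) (M.del a)

/-- The map `id ⊗̂ exp_E : Lie_E(𝕋) → E(𝕋)`. -/
def expT : M.LieT κ → M.ET κ := gaussMap F[X] (M.normLie κ) (M.normPoints κ) M.exp

/-- The special functions: the elements of `E(𝕋)` on which `a ⊗ 1` and `1 ⊗ a` act in the same way,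
for all `a ∈ A`. -/
def sf : Set (M.ET κ) := {ω | ∀ a : F[X], a • ω = M.actT κ a ω}

/-- The map `1 ⊗ ∂u - u ⊗ 1` on `Lie_E(𝕋)`. -/
def twist (u : F[X]) : M.LieT κ → M.LieT κ := fun y => M.delT κ u y - u • y

/-- The element `(id ⊗̂ exp_E) ((1 ⊗ ∂u - u ⊗ 1)⁻¹ x)` of `E(𝕋)`, for `x ∈ Lie_E(𝕋)`. -/
def expTwistInv (u : F[X]) (x : M.LieT κ) : M.ET κ := M.expT κ (Function.invFun (M.twist κ u) x)

/-- The element `a ⊗ l` of `Lie_E(𝕋)`, for `a ∈ A` and a period `l`. -/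
def periodT (a : F[X]) (l : M.periods) : M.LieT κ :=
  toGauss F[X] (M.normLie κ) (a ⊗ₜ[F] (l : M.LieC))

end AndersonModule

/-- The subring `𝔽[u]` of `A = 𝔽[t]`. -/
abbrev polySubring (u : F[X]) : Subalgebra F F[X] := Algebra.adjoin F {u}

/-- `u ∈ A` is separating if the extension `K / 𝔽(u)` is finite and separable. -/
def IsSeparating (u : F[X]) : Prop :=
  FiniteDimensional (IntermediateField.adjoin F {algebraMap F[X] (RatFunc F) u}) (RatFunc F) ∧
  Algebra.IsSeparable (IntermediateField.adjoin F {algebraMap F[X] (RatFunc F) u}) (RatFunc F)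

namespace AndersonModule

variable {L : IntermediateField (RatFunc F) (CInf F)} {d : ℕ} (M : AndersonModule L d)

/-- `𝔡_{A/𝔽[u]} · Λ_E`, with the relative different `𝔡_{A/𝔽[u]} ⊆ A` of `𝔽[u] ⊆ A`. -/
def differentPeriods (u : F[X]) : Submodule F[X] M.periods :=
  differentIdeal (polySubring u) F[X] • ⊤

/-- The action of `1 ⊗ b` on `A ⊗_{𝔽[u]} Λ_E`. -/
def rightAct (u b : F[X]) :
    F[X] ⊗[polySubring u] M.periods →ₗ[polySubring u] F[X] ⊗[polySubring u] M.periods :=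
  ((LinearMap.lsmul F[X] M.periods b).restrictScalars (polySubring u)).lTensor F[X]

/-- The multiplication map `A ⊗_{𝔽[u]} Λ_E → Λ_E`. -/
def mulMap (u : F[X]) : F[X] ⊗[polySubring u] M.periods →ₗ[polySubring u] M.periods :=
  TensorProduct.lift <| LinearMap.mk₂ (polySubring u) (fun (a : F[X]) (l : M.periods) => a • l)
    (fun a b l => add_smul a b l) (fun c a l => smul_assoc c a l)
    (fun a l m => smul_add a l m) (fun c a l => smul_comm a c l)

variable (κ : M.E ≅ Ga F L d)

/-- The graph of `δ̃_u`: `ω = δ̃_u(x) = (id ⊗̂ exp_E) ((1 ⊗ ∂u - u ⊗ 1)⁻¹ x)` for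
`x = ∑ i, a_i ⊗ l_i` in `A ⊗_{𝔽[u]} Λ_E`. -/
def IsDeltaTilde (u : F[X]) (x : F[X] ⊗[polySubring u] M.periods) (ω : M.ET κ) : Prop :=
  ∃ (n : ℕ) (a : Fin n → F[X]) (l : Fin n → M.periods),
    x = ∑ i, a i ⊗ₜ[polySubring u] l i ∧ ω = M.expTwistInv κ u (∑ i, M.periodT κ (a i) (l i))

/-- The graph of `δ_u`: `ω = δ̃_u(x)` for an `x ∈ A ⊗_{𝔽[u]} Λ_E` on which the two actions of `A`
coincide and which the multiplication map sends to `y`. -/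
def IsDelta (u : F[X]) (y : M.periods) (ω : M.ET κ) : Prop :=
  ∃ x : F[X] ⊗[polySubring u] M.periods,
    (∀ b : F[X], b • x = M.rightAct u b x) ∧ M.mulMap u x = y ∧ M.IsDeltaTilde κ u x ω

/-- The map `δ_u`, on `𝔡_{A/𝔽[u]} · Λ_E`: its value at `y` is the `ω` with `IsDelta u y ω`. -/
def delta (u : F[X]) (y : M.periods) : M.ET κ := Classical.epsilon (M.IsDelta κ u y)

end AndersonModule
end Anderson
end AndersonT

end

set_option linter.unusedSectionVars false

noncomputable section

namespace AndersonT

/-! ### Absolute values on ℂ_∞. -/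

section CInfty

variable (F : Type u) [Field F] [Fintype F]

/-! The algebraic heart is the divided difference g_u = (1⊗u − u⊗1)/(1⊗t − t⊗1) in A⊗A. Write Λ for
the period lattice and ω_λ for the generating function of λ. The module A ⊗_{𝔽[u]} Λ is the cokernel
of 1⊗u − u⊗1 on A⊗Λ (`exists_of_toRel_eq_zero`), and 1⊗t − t⊗1 is injective on A⊗Λ
(`eq_zero_of_tensorRight_X`). A class on which the two actions of A agree therefore lifts to w with
(1⊗t − t⊗1)w = (1⊗u − u⊗1)z, which forces w = g_u z. Two facts about g_u finish the argument
(`exists_dividedDifference`). Multiplication A⊗A → A sends g_u to u', so w has product u'λ, where λ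
is the product of z. Moreover (1⊗∂u − u⊗1)⁻¹ g_u z = (1⊗∂t − t⊗1)⁻¹ z, and u has disappeared from
the right-hand side. Applying exp to it gives ω_λ, because λ ↦ ω_λ is A-linear
(`expTwistInv_X_periodsT`). Hence the graph of δ_u consists of the pairs (u'λ, ω_λ) (`isDelta_iff`);
it is single-valued because ∂u' is invertible. The domain is right because A = 𝔽[u][t] and t is a
root of u(T) − u, so the different is generated by u' (`differentIdeal_polySubring`).

The analysis rests on one remark: as ∂a − a is nilpotent in characteristic p, the operator ∂a^{q^k}
is the scalar a^{q^k} for large k (`exists_del_pow_card`). First, this makes ∂u invertible for u ≠ 0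
and, for nonconstant u, some power of u⊗∂u⁻¹ a contraction, so that 1⊗∂u − u⊗1 is inverted by a
Neumann series (`twist_bijective_and_hasSum`). Secondly, it yields the exponential. With θ = t^{q^k}
the equation exp(θx) = φ_{t^{q^k}}(exp x) is a recursion with nonzero scalar denominators, whose
solution converges everywhere; a rigidity argument (`eq_zero_of_semiconj`) gives compatibility with
all other a ∈ A.

For the bijectivity of δ_t, a special function is read as a null sequence of coefficients e_n with
φ_t e_{n+1} = e_n and φ_t e_0 = 0. Since exp is bijective near 0 (`exists_exp_local`), such a
sequence lifts to Lie_E and there comes from exactly one period. -/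

instance : IsUltrametricDist (CInf F) := by
  have h : IsUltrametricDist (UniformSpace.Completion (AlgebraicClosure (KInf F))) := by
    refine IsUltrametricDist.isUltrametricDist_of_forall_norm_add_le_max_norm fun x y => ?_
    induction x, y using UniformSpace.Completion.induction_on₂ with
    | hp =>
      exact isClosed_le ((continuous_fst.add continuous_snd).norm)
        ((continuous_fst.norm).max (continuous_snd.norm))
    | ih x y =>
      rw [← UniformSpace.Completion.coe_add]
      simp only [UniformSpace.Completion.norm_coe]
      exact isNonarchimedean_spectralNorm x y
  exact h

/-- The element `t` of `ℂ_∞`. -/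
def tInf : CInf F := algebraMap (RatFunc F) (CInf F) RatFunc.X

theorem one_lt_norm_tInf : 1 < ‖tInf F‖ := by
  have h1 : ‖tInf F‖ = ‖algebraMap (RatFunc F) (KInf F) RatFunc.X‖ := by
    change ‖(UniformSpace.Completion.coe' (α := AlgebraicClosure (KInf F))
      (algebraMap (KInf F) (AlgebraicClosure (KInf F))
        (algebraMap (RatFunc F) (KInf F) RatFunc.X)))‖ = _
    rw [UniformSpace.Completion.norm_coe]
    exact spectralNorm_extends _
  rw [h1]
  refine (Valued.toNormedField.one_lt_norm_iff (L := KInf F)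
    (Γ₀ := WithZero (Multiplicative ℤ))).mpr ?_
  rw [valued_X, ← WithZero.exp_zero, WithZero.exp_lt_exp]
  exact one_pos

variable {F}

/-- Nonzero constants are roots of unity. -/
theorem norm_algebraMap_of_ne_zero {c : F} (hc : c ≠ 0) : ‖algebraMap F (CInf F) c‖ = 1 := by
  have h : algebraMap F (CInf F) c ^ (Fintype.card F - 1) = 1 := by
    rw [← map_pow, FiniteField.pow_card_sub_one_eq_one c hc, map_one]
  have h2 : 1 < Fintype.card F := Fintype.one_lt_card
  have h3 := congrArg norm h
  rw [norm_pow, norm_one] at h3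
  exact (pow_eq_one_iff_of_nonneg (norm_nonneg _) (by omega)).mp h3

theorem norm_algebraMap_le (c : F) : ‖algebraMap F (CInf F) c‖ ≤ 1 := by
  by_cases hc : c = 0
  · simp [hc]
  · exact (norm_algebraMap_of_ne_zero hc).le

/-- The image of `a ∈ A` in `ℂ_∞`. -/
def polyInf (a : F[X]) : CInf F := algebraMap (RatFunc F) (CInf F) (algebraMap F[X] (RatFunc F) a)

theorem polyInf_eq_sum (a : F[X]) :
    polyInf a = a.sum fun n c => algebraMap F (CInf F) c * tInf F ^ n := by
  conv_lhs => rw [← a.sum_C_mul_X_pow_eq]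
  simp only [polyInf, Polynomial.sum, map_sum, map_mul, map_pow]
  refine Finset.sum_congr rfl fun n _ => ?_
  rw [RatFunc.algebraMap_X, RatFunc.algebraMap_C]
  rfl

/-- As |t| > 1 and nonzero constants have norm 1, the leading term strictly dominates. -/
theorem norm_polyInf {a : F[X]} (ha : a ≠ 0) : ‖polyInf a‖ = ‖tInf F‖ ^ a.natDegree := by
  have ht := one_lt_norm_tInf F
  have ht0 : (0 : ℝ) < ‖tInf F‖ := by linarith
  rw [polyInf_eq_sum, Polynomial.sum_over_range _ (by simp), Finset.sum_range_succ]
  have h1 : ‖algebraMap F (CInf F) (a.coeff a.natDegree) * tInf F ^ a.natDegree‖ =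
      ‖tInf F‖ ^ a.natDegree := by
    rw [norm_mul, norm_pow, norm_algebraMap_of_ne_zero (by simpa using ha), one_mul]
  by_cases hn : a.natDegree = 0
  · rw [hn, Finset.range_zero, Finset.sum_empty, zero_add, ← hn, h1]
  have h2 : ‖∑ n ∈ Finset.range a.natDegree, algebraMap F (CInf F) (a.coeff n) * tInf F ^ n‖ <
      ‖tInf F‖ ^ a.natDegree := by
    refine lt_of_le_of_lt (IsUltrametricDist.norm_sum_le_of_forall_le_of_nonneg
      (C := ‖tInf F‖ ^ (a.natDegree - 1)) (by positivity) fun i hi => ?_)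
      (pow_lt_pow_right₀ ht (by omega))
    rw [norm_mul, norm_pow]
    calc _ ≤ 1 * ‖tInf F‖ ^ i := by gcongr; exact norm_algebraMap_le _
      _ ≤ _ := by
        rw [one_mul]
        exact pow_le_pow_right₀ ht.le (by have := Finset.mem_range.mp hi; omega)
  rw [← h1] at h2 ⊢
  rw [IsUltrametricDist.norm_add_eq_max_of_norm_ne_norm h2.ne, max_eq_right h2.le]

theorem polyInf_ne_zero {a : F[X]} (ha : a ≠ 0) : polyInf a ≠ 0 := by
  rw [← norm_pos_iff, norm_polyInf ha]
  have := one_lt_norm_tInf F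
  positivity

theorem one_lt_norm_polyInf {a : F[X]} (ha : a.natDegree ≠ 0) : 1 < ‖polyInf a‖ := by
  rw [norm_polyInf (by rintro rfl; simp at ha)]
  exact one_lt_pow₀ (one_lt_norm_tInf F) ha

end CInfty

/-! ### Additive and 𝔽-homogeneous polynomials. -/

section Additive

/-- A polynomial that is additive on all algebras. -/
theorem hasseDeriv_of_additive {L : Type u} [Field L] (P : L[X])
    (hP : (P.map (C : L →+* L[X])).comp (X + C X) = P.map C + C P) (k : ℕ) (hk : k ≠ 0) :
    hasseDeriv k P = C (P.coeff k) := by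
  have h := congrArg (fun Q : L[X][X] => Q.coeff k) hP
  -- P(X + Y) is expanded in the outer variable around the inner one: its coefficient of degree k is
  -- the k-th Hasse derivative at the inner variable, while additivity leaves only the constant
  -- `P.coeff k`.
  change (taylor X (P.map C)).coeff k = _ at h
  rw [taylor_coeff, coeff_add, coeff_C_of_ne_zero hk, add_zero, coeff_map] at h
  rw [← h]
  have : hasseDeriv k (P.map (C : L →+* L[X])) = (hasseDeriv k P).map C := by
    ext1 n
    simp [hasseDeriv_coeff]
  rw [this, Polynomial.eval_map, ← Polynomial.aeval_X_left_apply (hasseDeriv k P), aeval_def]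
  simp

/-- The k-th Hasse derivative is constant, so its coefficient in the positive degree n − k vanishes.
-/
theorem coeff_mul_choose_eq_zero {L : Type u} [Field L] (P : L[X])
    (hP : (P.map (C : L →+* L[X])).comp (X + C X) = P.map C + C P) {n k : ℕ} (hk : k ≠ 0)
    (hkn : k < n) : ((n.choose k : ℕ) : L) * P.coeff n = 0 := by
  have h := congrArg (fun Q : L[X] => Q.coeff (n - k)) (hasseDeriv_of_additive P hP k hk)
  simp only [hasseDeriv_coeff, coeff_C_of_ne_zero (show n - k ≠ 0 by omega)] at h
  rwa [Nat.sub_add_cancel hkn.le] at h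

/-- For n = p^v m with p ∤ m, take k = p^v. Since (1 + X)^n = (1 + X^{p^v})^m modulo p, the binomial
coefficient is congruent to m. -/
theorem exists_choose_not_dvd {p : ℕ} [hp : Fact p.Prime] {n : ℕ} (hn : n ≠ 0)
    (h : ∀ v, n ≠ p ^ v) : ∃ k, k ≠ 0 ∧ k < n ∧ ¬ p ∣ n.choose k := by
  obtain ⟨v, m, hm, rfl⟩ := Nat.exists_eq_pow_mul_and_not_dvd hn p hp.out.ne_one
  have hp0 : 0 < p := hp.out.pos
  have hm1 : m ≠ 1 := by rintro rfl; exact h v (by simp)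
  have hm0 : m ≠ 0 := by rintro rfl; simp at hm
  refine ⟨p ^ v, by positivity, ?_, ?_⟩
  · exact lt_mul_of_one_lt_right (by positivity) (by omega)
  · intro hd
    apply hm
    have key : ((p ^ v * m).choose (p ^ v * 1) : ZMod p) = (m.choose 1 : ZMod p) := by
      rw [mul_one, ← coeff_one_add_X_pow (ZMod p) (p ^ v * m) (p ^ v),
        ← coeff_one_add_X_pow (ZMod p) m 1, pow_mul, add_pow_char_pow, one_pow]
      have : (1 + X ^ p ^ v : (ZMod p)[X]) ^ m = expand (ZMod p) (p ^ v) ((1 + X) ^ m) := by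
        simp
      rw [this]
      have h1 := coeff_expand_mul (R := ZMod p) (p := p ^ v) (by positivity) ((1 + X) ^ m) 1
      rwa [one_mul] at h1
    rw [mul_one, Nat.choose_one_right, (ZMod.natCast_eq_zero_iff _ _).mpr hd] at key
    exact (ZMod.natCast_eq_zero_iff _ _).mp key.symm

/-- Additivity excludes every exponent that is not a power p^v of the characteristic. Homogeneity
gives c^n = c on 𝔽, which then forces v to be a multiple of f, where q = p^f. -/
theorem eq_card_pow_of_coeff_ne_zero {F L : Type u} [Field F] [Fintype F] [Field L] [Algebra F L]
    (P : L[X]) (hP : (P.map (C : L →+* L[X])).comp (X + C X) = P.map C + C P)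
    (hF : ∀ c : F, P.comp (C (algebraMap F L c) * X) = C (algebraMap F L c) * P) {n : ℕ}
    (hn : P.coeff n ≠ 0) : ∃ k, n = Fintype.card F ^ k := by
  obtain ⟨p, hp⟩ := CharP.exists F
  obtain ⟨f, hpp, hf⟩ := FiniteField.card F p
  have : Fact p.Prime := ⟨hpp⟩
  have : CharP L p := charP_of_injective_algebraMap (algebraMap F L).injective p
  have hc : ∀ c : F, c ^ n = c := fun c => by
    have h := congrArg (fun Q : L[X] => Q.coeff n) (hF c)
    simp only [comp_C_mul_X_coeff, coeff_C_mul] at h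
    rw [mul_comm] at h
    have h2 := mul_right_cancel₀ hn h
    rw [← map_pow] at h2
    exact (algebraMap F L).injective h2
  have hn0 : n ≠ 0 := by
    rintro rfl
    simpa using hc 0
  have hpow : ∃ v, n = p ^ v := by
    by_contra! hv
    obtain ⟨k, hk, hkn, hd⟩ := exists_choose_not_dvd (p := p) hn0 hv
    rcases mul_eq_zero.mp (coeff_mul_choose_eq_zero P hP hk hkn) with h | h
    · exact hd ((CharP.cast_eq_zero_iff L p _).mp h)
    · exact hn h
  obtain ⟨v, rfl⟩ := hpow
  have hf0 : (f : ℕ) ≠ 0 := f.pos.ne'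
  have hper : ∀ c : F, c ^ p ^ (v % f) = c := fun c => by
    have h := hc c
    have h3 : (c ^ p ^ ((f : ℕ) * (v / f))) = c := by
      rw [pow_mul, ← hf]
      exact FiniteField.pow_card_pow _ _
    conv at h => lhs; rw [← Nat.div_add_mod v f, pow_add, pow_mul, h3]
    exact h
  -- With a positive remainder r, all q elements of 𝔽 would be roots of X^{p^r} − X, whose degree is
  -- less than q.
  have hr : v % f = 0 := by
    by_contra h0
    have hlt : p ^ (v % f) < Fintype.card F := by
      rw [hf]; exact Nat.pow_lt_pow_right hpp.one_lt (Nat.mod_lt _ f.pos)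
    have hne : (X ^ p ^ (v % f) - X : F[X]) ≠ 0 :=
      FiniteField.X_pow_card_pow_sub_X_ne_zero F h0 hpp.one_lt
    have h1 : Fintype.card F ≤ (X ^ p ^ (v % f) - X : F[X]).natDegree := by
      rw [← Finset.card_univ]
      exact Polynomial.card_le_degree_of_subset_roots (by
        intro c _
        simp [mem_roots hne, hper c])
    rw [FiniteField.X_pow_card_pow_sub_X_natDegree_eq F h0 hpp.one_lt] at h1
    omega
  refine ⟨v / f, ?_⟩
  rw [hf, ← pow_mul]
  congr 1
  have := Nat.div_add_mod v f
  omega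

theorem exists_eq_sum_of_additive {F L : Type u} [Field F] [Fintype F] [Field L] [Algebra F L]
    (P : L[X]) (hP : (P.map (C : L →+* L[X])).comp (X + C X) = P.map C + C P)
    (hF : ∀ c : F, P.comp (C (algebraMap F L c) * X) = C (algebraMap F L c) * P) {N : ℕ}
    (hN : P.natDegree < N) :
    P = ∑ n ∈ Finset.range N,
      C (P.coeff (Fintype.card F ^ n)) * X ^ (Fintype.card F ^ n) := by
  have hq : 1 < Fintype.card F := Fintype.one_lt_card
  ext m
  simp only [finsetSum_coeff, coeff_C_mul, coeff_X_pow]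
  by_cases hm : P.coeff m = 0
  · rw [hm, eq_comm]
    refine Finset.sum_eq_zero fun n _ => ?_
    split_ifs with h
    · rw [← h, hm, zero_mul]
    · rw [mul_zero]
  · obtain ⟨k, rfl⟩ := eq_card_pow_of_coeff_ne_zero P hP hF hm
    rw [Finset.sum_eq_single k]
    · simp
    · intro b _ hb
      rw [if_neg (fun h => hb (Nat.pow_right_injective hq h).symm), mul_zero]
    -- An exponent k ≥ N is impossible, because q^k > k while q^k is at most the degree.
    · intro hk
      exfalso
      have h1 := le_natDegree_of_ne_zero hm
      have h2 : k < Fintype.card F ^ k := Nat.lt_pow_self hq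
      simp at hk
      omega

end Additive

/-! ### Morphisms between powers of 𝔾_a. -/

section GaHom

variable {F L : Type u} [Field F] [Field L] [Algebra F L] {d d' : ℕ}

/-- The map `R^d → R^d'` induced by a morphism `𝔾_a^d → 𝔾_a^d'`. -/
def gaMap (ψ : Ga F L d ⟶ Ga F L d') (R : Type u) [CommRing R] [Algebra L R] (v : Fin d → R) :
    Fin d' → R :=
  ptsMap ψ R v

theorem gaMap_add (ψ : Ga F L d ⟶ Ga F L d') (R : Type u) [CommRing R] [Algebra L R]
    (v w : Fin d → R) : gaMap ψ R (v + w) = gaMap ψ R v + gaMap ψ R w :=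
  map_add (ptsMap ψ R) v w

theorem gaMap_smul (ψ : Ga F L d ⟶ Ga F L d') (R : Type u) [CommRing R] [Algebra L R]
    (c : F) (v : Fin d → R) :
    gaMap ψ R (algebraMap F L c • v) = algebraMap F L c • gaMap ψ R v :=
  LinearMap.map_smul (ptsMap ψ R) c (v : Pts (Ga F L d) R)

theorem gaMap_comp (ψ : Ga F L d ⟶ Ga F L d') {R S : Type u} [CommRing R] [Algebra L R]
    [CommRing S] [Algebra L S] (g : R →ₐ[L] S) (v : Fin d → R) :
    gaMap ψ S (g ∘ v) = g ∘ gaMap ψ R v :=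
  ptsMap_ptsBaseChange ψ g v

theorem gaMap_sum (ψ : Ga F L d ⟶ Ga F L d') (R : Type u) [CommRing R] [Algebra L R]
    {ι : Type*} (s : Finset ι) (v : ι → Fin d → R) :
    gaMap ψ R (∑ i ∈ s, v i) = ∑ i ∈ s, gaMap ψ R (v i) :=
  map_sum (AddMonoidHom.mk' (gaMap ψ R) (gaMap_add ψ R)) v s

/-- The polynomial giving the `i`-th coordinate on the `j`-th axis. -/
def gaPoly (ψ : Ga F L d ⟶ Ga F L d') (i : Fin d') (j : Fin d) : L[X] :=
  gaMap ψ L[X] (Pi.single j X) i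

/-- Yoneda: r is the image of the universal point X ∈ L[X] under evaluation at r, and the morphism
is natural. -/
theorem gaMap_single (ψ : Ga F L d ⟶ Ga F L d') {R : Type u} [CommRing R] [Algebra L R] (j : Fin d)
    (r : R) (i : Fin d') : gaMap ψ R (Pi.single j r) i = aeval r (gaPoly ψ i j) := by
  have h := congrFun (gaMap_comp ψ (aeval r : L[X] →ₐ[L] R) (Pi.single j X)) i
  have h1 : (aeval r : L[X] →ₐ[L] R) ∘ (Pi.single j X) = (Pi.single j r : Fin d → R) := by
    ext k
    by_cases hk : k = j
    · subst hk; simp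
    · simp [Pi.single_eq_of_ne hk]
  rw [h1] at h
  exact h

theorem gaMap_apply (ψ : Ga F L d ⟶ Ga F L d') {R : Type u} [CommRing R] [Algebra L R]
    (v : Fin d → R) (i : Fin d') : gaMap ψ R v i = ∑ j, aeval (v j) (gaPoly ψ i j) := by
  conv_lhs => rw [← Finset.univ_sum_single v, gaMap_sum]
  rw [Finset.sum_apply]
  exact Finset.sum_congr rfl fun j _ => gaMap_single ψ j (v j) i

/-- Additivity of the morphism is applied to the universal pair of points, the two variables of
L[X][X]. -/
theorem gaPoly_additive (ψ : Ga F L d ⟶ Ga F L d') (i : Fin d') (j : Fin d) :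
    ((gaPoly ψ i j).map (C : L →+* L[X])).comp (X + C X) =
      (gaPoly ψ i j).map C + C (gaPoly ψ i j) := by
  have h := congrFun (gaMap_add ψ L[X][X] (Pi.single j X) (Pi.single j (C X))) i
  rw [← Pi.single_add, Pi.add_apply, gaMap_single, gaMap_single, gaMap_single] at h
  have h1 : ∀ r : L[X][X], aeval r (gaPoly ψ i j) =
      ((gaPoly ψ i j).map (C : L →+* L[X])).comp r := by
    intro r
    rw [comp, eval₂_map, aeval_def]
    rfl
  have h2 : aeval (C X : L[X][X]) (gaPoly ψ i j) = C (gaPoly ψ i j) := by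
    have := Polynomial.aeval_algebraMap_apply L[X][X] (X : L[X]) (gaPoly ψ i j)
    simpa using this
  rw [h2, h1, h1, comp_X] at h
  exact h

theorem gaPoly_homogeneous (ψ : Ga F L d ⟶ Ga F L d') (i : Fin d') (j : Fin d) (c : F) :
    (gaPoly ψ i j).comp (C (algebraMap F L c) * X) = C (algebraMap F L c) * gaPoly ψ i j := by
  have h := congrFun (gaMap_smul ψ L[X] c (Pi.single j X)) i
  rw [← Pi.single_smul, gaMap_single, Pi.smul_apply, gaMap_single] at h
  rw [aeval_X_left_apply, smul_eq_C_mul, smul_eq_C_mul] at h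
  rw [← h, comp, aeval_def]
  rfl

variable [Fintype F]

/-- Morphisms between powers of `𝔾_a` are given by matrices of `𝔽`-linear polynomials. -/
theorem exists_gaMap_eq (ψ : Ga F L d ⟶ Ga F L d') :
    ∃ (N : ℕ) (B : ℕ → Matrix (Fin d') (Fin d) L), 0 < N ∧ (∀ n, N ≤ n → B n = 0) ∧
      ∀ (R : Type u) [CommRing R] [Algebra L R] (v : Fin d → R),
        gaMap ψ R v = ∑ n ∈ Finset.range N,
          ((B n).map (algebraMap L R)).mulVec fun j => v j ^ (Fintype.card F) ^ n := by
  have hq : 1 < Fintype.card F := Fintype.one_lt_card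
  -- Larger than every degree involved; as q^n > n, the coefficients of X^{q^n} vanish for n ≥ N.
  let N := (∑ i, ∑ j, (gaPoly ψ i j).natDegree) + 1
  have hN : ∀ i j, (gaPoly ψ i j).natDegree < N := fun i j => by
    have h1 := Finset.single_le_sum (f := fun j => (gaPoly ψ i j).natDegree)
      (fun _ _ => Nat.zero_le _) (Finset.mem_univ j)
    have h2 := Finset.single_le_sum (f := fun i => ∑ j, (gaPoly ψ i j).natDegree)
      (fun _ _ => Nat.zero_le _) (Finset.mem_univ i)
    simp only [N]
    beta_reduce at h1 h2
    omega
  refine ⟨N, fun n => Matrix.of fun i j => (gaPoly ψ i j).coeff (Fintype.card F ^ n),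
    Nat.succ_pos _, fun n hn => ?_, fun R _ _ v => ?_⟩
  · ext i j
    simp only [Matrix.of_apply, Matrix.zero_apply]
    have : n < Fintype.card F ^ n := Nat.lt_pow_self hq
    exact coeff_eq_zero_of_natDegree_lt (by have := hN i j; omega)
  · ext i
    rw [gaMap_apply, Finset.sum_apply]
    simp only [Matrix.mulVec, dotProduct, Matrix.map_apply, Matrix.of_apply]
    rw [Finset.sum_comm]
    refine Finset.sum_congr rfl fun j _ => ?_
    conv_lhs => rw [exists_eq_sum_of_additive (F := F) (gaPoly ψ i j) (gaPoly_additive ψ i j)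
      (gaPoly_homogeneous ψ i j) (hN i j)]
    simp

end GaHom

/-! ### Points and tangent vectors in coordinates. -/

section Coordinates

variable {F L : Type u} [Field F] [Field L] [Algebra F L]
  {E E' : CommAlgCat.{u} L ⥤ ModuleCat.{u} F} {d d' : ℕ}
  {R : Type u} [CommRing R] [Algebra L R]

theorem coord_injective (κ : E ≅ Ga F L d) :
    Function.Injective (coord κ : Pts E R → Fin d → R) := by
  intro x y h
  have h2 : ∀ z : Pts E R, ptsMap κ.inv R (ptsMap κ.hom R z) = z := fun z => by
    change (κ.hom.app (CommAlgCat.of L R) ≫ κ.inv.app (CommAlgCat.of L R)).hom z = z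
    rw [Iso.hom_inv_id_app]
    rfl
  rw [← h2 x, ← h2 y]
  exact congrArg (ptsMap κ.inv R) h

/-- The point of `E` with given coordinates. -/
def coordInv (κ : E ≅ Ga F L d) (v : Fin d → R) : Pts E R := ptsMap κ.inv R (v : Pts (Ga F L d) R)

theorem coord_coordInv (κ : E ≅ Ga F L d) (v : Fin d → R) : coord κ (coordInv κ v) = v := by
  change (κ.inv.app (CommAlgCat.of L R) ≫ κ.hom.app (CommAlgCat.of L R)).hom v = v
  rw [Iso.inv_hom_id_app]
  rfl

theorem coord_zero (κ : E ≅ Ga F L d) : coord κ (0 : Pts E R) = 0 :=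
  map_zero (ptsMap κ.hom R)

theorem coord_sub (κ : E ≅ Ga F L d) (x y : Pts E R) : coord κ (x - y) = coord κ x - coord κ y :=
  map_sub (ptsMap κ.hom R) x y

theorem coord_smul (κ : E ≅ Ga F L d) (c : F) (x : Pts E R) :
    coord κ (c • x) = algebraMap F L c • coord κ x :=
  LinearMap.map_smul (ptsMap κ.hom R) c x

theorem coord_ptsBaseChange (κ : E ≅ Ga F L d) {S : Type u} [CommRing S] [Algebra L S]
    (g : R →ₐ[L] S) (x : Pts E R) : coord κ (ptsBaseChange E g x) = g ∘ coord κ x :=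
  ptsMap_ptsBaseChange κ.hom g x

/-- The morphism `φ` in coordinates. -/
def homCoord (κ : E ≅ Ga F L d) (κ' : E' ≅ Ga F L d') (φ : E ⟶ E') : Ga F L d ⟶ Ga F L d' :=
  κ.inv ≫ φ ≫ κ'.hom

theorem coord_ptsMap (κ : E ≅ Ga F L d) (κ' : E' ≅ Ga F L d') (φ : E ⟶ E') (x : Pts E R) :
    coord κ' (ptsMap φ R x) = gaMap (homCoord κ κ' φ) R (coord κ x) := by
  change _ = (κ.hom.app (CommAlgCat.of L R) ≫ κ.inv.app (CommAlgCat.of L R) ≫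
    φ.app (CommAlgCat.of L R) ≫ κ'.hom.app (CommAlgCat.of L R)).hom x
  rw [Iso.hom_inv_id_app_assoc]
  rfl

theorem coord_lie (κ : E ≅ Ga F L d) (x : Lie E R) (i : Fin d) :
    coord κ (x : Pts E (DualNumber R)) i = TrivSqZeroExt.inr (lieCoord κ x i) := by
  have hx : ptsBaseChange E (TrivSqZeroExt.fstHom L R R) (x : Pts E (DualNumber R)) = 0 := x.2
  have h := congrFun (coord_ptsBaseChange κ (TrivSqZeroExt.fstHom L R R)
    (x : Pts E (DualNumber R))) i
  rw [hx, coord_zero] at h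
  ext
  · exact h.symm
  · rfl

theorem lieCoord_injective (κ : E ≅ Ga F L d) :
    Function.Injective (lieCoord κ : Lie E R → Fin d → R) := by
  intro x y h
  refine Subtype.ext (coord_injective κ (funext fun i => ?_))
  rw [coord_lie, coord_lie, h]

/-- The tangent vector with given coordinates. -/
def lieCoordInv (κ : E ≅ Ga F L d) (v : Fin d → R) : Lie E R :=
  ⟨coordInv κ fun i => TrivSqZeroExt.inr (v i), by
    change ptsBaseChange E (TrivSqZeroExt.fstHom L R R) _ = 0
    apply coord_injective κ
    rw [coord_ptsBaseChange, coord_coordInv, coord_zero]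
    ext i
    simp⟩

theorem lieCoord_lieCoordInv (κ : E ≅ Ga F L d) (v : Fin d → R) :
    lieCoord κ (lieCoordInv κ v) = v := by
  ext i
  simp [lieCoord, lieCoordInv, coord_coordInv]

theorem lieCoord_zero (κ : E ≅ Ga F L d) : lieCoord κ (0 : Lie E R) = 0 := by
  have h := lieCoord_add κ (0 : Lie E R) 0
  simpa using h

theorem lieCoord_sub (κ : E ≅ Ga F L d) (x y : Lie E R) :
    lieCoord κ (x - y) = lieCoord κ x - lieCoord κ y := by
  have h := lieCoord_add κ (x - y) y
  rw [sub_add_cancel] at h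
  rw [h, add_sub_cancel_right]

theorem lieCoord_smul (κ : E ≅ Ga F L d) (c : F) (x : Lie E R) :
    lieCoord κ (c • x) = algebraMap F L c • lieCoord κ x := by
  ext i
  have h := congrFun (coord_smul κ c (x : Pts E (DualNumber R))) i
  exact congrArg TrivSqZeroExt.snd h

theorem lieCoord_lieScalar (κ : E ≅ Ga F L d) (c : R) (x : Lie E R) :
    lieCoord κ (lieScalar E c x) = c • lieCoord κ x := by
  ext i
  have h := congrFun (coord_ptsBaseChange κ (dualScale L c) (x : Pts E (DualNumber R))) i
  have h2 : lieCoord κ (lieScalar E c x) i =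
    (coord κ (ptsBaseChange E (dualScale L c) (x : Pts E (DualNumber R))) i).snd := rfl
  rw [h2, h, Function.comp_apply, coord_lie]
  simp [dualScale, mul_comm]

variable [Fintype F]

/-- On multiples of ε every q^n-th power with n ≥ 1 vanishes, because q^n ≥ 2 and ε² = 0. Only the
linear part survives. -/
theorem lieCoord_lieMap (κ : E ≅ Ga F L d) (κ' : E' ≅ Ga F L d') (φ : E ⟶ E') {N : ℕ} (hN : 0 < N)
    (B : ℕ → Matrix (Fin d') (Fin d) L)
    (hB : ∀ v : Fin d → DualNumber R, gaMap (homCoord κ κ' φ) (DualNumber R) v =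
      ∑ n ∈ Finset.range N, ((B n).map (algebraMap L (DualNumber R))).mulVec
        fun j => v j ^ (Fintype.card F) ^ n) (x : Lie E R) :
    lieCoord κ' (lieMap φ R x) = ((B 0).map (algebraMap L R)).mulVec (lieCoord κ x) := by
  have hq : 1 < Fintype.card F := Fintype.one_lt_card
  ext i
  have h2 : lieCoord κ' (lieMap φ R x) i =
    (coord κ' (ptsMap φ (DualNumber R) (x : Pts E (DualNumber R))) i).snd := rfl
  rw [h2, coord_ptsMap κ κ', hB, Finset.sum_apply, Finset.sum_eq_single_of_mem 0 (by simpa)]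
  · simp only [Matrix.mulVec, dotProduct, pow_zero, pow_one, Matrix.map_apply]
    rw [TrivSqZeroExt.snd_sum]
    refine Finset.sum_congr rfl fun j _ => ?_
    rw [coord_lie]
    simp [TrivSqZeroExt.algebraMap_eq_inl', mul_comm]
  · intro n _ hn
    simp only [Matrix.mulVec, dotProduct]
    refine Finset.sum_eq_zero fun j _ => ?_
    have h1 : 2 ≤ Fintype.card F ^ n := le_trans hq (Nat.le_self_pow hn _)
    rw [coord_lie, ← Nat.sub_add_cancel h1, pow_add, pow_two, TrivSqZeroExt.inr_mul_inr]
    simp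

end Coordinates

/-! ### Convergent twisted power series over an ultrametric field. -/

section TwistedSeries

open scoped Matrix.Norms.Elementwise

variable (F : Type u) [Field F] [Fintype F] {C : Type u} [NormedField C] [Algebra F C]
  {d d' d'' : ℕ}

/-- The coordinatewise `q^n`-th power. -/
def twPow (n : ℕ) (v : Fin d → C) : Fin d → C := fun j => v j ^ (Fintype.card F) ^ n

/-- The entrywise `q^n`-th power of a matrix. -/
def twMat (n : ℕ) (M : Matrix (Fin d) (Fin d') C) : Matrix (Fin d) (Fin d') C :=
  M.map fun c => c ^ (Fintype.card F) ^ n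

/-- `G` is the everywhere convergent twisted power series with coefficients `g`. -/
def IsTwSeries (g : ℕ → Matrix (Fin d') (Fin d) C) (G : (Fin d → C) → Fin d' → C) : Prop :=
  ∀ x, HasSum (fun n => (g n).mulVec (twPow F n x)) (G x)

/-- The twisted polynomial `∑_{n<N} B_n τ^n`. -/
def twPoly (N : ℕ) (B : ℕ → Matrix (Fin d') (Fin d) C) (x : Fin d → C) : Fin d' → C :=
  ∑ n ∈ Finset.range N, (B n).mulVec (twPow F n x)

/-- The coefficients of the product of a twisted polynomial and a twisted power series. -/
def twMul (N : ℕ) (B : ℕ → Matrix (Fin d'') (Fin d') C) (g : ℕ → Matrix (Fin d') (Fin d) C)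
    (n : ℕ) :
    Matrix (Fin d'') (Fin d) C :=
  ∑ i ∈ Finset.range N, if i ≤ n then B i * twMat F i (g (n - i)) else 0

theorem add_pow_card_pow (n : ℕ) (x y : C) :
    (x + y) ^ (Fintype.card F) ^ n = x ^ (Fintype.card F) ^ n + y ^ (Fintype.card F) ^ n := by
  obtain ⟨p, hp⟩ := CharP.exists F
  obtain ⟨f, hpp, hf⟩ := FiniteField.card F p
  have : Fact p.Prime := ⟨hpp⟩
  have : CharP C p := charP_of_injective_algebraMap (algebraMap F C).injective p
  rw [hf, ← pow_mul, add_pow_char_pow]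

/-- The `q^n`-th power map as a ring endomorphism. -/
def frobPow (C : Type u) [NormedField C] [Algebra F C] (n : ℕ) : C →+* C where
  toFun c := c ^ (Fintype.card F) ^ n
  map_one' := one_pow _
  map_mul' _ _ := mul_pow _ _ _
  map_zero' := zero_pow (pow_ne_zero _ Fintype.card_ne_zero)
  map_add' := add_pow_card_pow F n

theorem twPow_add (n : ℕ) (x y : Fin d → C) : twPow F n (x + y) = twPow F n x + twPow F n y :=
  funext fun _ => add_pow_card_pow F n _ _

theorem twPow_zero (n : ℕ) : twPow F n (0 : Fin d → C) = 0 :=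
  funext fun _ => (frobPow F C n).map_zero

theorem twPow_smul (n : ℕ) (c : C) (x : Fin d → C) :
    twPow F n (c • x) = c ^ (Fintype.card F) ^ n • twPow F n x :=
  funext fun _ => mul_pow _ _ _

theorem twPow_algebraMap_smul (n : ℕ) (c : F) (x : Fin d → C) :
    twPow F n (algebraMap F C c • x) = algebraMap F C c • twPow F n x := by
  rw [twPow_smul, ← map_pow, FiniteField.pow_card_pow]

theorem twPow_mulVec (n : ℕ) (M : Matrix (Fin d') (Fin d) C) (x : Fin d → C) :
    twPow F n (M.mulVec x) = (twMat F n M).mulVec (twPow F n x) :=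
  funext fun i => RingHom.map_mulVec (frobPow F C n) M x i

theorem twPow_twPow (n m : ℕ) (x : Fin d → C) : twPow F n (twPow F m x) = twPow F (n + m) x :=
  funext fun i => by simp only [twPow]; rw [← pow_mul, ← pow_add, add_comm]

theorem twMat_zero (M : Matrix (Fin d') (Fin d) C) : twMat F 0 M = M := by
  ext; simp [twMat]

theorem twPow_index_zero (x : Fin d → C) : twPow F 0 x = x := by
  ext; simp [twPow]

theorem continuous_twPow (n : ℕ) : Continuous (twPow F n : (Fin d → C) → Fin d → C) :=
  continuous_pi fun i => (continuous_apply i).pow _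

theorem card_pow_pos (n : ℕ) : 0 < Fintype.card F ^ n := Nat.pow_pos Fintype.card_pos

theorem two_le_card_pow {n : ℕ} (hn : n ≠ 0) : 2 ≤ Fintype.card F ^ n :=
  le_trans (Fintype.one_lt_card (α := F)) (Nat.le_self_pow hn _)

theorem norm_twPow_le (n : ℕ) (x : Fin d → C) : ‖twPow F n x‖ ≤ ‖x‖ ^ (Fintype.card F) ^ n := by
  refine (pi_norm_le_iff_of_nonneg (by positivity)).mpr fun i => ?_
  rw [twPow, norm_pow]
  exact pow_le_pow_left₀ (norm_nonneg _) (norm_le_pi_norm x i) _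

theorem norm_twMat_le (n : ℕ) (M : Matrix (Fin d') (Fin d) C) :
    ‖twMat F n M‖ ≤ ‖M‖ ^ (Fintype.card F) ^ n := by
  refine (Matrix.norm_le_iff (by positivity)).mpr fun i j => ?_
  rw [twMat, Matrix.map_apply, norm_pow]
  exact pow_le_pow_left₀ (norm_nonneg _) (Matrix.norm_entry_le_entrywise_sup_norm M) _

variable {F}

section Ultrametric

variable [IsUltrametricDist C]

theorem norm_mulVec_le (M : Matrix (Fin d') (Fin d) C) (x : Fin d → C) :
    ‖M.mulVec x‖ ≤ ‖M‖ * ‖x‖ := by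
  refine (pi_norm_le_iff_of_nonneg (by positivity)).mpr fun i => ?_
  rw [Matrix.mulVec, dotProduct]
  refine IsUltrametricDist.norm_sum_le_of_forall_le_of_nonneg
    (mul_nonneg (norm_nonneg M) (norm_nonneg x)) fun j _ => ?_
  rw [norm_mul]
  gcongr
  · exact Matrix.norm_entry_le_entrywise_sup_norm M
  · exact norm_le_pi_norm x j

theorem norm_matrix_mul_le (M : Matrix (Fin d'') (Fin d') C) (N : Matrix (Fin d') (Fin d) C) :
    ‖M * N‖ ≤ ‖M‖ * ‖N‖ := by
  refine (Matrix.norm_le_iff (by positivity)).mpr fun i k => ?_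
  rw [Matrix.mul_apply]
  refine IsUltrametricDist.norm_sum_le_of_forall_le_of_nonneg
    (mul_nonneg (norm_nonneg M) (norm_nonneg N)) fun j _ => ?_
  rw [norm_mul]
  gcongr <;> exact Matrix.norm_entry_le_entrywise_sup_norm _

instance : IsUltrametricDist (Matrix (Fin d') (Fin d) C) :=
  inferInstanceAs (IsUltrametricDist (Fin d' → Fin d → C))

end Ultrametric

theorem continuous_mulVec (M : Matrix (Fin d') (Fin d) C) : Continuous fun x => M.mulVec x :=
  Continuous.matrix_mulVec continuous_const continuous_id

theorem twPoly_zero (N : ℕ) (B : ℕ → Matrix (Fin d') (Fin d) C) : twPoly F N B 0 = 0 := by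
  simp [twPoly, twPow_zero]

/-- Replaces the cutoff i < N by i ≤ n: both sums extend by zero to the same larger range. -/
theorem twMul_eq {N : ℕ} {B : ℕ → Matrix (Fin d'') (Fin d') C} (hB : ∀ n, N ≤ n → B n = 0)
    (g : ℕ → Matrix (Fin d') (Fin d) C)
    (n : ℕ) :
    twMul F N B g n = ∑ i ∈ Finset.range (n + 1), B i * twMat F i (g (n - i)) := by
  have h1 : twMul F N B g n = ∑ i ∈ Finset.range (N + (n + 1)),
      if i ≤ n then B i * twMat F i (g (n - i)) else 0 := by
    refine Finset.sum_subset (by simp) fun i _ hi => ?_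
    rw [hB i (by simpa using hi)]
    simp
  rw [h1]
  have h2 : ∑ i ∈ Finset.range (n + 1), B i * twMat F i (g (n - i)) =
      ∑ i ∈ Finset.range (n + 1), if i ≤ n then B i * twMat F i (g (n - i)) else 0 :=
    Finset.sum_congr rfl fun i hi => by rw [if_pos (by have := Finset.mem_range.mp hi; omega)]
  rw [h2]
  symm
  refine Finset.sum_subset (by simp) fun i _ hi => ?_
  rw [if_neg (by have := Finset.mem_range.not.mp hi; omega)]

theorem hasSum_of_eq {W : Type*} [AddCommMonoid W] [TopologicalSpace W] {f f' : ℕ → W} {a : W}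
    (h : HasSum f a) (hf : ∀ n, f' n = f n) : HasSum f' a := by
  rwa [show f' = f from funext hf]

theorem hasSum_shift {W : Type*} [AddCommMonoid W] [TopologicalSpace W] {f : ℕ → W} {a : W}
    (h : HasSum f a) (i : ℕ) : HasSum (fun n => if i ≤ n then f (n - i) else 0) a := by
  have h1 := (add_left_injective i).hasSum_iff (f := fun n => if i ≤ n then f (n - i) else 0)
    (a := a) (fun n hn => if_neg fun h => hn ⟨n - i, Nat.sub_add_cancel h⟩)
  refine h1.mp ?_
  simpa [Function.comp_def] using h

namespace IsTwSeries

variable {g g' : ℕ → Matrix (Fin d') (Fin d) C} {G G' : (Fin d → C) → Fin d' → C}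

/-- Each B_i τ^i is additive and continuous, so it passes through the infinite sum and shifts its
index by i. -/
theorem twPoly_comp (hg : IsTwSeries F g G) (N : ℕ) (B : ℕ → Matrix (Fin d'') (Fin d') C) :
    IsTwSeries F (twMul F N B g) fun x => twPoly F N B (G x) := by
  intro x
  have h1 : ∀ i ∈ Finset.range N, HasSum (fun n => (if i ≤ n then
      (B i * twMat F i (g (n - i))) else 0).mulVec (twPow F n x))
      ((B i).mulVec (twPow F i (G x))) := by
    intro i _
    let T : (Fin d' → C) →+ (Fin d'' → C) :=
      { toFun := fun y => (B i).mulVec (twPow F i y)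
        map_zero' := by rw [twPow_zero, Matrix.mulVec_zero]
        map_add' := fun y z => by rw [twPow_add, Matrix.mulVec_add] }
    have hT : Continuous T := (continuous_mulVec (B i)).comp (continuous_twPow F i)
    have h2 := hasSum_shift ((hg x).map T hT) i
    refine hasSum_of_eq h2 fun n => ?_
    split_ifs with hin
    · simp only [Function.comp_apply, T, AddMonoidHom.coe_mk, ZeroHom.coe_mk]
      rw [twPow_mulVec, twPow_twPow, Matrix.mulVec_mulVec, Nat.add_sub_cancel' hin]
    · exact Matrix.zero_mulVec _
  have h2 := hasSum_sum h1
  refine hasSum_of_eq h2 fun n => ?_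
  rw [twMul, Matrix.sum_mulVec]

theorem comp_mulVec (hg : IsTwSeries F g G) (J : Matrix (Fin d) (Fin d'') C) :
    IsTwSeries F (fun n => g n * twMat F n J) fun x => G (J.mulVec x) := by
  intro x
  have h := hg (J.mulVec x)
  simp only [twPow_mulVec, Matrix.mulVec_mulVec] at h
  exact h

theorem sub (hg : IsTwSeries F g G) (hg' : IsTwSeries F g' G') :
    IsTwSeries F (fun n => g n - g' n) fun x => G x - G' x := by
  intro x
  simpa only [Matrix.sub_mulVec] using (hg x).sub (hg' x)

theorem map_add (hg : IsTwSeries F g G) (x y : Fin d → C) : G (x + y) = G x + G y := by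
  have h := (hg x).add (hg y)
  simp only [← Matrix.mulVec_add, ← twPow_add] at h
  exact (hg (x + y)).unique h

theorem map_smul (hg : IsTwSeries F g G) (c : F) (x : Fin d → C) :
    G (algebraMap F C c • x) = algebraMap F C c • G x := by
  have h := (hg x).const_smul (algebraMap F C c)
  simp only [← Matrix.mulVec_smul, ← twPow_algebraMap_smul] at h
  exact (hg _).unique h

theorem map_zero (hg : IsTwSeries F g G) : G 0 = 0 := by
  have h := hg.map_add 0 0
  simpa using h

/-- Standard basis vectors are fixed by τ, so convergence there says that the columns of g_n tend to
0. -/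
theorem exists_bound (hg : IsTwSeries F g G) : ∃ K, 0 ≤ K ∧ ∀ n, ‖g n‖ ≤ K := by
  have h : ∀ i j, ∃ K, ∀ n, ‖g n i j‖ ≤ K := by
    intro i j
    have h1 := (hg (Pi.single j 1)).summable.tendsto_atTop_zero
    have h2 := (tendsto_pi_nhds.mp h1 i).norm
    obtain ⟨K, hK⟩ := h2.bddAbove_range
    refine ⟨K, fun n => ?_⟩
    have h3 : twPow F n (Pi.single j 1 : Fin d → C) = Pi.single j 1 := by
      ext k
      by_cases hk : k = j
      · subst hk; simp [twPow]
      · simp [twPow, Pi.single_eq_of_ne hk]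
    have h4 := hK ⟨n, rfl⟩
    simpa [h3] using h4
  choose K hK using h
  refine ⟨∑ i, ∑ j, |K i j|, by positivity, fun n => ?_⟩
  refine (Matrix.norm_le_iff (by positivity)).mpr fun i j => ?_
  calc ‖g n i j‖ ≤ |K i j| := (hK i j n).trans (le_abs_self _)
    _ ≤ ∑ j, |K i j| := Finset.single_le_sum (f := fun j => |K i j|) (fun _ _ => abs_nonneg _)
        (Finset.mem_univ j)
    _ ≤ _ := Finset.single_le_sum (f := fun i => ∑ j, |K i j|) (fun _ _ => by positivity)
        (Finset.mem_univ i)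

variable [IsUltrametricDist C]

/-- Without a linear term only exponents q^n ≥ 2 occur, and the ultrametric inequality bounds the
sum by its largest term. -/
theorem exists_norm_le (hg : IsTwSeries F g G) (h0 : g 0 = 0) :
    ∃ K, 0 ≤ K ∧ ∀ x, ‖x‖ ≤ 1 → ‖G x‖ ≤ K * ‖x‖ ^ 2 := by
  obtain ⟨K, hK0, hK⟩ := hg.exists_bound
  refine ⟨K, hK0, fun x hx => ?_⟩
  rw [← (hg x).tsum_eq]
  refine IsUltrametricDist.norm_tsum_le_of_forall_le_of_nonneg (by positivity) fun n => ?_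
  rcases eq_or_ne n 0 with rfl | hn
  · rw [h0]; simp; positivity
  · calc _ ≤ ‖g n‖ * ‖twPow F n x‖ := norm_mulVec_le _ _
      _ ≤ K * ‖x‖ ^ Fintype.card F ^ n := by
        gcongr
        · exact hK n
        · exact norm_twPow_le F n x
      _ ≤ _ := by
        gcongr K * ?_
        exact pow_le_pow_of_le_one (norm_nonneg _) hx (two_le_card_pow F hn)

/-- A twisted power series with leading term `x` is, near `0`, an isometry. -/
theorem exists_norm_sub_le {g : ℕ → Matrix (Fin d) (Fin d) C} {G : (Fin d → C) → Fin d → C}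
    (hg : IsTwSeries F g G) (h0 : g 0 = 1) :
    ∃ ρ : ℝ, 0 < ρ ∧ ∀ x, ‖x‖ ≤ ρ → ‖x - G x‖ ≤ 2⁻¹ * ‖x‖ := by
  have h1 : IsTwSeries F (fun n => (if n = 0 then 1 else 0 : Matrix (Fin d) (Fin d) C)) id := by
    intro x
    refine hasSum_of_eq (hasSum_ite_eq 0 x) fun n => ?_
    beta_reduce
    split_ifs with hn
    · rw [hn, twPow_index_zero, Matrix.one_mulVec]
    · rw [Matrix.zero_mulVec]
  obtain ⟨K, hK0, hK⟩ := (h1.sub hg).exists_norm_le (by simp [h0])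
  -- On this ball ‖x‖ ≤ 1 and K‖x‖ ≤ 1/2, so the quadratic bound becomes the factor 1/2.
  refine ⟨(2 * K + 1)⁻¹, by positivity, fun x hx => ?_⟩
  have hx1 : ‖x‖ ≤ 1 := hx.trans (inv_le_one_of_one_le₀ (by linarith))
  refine (hK x hx1).trans ?_
  have h2 : K * ‖x‖ ≤ 2⁻¹ := by
    have h3 : K * ‖x‖ ≤ K * (2 * K + 1)⁻¹ := by gcongr
    refine h3.trans ?_
    rw [← div_eq_mul_inv, div_le_iff₀ (by positivity)]
    linarith
  calc K * ‖x‖ ^ 2 = (K * ‖x‖) * ‖x‖ := by ring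
    _ ≤ _ := by gcongr

/-- By additivity continuity at 0 suffices, and there ‖G x‖ ≤ K‖x‖ on the unit ball. -/
theorem continuous (hg : IsTwSeries F g G) : Continuous G := by
  let T : (Fin d → C) →+ (Fin d' → C) :=
    { toFun := G, map_zero' := hg.map_zero, map_add' := hg.map_add }
  obtain ⟨K, hK0, hK⟩ := hg.exists_bound
  refine continuous_of_continuousAt_zero T ?_
  rw [ContinuousAt, _root_.map_zero, tendsto_zero_iff_norm_tendsto_zero]
  have h1 : Filter.Tendsto (fun x : Fin d → C => K * ‖x‖) (nhds 0) (nhds 0) := by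
    have : Continuous fun x : Fin d → C => K * ‖x‖ := by fun_prop
    simpa using this.tendsto 0
  refine squeeze_zero' (Filter.Eventually.of_forall fun _ => norm_nonneg _) ?_ h1
  filter_upwards [Metric.closedBall_mem_nhds (0 : Fin d → C) one_pos] with x hx
  rw [mem_closedBall_zero_iff] at hx
  change ‖G x‖ ≤ _
  rw [← (hg x).tsum_eq]
  refine IsUltrametricDist.norm_tsum_le_of_forall_le_of_nonneg (by positivity) fun n => ?_
  calc _ ≤ ‖g n‖ * ‖twPow F n x‖ := norm_mulVec_le _ _
    _ ≤ K * ‖x‖ ^ Fintype.card F ^ n := by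
      gcongr
      · exact hK n
      · exact norm_twPow_le F n x
    _ ≤ _ := by
      gcongr K * ?_
      exact pow_le_of_le_one (norm_nonneg _) hx (card_pow_pos F n).ne'

/-- A twisted power series with leading term `x` is, near `0`, onto. -/
theorem exists_eq_of_norm_le [CompleteSpace C] {g : ℕ → Matrix (Fin d) (Fin d) C}
    {G : (Fin d → C) → Fin d → C} (hg : IsTwSeries F g G) {ρ : ℝ}
    (hρ : ∀ x, ‖x‖ ≤ ρ → ‖x - G x‖ ≤ 2⁻¹ * ‖x‖) {y : Fin d → C} (hy : ‖y‖ ≤ ρ) :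
    ∃ x, ‖x‖ ≤ ‖y‖ ∧ G x = y := by
  let T : (Fin d → C) →+ (Fin d → C) :=
    { toFun := G, map_zero' := hg.map_zero, map_add' := hg.map_add }
  -- The successive errors: each a_n is used as a correction and leaves the error a_n − G(a_n), at
  -- most half as large. By additivity the images G(a_n) telescope, so the sum of the a_n is a
  -- preimage of y.
  let a : ℕ → Fin d → C := fun n => Nat.rec y (fun _ z => z - G z) n
  have ha1 : ∀ n, a (n + 1) = a n - G (a n) := fun n => rfl
  have ha : ∀ n, ‖a n‖ ≤ 2⁻¹ ^ n * ‖y‖ := by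
    intro n
    induction n with
    | zero => simp [a]
    | succ n ih =>
      rw [ha1, pow_succ']
      have h1 : ‖a n‖ ≤ ρ := by
        refine ih.trans (le_trans ?_ hy)
        exact mul_le_of_le_one_left (norm_nonneg _) (pow_le_one₀ (by norm_num) (by norm_num))
      calc _ ≤ 2⁻¹ * ‖a n‖ := hρ _ h1
        _ ≤ 2⁻¹ * (2⁻¹ ^ n * ‖y‖) := by gcongr
        _ = _ := by ring
  have hs : Summable a := Summable.of_norm_bounded
    ((summable_geometric_of_lt_one (by norm_num) (by norm_num : (2⁻¹ : ℝ) < 1)).mul_right ‖y‖) ha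
  refine ⟨∑' n, a n, ?_, ?_⟩
  · refine IsUltrametricDist.norm_tsum_le_of_forall_le_of_nonneg (by positivity) fun n => ?_
    exact (ha n).trans (mul_le_of_le_one_left (norm_nonneg _)
      (pow_le_one₀ (by norm_num) (by norm_num)))
  · have h1 := (hs.hasSum.map T hg.continuous).tendsto_sum_nat
    have h2 : ∀ N, ∑ n ∈ Finset.range N, (T ∘ a) n = y - a N := by
      intro N
      induction N with
      | zero => simp [a]
      | succ N ih =>
        rw [Finset.sum_range_succ, ih, ha1]
        simp only [Function.comp_apply, T, AddMonoidHom.coe_mk, ZeroHom.coe_mk]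
        abel
    simp only [h2] at h1
    have h3 := (tendsto_const_nhds (x := y)).sub hs.tendsto_atTop_zero
    rw [sub_zero] at h3
    exact tendsto_nhds_unique h1 h3

/-- Rigidity: a twisted power series without linear term that commutes with an expanding twisted
polynomial vanishes. -/
theorem eq_zero_of_semiconj {g : ℕ → Matrix (Fin d) (Fin d) C} {G : (Fin d → C) → Fin d → C}
    (hg : IsTwSeries F g G) (h0 : g 0 = 0) {θ : C} (hθ : 1 < ‖θ‖) {N : ℕ}
    {B : ℕ → Matrix (Fin d) (Fin d) C} (hB0 : B 0 = θ • 1)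
    (hG : ∀ x, G (θ • x) = twPoly F N B (G x)) (x : Fin d → C) : G x = 0 := by
  obtain ⟨K, hK0, hK⟩ := hg.exists_norm_le h0
  have hθ0 : θ ≠ 0 := by rintro rfl; simp at hθ; linarith
  -- On the ball of radius 1/M the terms with n ≥ 1 are at most M‖y‖² ≤ ‖y‖, so the twisted
  -- polynomial expands by at most ‖θ‖.
  let M : ℝ := 1 + ∑ n ∈ Finset.range N, ‖B n‖
  have hM1 : 1 ≤ M := 
    le_add_of_nonneg_right (Finset.sum_nonneg fun n _ => norm_nonneg (B n))
  have hMB : ∀ n ∈ Finset.range N, ‖B n‖ ≤ M := fun n hn => by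
    have := Finset.single_le_sum (f := fun n => ‖B n‖) (fun _ _ => norm_nonneg _) hn
    simp only [M]; linarith
  have hΘ : ∀ y : Fin d → C, ‖y‖ ≤ M⁻¹ → ‖twPoly F N B y‖ ≤ ‖θ‖ * ‖y‖ := by
    intro y hy
    have hy1 : ‖y‖ ≤ 1 := hy.trans (inv_le_one_of_one_le₀ hM1)
    refine IsUltrametricDist.norm_sum_le_of_forall_le_of_nonneg (by positivity) fun n hn => ?_
    rcases eq_or_ne n 0 with rfl | hn0
    · rw [hB0, twPow_index_zero, Matrix.smul_mulVec, Matrix.one_mulVec, norm_smul]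
    · calc _ ≤ ‖B n‖ * ‖twPow F n y‖ := norm_mulVec_le _ _
        _ ≤ M * ‖y‖ ^ Fintype.card F ^ n := by
          gcongr
          · exact hMB n hn
          · exact norm_twPow_le F n y
        _ ≤ M * ‖y‖ ^ 2 := by
          gcongr M * ?_
          exact pow_le_pow_of_le_one (norm_nonneg _) hy1 (two_le_card_pow F hn0)
        _ = (M * ‖y‖) * ‖y‖ := by ring
        _ ≤ 1 * ‖y‖ := by
          gcongr
          rw [mul_comm, ← le_div_iff₀ (by linarith), one_div]
          exact hy
        _ ≤ _ := by gcongr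
  -- A backward orbit of the twisted polynomial that starts at G(x) and tends to 0.
  let y : ℕ → Fin d → C := fun n => G ((θ⁻¹) ^ n • x)
  have hy : ∀ n, twPoly F N B (y (n + 1)) = y n := fun n => by
    simp only [y]
    rw [← hG, smul_smul, pow_succ', ← mul_assoc, mul_inv_cancel₀ hθ0, one_mul]
  have hr : ‖θ⁻¹‖ < 1 := by rw [norm_inv]; exact inv_lt_one_of_one_lt₀ hθ
  have ht : Filter.Tendsto (fun n : ℕ => (θ⁻¹) ^ n • x) Filter.atTop (nhds 0) := by
    have := (tendsto_pow_atTop_nhds_zero_of_norm_lt_one hr).smul_const x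
    simpa using this
  have hyt : Filter.Tendsto y Filter.atTop (nhds 0) := by
    have := (hg.continuous.tendsto 0).comp ht
    rwa [hg.map_zero] at this
  have hs1 : ∀ᶠ n in Filter.atTop, ‖(θ⁻¹) ^ n • x‖ ≤ 1 := by
    have := ht.norm
    rw [norm_zero] at this
    exact this.eventually_le_const one_pos
  have hs2 : ∀ᶠ n in Filter.atTop, ‖y n‖ ≤ M⁻¹ := by
    have := hyt.norm
    rw [norm_zero] at this
    exact this.eventually_le_const (by positivity)
  obtain ⟨n₀, hn₀⟩ := Filter.eventually_atTop.mp (hs1.and hs2)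
  have hle : ∀ k, ‖y n₀‖ ≤ ‖θ‖ ^ k * ‖y (n₀ + k)‖ := by
    intro k
    induction k with
    | zero => simp
    | succ k ih =>
      refine ih.trans ?_
      have h1 := hΘ (y (n₀ + k + 1)) (hn₀ _ (by omega)).2
      rw [hy] at h1
      calc _ ≤ ‖θ‖ ^ k * (‖θ‖ * ‖y (n₀ + k + 1)‖) := by gcongr
        _ = _ := by rw [pow_succ, ← add_assoc]; ring
  -- Going forward k steps costs a factor ‖θ‖^k, but G vanishes to second order, which gains
  -- ‖θ‖^{−2k}.
  have hle2 : ∀ k, ‖y n₀‖ ≤ (K * ‖x‖ ^ 2) * ‖θ⁻¹‖ ^ k := by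
    intro k
    refine (hle k).trans ?_
    have h1 := hK _ (hn₀ (n₀ + k) (by omega)).1
    have h3 : ‖θ‖ * ‖θ⁻¹‖ = 1 := by rw [← norm_mul, mul_inv_cancel₀ hθ0, norm_one]
    calc ‖θ‖ ^ k * ‖y (n₀ + k)‖ ≤ ‖θ‖ ^ k * (K * ‖(θ⁻¹) ^ (n₀ + k) • x‖ ^ 2) := by gcongr
      _ = (K * ‖x‖ ^ 2) * ((‖θ‖ * ‖θ⁻¹‖) ^ k * ‖θ⁻¹‖ ^ k * (‖θ⁻¹‖ ^ n₀) ^ 2) := by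
        rw [norm_smul, norm_pow, mul_pow, mul_pow, pow_add, mul_pow, ← pow_mul, ← pow_mul]; ring
      _ ≤ (K * ‖x‖ ^ 2) * (1 * ‖θ⁻¹‖ ^ k * 1) := by
        rw [h3, one_pow]
        gcongr
        exact pow_le_one₀ (by positivity) (pow_le_one₀ (norm_nonneg _) hr.le)
      _ = _ := by ring
  have hz : y n₀ = 0 := by
    rw [← norm_le_zero_iff]
    have h1 := (tendsto_pow_atTop_nhds_zero_of_lt_one (norm_nonneg _) hr).const_mul (K * ‖x‖ ^ 2)
    rw [mul_zero] at h1
    exact ge_of_tendsto' h1 hle2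
  -- The twisted polynomial fixes 0, so a zero of the orbit propagates back to y_0 = G(x).
  have hdown : ∀ n, y n = 0 → y 0 = 0 := by
    intro n
    induction n with
    | zero => exact id
    | succ n ih => exact fun h => ih (by rw [← hy, h, twPoly_zero])
  simpa [y] using hdown n₀ hz

end IsTwSeries

end TwistedSeries

/-! ### Coefficients of the exponential series and their decay. -/

section FormalExponential

open scoped Matrix.Norms.Elementwise

variable (F : Type u) [Field F] [Fintype F] {C : Type u} [NormedField C] [Algebra F C] {d : ℕ}

/-- The coefficients of the exponential series attached to `θ + B_1 τ + B_2 τ² + …`. -/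
def expCoeff (θ : C) (B : ℕ → Matrix (Fin d) (Fin d) C) : ℕ → Matrix (Fin d) (Fin d) C
  | 0 => 1
  | n + 1 => (θ ^ Fintype.card F ^ (n + 1) - θ)⁻¹ •
      ∑ i : Fin (n + 1), B (i + 1) * twMat F (i + 1) (expCoeff θ B (n - i))
decreasing_by omega

theorem expCoeff_zero (θ : C) (B : ℕ → Matrix (Fin d) (Fin d) C) : expCoeff F θ B 0 = 1 := by
  rw [expCoeff]

theorem expCoeff_succ (θ : C) (B : ℕ → Matrix (Fin d) (Fin d) C) (n : ℕ) :
    expCoeff F θ B (n + 1) = (θ ^ Fintype.card F ^ (n + 1) - θ)⁻¹ •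
      ∑ i ∈ Finset.range (n + 1), B (i + 1) * twMat F (i + 1) (expCoeff F θ B (n - i)) := by
  rw [expCoeff, Finset.sum_range fun i => B (i + 1) * twMat F (i + 1) (expCoeff F θ B (n - i))]

variable [IsUltrametricDist C]

theorem norm_pow_card_sub {θ : C} (hθ : 1 < ‖θ‖) {n : ℕ} (hn : n ≠ 0) :
    ‖θ ^ Fintype.card F ^ n - θ‖ = ‖θ‖ ^ Fintype.card F ^ n := by
  have h : ‖-θ‖ < ‖θ ^ Fintype.card F ^ n‖ := by
    rw [norm_neg, norm_pow]
    exact lt_self_pow₀ hθ (two_le_card_pow F hn)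
  rw [sub_eq_add_neg, IsUltrametricDist.norm_add_eq_max_of_norm_ne_norm h.ne', max_eq_left h.le,
    norm_pow]

variable {F}

/-- The recursion was solved for this identity: the term i = 0 contributes θ e_n, and the remaining
terms add up to (θ^{q^n} − θ) e_n. -/
theorem twMul_expCoeff {θ : C} (hθ : 1 < ‖θ‖) {N : ℕ} {B : ℕ → Matrix (Fin d) (Fin d) C}
    (hB : ∀ n, N ≤ n → B n = 0) (hB0 : B 0 = θ • 1) (n : ℕ) :
    twMul F N B (expCoeff F θ B) n = θ ^ Fintype.card F ^ n • expCoeff F θ B n := by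
  rw [twMul_eq hB]
  rcases n with _ | n
  · simp [expCoeff_zero, hB0, twMat_zero]
  · have hne : θ ^ Fintype.card F ^ (n + 1) - θ ≠ 0 := by
      rw [← norm_pos_iff, norm_pow_card_sub F hθ n.succ_ne_zero]
      positivity
    have h1 := congrArg (fun M => (θ ^ Fintype.card F ^ (n + 1) - θ) • M) (expCoeff_succ F θ B n)
    simp only [smul_smul, mul_inv_cancel₀ hne, one_smul] at h1
    rw [Finset.sum_range_succ', hB0, twMat_zero]
    simp only [Nat.add_sub_add_right, Nat.sub_zero, Matrix.smul_mul, Matrix.one_mul]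
    rw [← h1, sub_smul, sub_add_cancel]

/-- Bounds of the shape c^{q^n} fit the recursion, because (c^{q^{n−i}})^{q^{i+1}} = c^{q^{n+1}}.
The denominator supplies the factor ‖θ‖^{q^{n+1}} on the left. -/
theorem norm_expCoeff_succ_mul_le {θ : C} (hθ : 1 < ‖θ‖) {N : ℕ}
    {B : ℕ → Matrix (Fin d) (Fin d) C} (hB : ∀ n, N ≤ n → B n = 0) {K : ℝ} (hK : ∀ n, ‖B n‖ ≤ K)
    {c : ℝ} (hc : 0 ≤ c) {n : ℕ}
    (h : ∀ i ≤ n, i + 1 < N → ‖expCoeff F θ B (n - i)‖ ≤ c ^ Fintype.card F ^ (n - i)) :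
    ‖expCoeff F θ B (n + 1)‖ * ‖θ‖ ^ Fintype.card F ^ (n + 1) ≤
      K * c ^ Fintype.card F ^ (n + 1) := by
  have hK0 : 0 ≤ K := (norm_nonneg _).trans (hK 0)
  have hpos : 0 < ‖θ‖ ^ Fintype.card F ^ (n + 1) := by positivity
  rw [expCoeff_succ, norm_smul, norm_inv, norm_pow_card_sub F hθ n.succ_ne_zero, mul_comm,
    ← mul_assoc, mul_inv_cancel₀ hpos.ne', one_mul]
  refine IsUltrametricDist.norm_sum_le_of_forall_le_of_nonneg (by positivity) fun i hi => ?_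
  by_cases hiN : i + 1 < N
  · have hin : i ≤ n := by have := Finset.mem_range.mp hi; omega
    calc _ ≤ ‖B (i + 1)‖ * ‖twMat F (i + 1) (expCoeff F θ B (n - i))‖ := norm_matrix_mul_le _ _
      _ ≤ K * (c ^ Fintype.card F ^ (n - i)) ^ Fintype.card F ^ (i + 1) := by
        gcongr
        · exact hK _
        · refine (norm_twMat_le F _ _).trans ?_
          gcongr
          exact h i hin hiN
      _ = _ := by
        rw [← pow_mul, ← pow_add]
        congr 3
        omega
  · rw [hB _ (not_lt.mp hiN), Matrix.zero_mul, norm_zero]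
    positivity

/-- The recursion improves a bound c^{q^n} to (c/2)^{q^n} for large n. Starting from some crude c₀
and repeating this makes the base arbitrarily small, which is what convergence everywhere requires.
-/
theorem expCoeff_decay {θ : C} (hθ : 4 ≤ ‖θ‖) {N : ℕ}
    {B : ℕ → Matrix (Fin d) (Fin d) C} (hB : ∀ n, N ≤ n → B n = 0) {c : ℝ} (hc : 0 < c) :
    ∃ n₀, ∀ n ≥ n₀, ‖expCoeff F θ B n‖ ≤ c ^ Fintype.card F ^ n := by
  have hθ1 : 1 < ‖θ‖ := by linarith
  let K : ℝ := ∑ n ∈ Finset.range N, ‖B n‖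
  have hK : ∀ n, ‖B n‖ ≤ K := fun n => by
    by_cases hn : n < N
    · exact Finset.single_le_sum (f := fun n => ‖B n‖) (fun _ _ => norm_nonneg _)
        (Finset.mem_range.mpr hn)
    · rw [hB n (not_lt.mp hn), norm_zero]
      exact Finset.sum_nonneg fun _ _ => norm_nonneg _
  obtain ⟨m, hm⟩ := pow_unbounded_of_one_lt K (one_lt_two : (1 : ℝ) < 2)
  -- For n ≥ m the constant K is absorbed by 2^{q^{n+1}}, while ‖θ‖ ≥ 4 gains 4^{q^{n+1}}; the net
  -- effect is the factor 1/2 on c.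
  have hstep : ∀ n ≥ m, ∀ c : ℝ, 0 ≤ c →
      (∀ i ≤ n, i + 1 < N → ‖expCoeff F θ B (n - i)‖ ≤ c ^ Fintype.card F ^ (n - i)) →
      ‖expCoeff F θ B (n + 1)‖ ≤ (c / 2) ^ Fintype.card F ^ (n + 1) := by
    intro n hn c hc h
    have h1 := norm_expCoeff_succ_mul_le hθ1 hB hK hc h
    have h2 : K ≤ 2 ^ Fintype.card F ^ (n + 1) := by
      refine hm.le.trans (pow_le_pow_right₀ one_le_two ?_)
      have := Nat.lt_pow_self (Fintype.one_lt_card (α := F)) (n := n + 1)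
      omega
    have h3 : (4 : ℝ) ^ Fintype.card F ^ (n + 1) ≤ ‖θ‖ ^ Fintype.card F ^ (n + 1) := by gcongr
    have h4 : ‖expCoeff F θ B (n + 1)‖ * 4 ^ Fintype.card F ^ (n + 1) ≤
        2 ^ Fintype.card F ^ (n + 1) * c ^ Fintype.card F ^ (n + 1) :=
      calc _ ≤ ‖expCoeff F θ B (n + 1)‖ * ‖θ‖ ^ Fintype.card F ^ (n + 1) := by gcongr
        _ ≤ _ := h1
        _ ≤ _ := by gcongr
    rw [← le_div_iff₀ (by positivity), ← mul_pow, ← div_pow] at h4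
    refine h4.trans (le_of_eq ?_)
    congr 1
    ring
  have hbase : ∃ c : ℝ, 0 < c ∧ ∀ n, ‖expCoeff F θ B n‖ ≤ c ^ Fintype.card F ^ n := by
    let c : ℝ := 1 + ∑ n ∈ Finset.range (m + 1), ‖expCoeff F θ B n‖
    have hc1 : 1 ≤ c := le_add_of_nonneg_right (Finset.sum_nonneg fun n _ => norm_nonneg _)
    refine ⟨c, by linarith, fun n => ?_⟩
    induction n using Nat.strong_induction_on with
    | _ n ih =>
      by_cases hn : n ≤ m
      · have h1 := Finset.single_le_sum (f := fun n => ‖expCoeff F θ B n‖)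
          (fun _ _ => norm_nonneg _) (Finset.mem_range.mpr (Nat.lt_succ_of_le hn))
        refine le_trans (h1.trans ?_) (le_self_pow₀ hc1 (card_pow_pos F n).ne')
        exact le_add_of_nonneg_left zero_le_one
      · obtain ⟨k, rfl⟩ : ∃ k, n = k + 1 := ⟨n - 1, by omega⟩
        refine (hstep k (by omega) c (by linarith) fun i _ _ => ih _ (by omega)).trans ?_
        gcongr
        linarith
  obtain ⟨c₀, hc₀, hbase⟩ := hbase
  have hind : ∀ k : ℕ, ∃ n₀, ∀ n ≥ n₀, ‖expCoeff F θ B n‖ ≤ (c₀ / 2 ^ k) ^ Fintype.card F ^ n := by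
    intro k
    induction k with
    | zero => exact ⟨0, fun n _ => by simpa using hbase n⟩
    | succ k ih =>
      obtain ⟨n₀, hn₀⟩ := ih
      -- The recursion looks back fewer than N indices, so beyond this point it uses only
      -- coefficients already covered by n₀.
      refine ⟨n₀ + N + m + 1, fun n hn => ?_⟩
      obtain ⟨j, rfl⟩ : ∃ j, n = j + 1 := ⟨n - 1, by omega⟩
      refine (hstep j (by omega) (c₀ / 2 ^ k) (by positivity) fun i _ hi =>
        hn₀ _ (by omega)).trans (le_of_eq ?_)
      congr 1
      rw [pow_succ, div_div]
  obtain ⟨k, hk⟩ := pow_unbounded_of_one_lt (c₀ / c) (one_lt_two : (1 : ℝ) < 2)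
  obtain ⟨n₀, hn₀⟩ := hind k
  refine ⟨n₀, fun n hn => (hn₀ n hn).trans ?_⟩
  gcongr
  rw [div_lt_iff₀ hc] at hk
  rw [div_le_iff₀ (by positivity)]
  linarith

variable [CompleteSpace C]

theorem summable_expCoeff {θ : C} (hθ : 4 ≤ ‖θ‖) {N : ℕ}
    {B : ℕ → Matrix (Fin d) (Fin d) C} (hB : ∀ n, N ≤ n → B n = 0) (x : Fin d → C) :
    Summable fun n => (expCoeff F θ B n).mulVec (twPow F n x) := by
  -- This base makes the n-th term at most 2^{−q^n}.
  obtain ⟨n₀, hn₀⟩ := expCoeff_decay (F := F) hθ hB (c := (2 * (‖x‖ + 1))⁻¹) (by positivity)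
  rw [← summable_nat_add_iff n₀]
  refine Summable.of_norm_bounded (g := fun n => (2⁻¹ : ℝ) ^ n)
    (summable_geometric_of_lt_one (by norm_num) (by norm_num)) fun n => ?_
  calc _ ≤ ‖expCoeff F θ B (n + n₀)‖ * ‖twPow F (n + n₀) x‖ := norm_mulVec_le _ _
    _ ≤ (2 * (‖x‖ + 1))⁻¹ ^ Fintype.card F ^ (n + n₀) * (‖x‖ + 1) ^ Fintype.card F ^ (n + n₀) := by
      gcongr
      · exact hn₀ _ (by omega)
      · refine (norm_twPow_le F _ _).trans ?_
        gcongr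
        linarith
    _ = (2⁻¹ : ℝ) ^ Fintype.card F ^ (n + n₀) := by
      rw [← mul_pow]
      congr 1
      field_simp
    _ ≤ _ := by
      refine pow_le_pow_of_le_one (by norm_num) (by norm_num) ?_
      have := Nat.lt_pow_self (Fintype.one_lt_card (α := F)) (n := n + n₀)
      omega

/-- Both sides of the functional equation are sums of twisted series with the same terms, by
`twMul_expCoeff`. -/
theorem exists_twSeries_semiconj {θ : C} (hθ : 4 ≤ ‖θ‖) {N : ℕ}
    {B : ℕ → Matrix (Fin d) (Fin d) C} (hB : ∀ n, N ≤ n → B n = 0) (hB0 : B 0 = θ • 1) :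
    ∃ (g : ℕ → Matrix (Fin d) (Fin d) C) (G : (Fin d → C) → Fin d → C),
      g 0 = 1 ∧ IsTwSeries F g G ∧ ∀ x, G (θ • x) = twPoly F N B (G x) := by
  have hs : IsTwSeries F (expCoeff F θ B)
      fun x => ∑' n, (expCoeff F θ B n).mulVec (twPow F n x) :=
    fun x => (summable_expCoeff hθ hB x).hasSum
  refine ⟨_, _, expCoeff_zero F θ B, hs, fun x => ?_⟩
  refine (hs (θ • x)).unique (hasSum_of_eq (hs.twPoly_comp N B x) fun n => ?_)
  rw [twMul_expCoeff (by linarith) hB hB0, twPow_smul, Matrix.mulVec_smul, Matrix.smul_mulVec]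

end FormalExponential

/-! ### Existence of the exponential function of an Anderson module. -/

section Exponential

variable {F : Type u} [Field F] [Fintype F] {L : IntermediateField (RatFunc F) (CInf F)} {d : ℕ}

theorem exists_twPoly_coord {E E' : CommAlgCat.{u} L ⥤ ModuleCat.{u} F} (κ : E ≅ Ga F L d)
    (κ' : E' ≅ Ga F L d) (φ : E ⟶ E') :
    ∃ (N : ℕ) (B : ℕ → Matrix (Fin d) (Fin d) L), 0 < N ∧ (∀ n, N ≤ n → B n = 0) ∧
      (∀ x : Pts E (CInf F), coord κ' (ptsMap φ (CInf F) x) =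
        twPoly F N (fun n => (B n).map (algebraMap L (CInf F))) (coord κ x)) ∧
      ∀ (R : Type u) [CommRing R] [Algebra L R] (x : Lie E R),
        lieCoord κ' (lieMap φ R x) = ((B 0).map (algebraMap L R)).mulVec (lieCoord κ x) := by
  obtain ⟨N, B, hN, hB, h⟩ := exists_gaMap_eq (homCoord κ κ' φ)
  refine ⟨N, B, hN, hB, fun x => ?_, fun R _ _ x => ?_⟩
  · rw [coord_ptsMap κ κ', h]
    rfl
  · exact lieCoord_lieMap κ κ' φ hN B (fun v => h _ v) x

theorem eq_smul_one_of_mulVec {R : Type*} [CommRing R] {J : Matrix (Fin d) (Fin d) R} {c : R}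
    (h : ∀ v, J.mulVec v = c • v) : J = c • 1 := by
  ext i j
  have h1 := congrFun (h (Pi.single j 1)) i
  rw [Matrix.mulVec_single_one] at h1
  simpa [Matrix.one_apply, Pi.single_apply] using h1

/-- Evaluate (X − c)^{q^k} = X^{q^k} − c^{q^k} at J; the left side is 0 once q^k reaches the order
of nilpotency. The bound k ≥ r suffices, as q^k > k. -/
theorem pow_card_eq_of_isNilpotent {K : Type*} [Field K] [Algebra F K]
    {J : Matrix (Fin d) (Fin d) K} {c : K} (h : IsNilpotent (J - c • 1)) :
    ∃ k₀, ∀ k ≥ k₀, J ^ Fintype.card F ^ k = c ^ Fintype.card F ^ k • 1 := by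
  obtain ⟨r, hr⟩ := h
  refine ⟨r, fun k hk => ?_⟩
  obtain ⟨p, hp⟩ := CharP.exists F
  obtain ⟨f, hpp, hf⟩ := FiniteField.card F p
  have : Fact p.Prime := ⟨hpp⟩
  have : CharP K p := charP_of_injective_algebraMap (algebraMap F K).injective p
  have h1 : (X - C c : K[X]) ^ Fintype.card F ^ k = X ^ Fintype.card F ^ k -
      C (c ^ Fintype.card F ^ k) := by
    rw [hf, ← pow_mul, sub_pow_char_pow, C_pow]
  have h2 := congrArg (aeval J) h1
  have h3 : aeval J (C c : K[X]) = c • 1 := by rw [aeval_C, Algebra.algebraMap_eq_smul_one]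
  have hle : r ≤ Fintype.card F ^ k :=
    hk.le.trans (Nat.lt_pow_self (Fintype.one_lt_card (α := F))).le
  rw [map_pow, map_sub, aeval_X, h3, pow_eq_zero_of_le hle hr, map_sub, map_pow, aeval_X, aeval_C,
    Algebra.algebraMap_eq_smul_one] at h2
  exact sub_eq_zero.mp h2.symm

namespace AndersonModule

variable (M : AndersonModule L d)

/-- For `k` large, `∂a^{q^k}` is the multiplication by `a^{q^k}`. -/
theorem exists_del_pow_card (κ : M.E ≅ Ga F L d) (a : F[X]) : ∃ k₀, ∀ k ≥ k₀, ∀ x : M.LieC,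
    lieCoord κ (M.del (a ^ Fintype.card F ^ k) x) =
      polyInf a ^ Fintype.card F ^ k • lieCoord κ x := by
  obtain ⟨N, B, hN, hB, -, hL⟩ := exists_twPoly_coord κ κ (M.φ a)
  let c : L := algebraMap (RatFunc F) L (algebraMap F[X] (RatFunc F) a)
  have hnil : IsNilpotent (B 0 - c • 1) := by
    obtain ⟨r, hr⟩ := M.nilpotent a
    refine ⟨r, ?_⟩
    let f : Module.End F (Lie M.E L) := lieMap (M.φ a) L - lieScalar M.E c
    have h1 : ∀ n, ∀ x : Lie M.E L, lieCoord κ ((f ^ n) x) =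
        ((B 0 - c • 1) ^ n).mulVec (lieCoord κ x) := by
      intro n
      induction n with
      | zero => intro x; simp
      | succ n ih =>
        intro x
        have h2 : lieCoord κ (f x) = (B 0 - c • 1).mulVec (lieCoord κ x) := by
          change lieCoord κ (lieMap (M.φ a) L x - lieScalar M.E c x) = _
          rw [lieCoord_sub, hL, lieCoord_lieScalar, Matrix.sub_mulVec, Matrix.smul_mulVec,
            Matrix.one_mulVec]
          congr 2
        rw [pow_succ, Module.End.mul_apply, ih, h2, Matrix.mulVec_mulVec, pow_succ]
    have h3 : f ^ r = 0 := hr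
    -- Every vector over L is the coordinate vector of a tangent vector, so f^r = 0 becomes a matrix
    -- identity.
    have h4 : (B 0 - c • 1) ^ r = (0 : L) • 1 := by
      refine eq_smul_one_of_mulVec fun v => ?_
      rw [← lieCoord_lieCoordInv κ v, ← h1, h3, zero_smul]
      exact lieCoord_zero κ
    rw [h4, zero_smul]
  obtain ⟨k₀, hk₀⟩ := pow_card_eq_of_isNilpotent (F := F) hnil
  refine ⟨k₀, fun k hk x => ?_⟩
  have h5 : ∀ n, lieCoord κ (M.del (a ^ n) x) =
      ((B 0 ^ n).map (algebraMap L (CInf F))).mulVec (lieCoord κ x) := by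
    intro n
    induction n with
    | zero => rw [pow_zero, pow_zero, map_one, Matrix.map_one _ (map_zero _) (map_one _),
        Matrix.one_mulVec, Module.End.one_apply]
    | succ n ih =>
      rw [pow_succ', map_mul, Module.End.mul_apply]
      refine (hL (CInf F) _).trans ?_
      rw [ih, Matrix.mulVec_mulVec, ← Matrix.map_mul, pow_succ']
  rw [h5, hk₀ k hk]
  have h6 : ((c ^ Fintype.card F ^ k • (1 : Matrix (Fin d) (Fin d) L)).map
      (algebraMap L (CInf F))) =
      polyInf a ^ Fintype.card F ^ k • 1 := by
    ext i j
    simp only [Matrix.map_apply, Matrix.smul_apply, smul_eq_mul, map_mul, map_pow]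
    congr 1
    by_cases hij : i = j
    · subst hij; simp
    · simp [Matrix.one_apply_ne hij]
  rw [h6, Matrix.smul_mulVec, Matrix.one_mulVec]

/-- The exponential function exists. -/
theorem exists_isExponential : ∃ f, M.IsExponential f := by
  obtain ⟨κ⟩ := M.isoGa
  obtain ⟨k₀, hk₀⟩ := M.exists_del_pow_card κ X
  have ht := one_lt_norm_tInf F
  have hX : polyInf (X : F[X]) = tInf F := by simp [polyInf, tInf]
  obtain ⟨m, hm⟩ := pow_unbounded_of_one_lt (4 : ℝ) ht
  -- Large enough both for ∂(t^{q^k}) to be the scalar θ and for ‖θ‖ ≥ 4.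
  let k := k₀ + m
  let a : F[X] := X ^ Fintype.card F ^ k
  let θ : CInf F := tInf F ^ Fintype.card F ^ k
  have hθ : 4 ≤ ‖θ‖ := by
    rw [norm_pow]
    refine hm.le.trans (pow_le_pow_right₀ ht.le ?_)
    have := Nat.lt_pow_self (Fintype.one_lt_card (α := F)) (n := k)
    omega
  have ha : ∀ x : M.LieC, lieCoord κ (M.del a x) = θ • lieCoord κ x := fun x => by
    have := hk₀ k (by omega) x
    rwa [hX] at this
  obtain ⟨N, B, hN, hB, hact, hL⟩ := exists_twPoly_coord κ κ (M.φ a)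
  let B' : ℕ → Matrix (Fin d) (Fin d) (CInf F) := fun n => (B n).map (algebraMap L (CInf F))
  have hB' : ∀ n, N ≤ n → B' n = 0 := fun n hn => by
    simp only [B', hB n hn]
    exact Matrix.map_zero _ (map_zero _)
  have hB0 : B' 0 = θ • 1 := by
    refine eq_smul_one_of_mulVec fun v => ?_
    rw [← lieCoord_lieCoordInv κ v, ← ha]
    exact (hL (CInf F) (lieCoordInv κ v)).symm
  obtain ⟨g, G, hg0, hg, hG⟩ := exists_twSeries_semiconj (F := F) hθ hB' hB0
  let f : M.LieC →ₗ[F] M.Points :=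
    { toFun := fun x => coordInv κ (G (lieCoord κ x))
      map_add' := fun x y => by
        apply coord_injective κ
        rw [coord_add, coord_coordInv, coord_coordInv, coord_coordInv, lieCoord_add, hg.map_add]
      map_smul' := fun c x => by
        apply coord_injective κ
        rw [RingHom.id_apply, coord_smul, coord_coordInv, coord_coordInv, lieCoord_smul]
        exact hg.map_smul c _ }
  have hf : ∀ x, coord κ (f x) = G (lieCoord κ x) := fun x => coord_coordInv κ _
  refine ⟨f, fun b x => ?_, fun κ' => ?_⟩
  · obtain ⟨N₂, B₂, hN₂, hB₂, hact₂, hL₂⟩ := exists_twPoly_coord κ κ (M.φ b)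
    let D : ℕ → Matrix (Fin d) (Fin d) (CInf F) := fun n => (B₂ n).map (algebraMap L (CInf F))
    have hD : ∀ n, N₂ ≤ n → D n = 0 := fun n hn => by
      simp only [D, hB₂ n hn]
      exact Matrix.map_zero _ (map_zero _)
    -- The defect φ_b ∘ G − G ∘ ∂b as a twisted series. It has no linear term, as both parts start
    -- with ∂b.
    have hS := (hg.twPoly_comp N₂ D).sub (hg.comp_mulVec (D 0))
    have hT : ∀ v, twPoly F N B' v = coord κ (M.act a (coordInv κ v)) := fun v => by
      have := hact (coordInv κ v)
      rw [coord_coordInv] at this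
      exact this.symm
    have hT₂ : ∀ v, twPoly F N₂ D v = coord κ (M.act b (coordInv κ v)) := fun v => by
      have := hact₂ (coordInv κ v)
      rw [coord_coordInv] at this
      exact this.symm
    have hinv : ∀ x : M.Points, coordInv κ (coord κ x) = x := fun x =>
      coord_injective κ (coord_coordInv κ _)
    have hcomm : ∀ v, twPoly F N B' (twPoly F N₂ D v) = twPoly F N₂ D (twPoly F N B' v) := by
      intro v
      rw [hT, hT₂, hT₂, hT, hinv, hinv]
      have h1 : M.act a ∘ₗ M.act b = M.act b ∘ₗ M.act a := by
        change ptsMap (M.φ a * M.φ b) (CInf F) = ptsMap (M.φ b * M.φ a) (CInf F)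
        rw [← map_mul, mul_comm, map_mul]
      exact congrArg (coord κ) (LinearMap.congr_fun h1 _)
    have hsub : ∀ v w, twPoly F N B' (v - w) = twPoly F N B' v - twPoly F N B' w := by
      intro v w
      rw [hT, hT, hT, ← coord_sub, ← map_sub]
      congr 2
      apply coord_injective κ
      rw [coord_sub, coord_coordInv, coord_coordInv, coord_coordInv]
    -- Since φ_a and φ_b commute, the defect intertwines θ with φ_a, and rigidity makes it vanish.
    have hz := hS.eq_zero_of_semiconj (by
      rw [twMul_eq hD]
      simp [hg0, twMat_zero]) (θ := θ) (by linarith) hB0 (fun v => by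
        rw [hG, ← hcomm, Matrix.mulVec_smul, hG, ← hsub]) (lieCoord κ x)
    apply coord_injective κ
    rw [hf]
    refine Eq.trans ?_ (hact₂ (f x)).symm
    rw [hf]
    have h2 : lieCoord κ (M.del b x) = (D 0).mulVec (lieCoord κ x) := hL₂ (CInf F) x
    rw [h2]
    exact (sub_eq_zero.mp hz).symm
  · obtain ⟨N₁, B₁, hN₁, hB₁, hp₁, hL₁⟩ := exists_twPoly_coord κ κ' (𝟙 M.E)
    obtain ⟨N₂, B₂, hN₂, hB₂, hp₂, hL₂⟩ := exists_twPoly_coord κ' κ (𝟙 M.E)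
    let P : ℕ → Matrix (Fin d) (Fin d) (CInf F) := fun n => (B₁ n).map (algebraMap L (CInf F))
    let D : Matrix (Fin d) (Fin d) (CInf F) := (B₂ 0).map (algebraMap L (CInf F))
    have hP : ∀ n, N₁ ≤ n → P n = 0 := fun n hn => by
      simp only [P, hB₁ n hn]
      exact Matrix.map_zero _ (map_zero _)
    have hP1 : ∀ x : M.Points, coord κ' x = twPoly F N₁ P (coord κ x) := hp₁
    have hP2 : ∀ x : M.LieC, lieCoord κ' x = (P 0).mulVec (lieCoord κ x) := hL₁ (CInf F)
    have hD2 : ∀ x : M.LieC, lieCoord κ x = D.mulVec (lieCoord κ' x) := hL₂ (CInf F)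
    -- In the coordinates κ' the series is P ∘ G ∘ D, with P the change of coordinates on E and D
    -- the inverse change on the tangent space. Its linear term P_0 D is 1 because P_0 is the
    -- derivative of P.
    have hPD : P 0 * D = 1 := by
      rw [← one_smul (CInf F) (1 : Matrix (Fin d) (Fin d) (CInf F))]
      refine eq_smul_one_of_mulVec fun v => ?_
      rw [← lieCoord_lieCoordInv κ' v, ← Matrix.mulVec_mulVec, ← hD2, ← hP2, one_smul]
    refine ⟨twMul F N₁ P fun n => g n * twMat F n D, ?_, fun x => ?_⟩
    rotate_left
    · have := (hg.comp_mulVec D).twPoly_comp N₁ P (lieCoord κ' x)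
      beta_reduce at this
      rw [← hD2, ← hf, ← hP1] at this
      exact this
    · rw [twMul_eq hP]
      simp [hg0, twMat_zero, hPD]

theorem isExponential_exp : M.IsExponential M.exp := by
  have h := M.exists_isExponential
  rw [exp, dif_pos h]
  exact h.choose_spec

/-- The exponential function in coordinates. -/
def expCoord (κ : M.E ≅ Ga F L d) (v : Fin d → CInf F) : Fin d → CInf F :=
  coord κ (M.exp (lieCoordInv κ v))

theorem lieCoordInv_lieCoord (κ : M.E ≅ Ga F L d) (x : M.LieC) :
    lieCoordInv κ (lieCoord κ x) = x :=
  lieCoord_injective κ (lieCoord_lieCoordInv κ _)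

theorem coord_exp (κ : M.E ≅ Ga F L d) (x : M.LieC) :
    coord κ (M.exp x) = M.expCoord κ (lieCoord κ x) := by
  rw [expCoord, lieCoordInv_lieCoord]

theorem exists_isTwSeries_expCoord (κ : M.E ≅ Ga F L d) :
    ∃ g, g 0 = 1 ∧ IsTwSeries F g (M.expCoord κ) := by
  obtain ⟨e, he0, he⟩ := M.isExponential_exp.2 κ
  refine ⟨e, he0, fun v => ?_⟩
  have := he (lieCoordInv κ v)
  rw [lieCoord_lieCoordInv] at this
  exact this

end AndersonModule

end Exponential

/-! ### Neumann series for a map with a contracting iterate. -/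

section Neumann

variable {Y : Type*} [NormedAddCommGroup Y]

/-- A partial sum S satisfies S ≤ (a_0 + … + a_{m−1}) + cS, which bounds S independently of its
length. -/
theorem summable_of_add_le {a : ℕ → ℝ} (ha : ∀ n, 0 ≤ a n) {c : ℝ} (hc : c < 1) {m : ℕ}
    (h : ∀ n, a (n + m) ≤ c * a n) : Summable a := by
  refine summable_of_sum_range_le (c := (∑ n ∈ Finset.range m, a n) / (1 - c)) ha fun N => ?_
  rw [le_div_iff₀ (by linarith)]
  have h1 : ∑ n ∈ Finset.range N, a n ≤ ∑ n ∈ Finset.range (m + N), a n :=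
    Finset.sum_le_sum_of_subset_of_nonneg (by simp) fun _ _ _ => ha _
  rw [Finset.sum_range_add] at h1
  have h2 : ∑ n ∈ Finset.range N, a (m + n) ≤ c * ∑ n ∈ Finset.range N, a n := by
    rw [Finset.mul_sum]
    exact Finset.sum_le_sum fun n _ => by rw [add_comm]; exact h n
  linarith

theorem summable_iterate [CompleteSpace Y] (T : Y →+ Y) {c : ℝ} (hc : c < 1) {m : ℕ}
    (h : ∀ y, ‖T^[m] y‖ ≤ c * ‖y‖) (y : Y) : Summable fun n => T^[n] y :=
  Summable.of_norm (summable_of_add_le (fun _ => norm_nonneg _) hc (fun n => by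
    rw [add_comm, Function.iterate_add_apply]
    exact h _))

theorem tsum_iterate_sub [CompleteSpace Y] (T : Y →+ Y) (hT : Continuous T) {c : ℝ}
    (hc : c < 1) {m : ℕ} (h : ∀ y, ‖T^[m] y‖ ≤ c * ‖y‖) (y : Y) :
    ∑' n, T^[n] y - T (∑' n, T^[n] y) = y := by
  have hs := summable_iterate T hc h y
  rw [hs.map_tsum T hT, hs.tsum_eq_zero_add]
  simp only [Function.iterate_succ_apply', Function.iterate_zero_apply, add_sub_cancel_right]

theorem eq_zero_of_map_eq_self (T : Y →+ Y) {c : ℝ} (hc : c < 1) {m : ℕ}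
    (h : ∀ y, ‖T^[m] y‖ ≤ c * ‖y‖) {y : Y} (hy : T y = y) : y = 0 := by
  have h1 : T^[m] y = y := Function.iterate_fixed hy m
  have h2 := h y
  rw [h1] at h2
  rw [← norm_le_zero_iff]
  nlinarith [norm_nonneg y]

end Neumann

/-! ### Functoriality of the completed tensor product. -/

section GaussMap

variable {F : Type u} [Field F] {B : Type u} [CommRing B] [Algebra F B]
  {V W U : Type u} [AddCommGroup V] [Module F V] [AddCommGroup W] [Module F W]
  [AddCommGroup U] [Module F U] {ν : AddGroupSeminorm V} {μ : AddGroupSeminorm W}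
  {ξ : AddGroupSeminorm U}

/-- Continuity at `0` for the seminorms `ν` and `μ`. -/
def SeminormContinuous (ν : AddGroupSeminorm V) (μ : AddGroupSeminorm W) (f : V →ₗ[F] W) : Prop :=
  ∀ ε > 0, ∃ δ > 0, ∀ v, ν v < δ → μ (f v) < ε

theorem SeminormContinuous.of_bound {f : V →ₗ[F] W} {K : ℝ} (h : ∀ v, μ (f v) ≤ K * ν v) :
    SeminormContinuous ν μ f := by
  intro ε hε
  -- |K| + 1 replaces K, which may be zero or negative.
  refine ⟨ε / (|K| + 1), by positivity, fun v hv => ?_⟩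
  rw [lt_div_iff₀ (by positivity)] at hv
  have h1 := h v
  have h2 : K * ν v ≤ |K| * ν v := by 
    exact mul_le_mul_of_nonneg_right (le_abs_self K) (apply_nonneg ν v)
  have h3 : 0 ≤ ν v := apply_nonneg ν v
  nlinarith

theorem norm_gaussTensor_le {x : GaussTensor (F := F) B ν} {n : ℕ} {b : Fin n → B} {v : Fin n → V}
    (hx : x = (∑ i, b i ⊗ₜ[F] v i : B ⊗[F] V)) {C : ℝ} (hC : 0 ≤ C) (h : ∀ i, ν (v i) ≤ C) :
    ‖x‖ ≤ C :=
  (csInf_le (gaussValues_bddBelow B ν x) ⟨n, b, v, hx, rfl⟩).trans (Real.iSup_le h hC)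

theorem exists_rep_of_norm_lt {x : GaussTensor (F := F) B ν} {C : ℝ} (h : ‖x‖ < C) :
    ∃ (n : ℕ) (b : Fin n → B) (v : Fin n → V), x = (∑ i, b i ⊗ₜ[F] v i : B ⊗[F] V) ∧
      ∀ i, ν (v i) < C := by
  obtain ⟨r, ⟨n, b, v, hx, rfl⟩, hr⟩ := exists_lt_of_csInf_lt (gaussValues_nonempty B ν x) h
  refine ⟨n, b, v, hx, fun i => lt_of_le_of_lt ?_ hr⟩
  exact le_ciSup (f := fun i => ν (v i)) (Set.finite_range _).bddAbove i

/-- `id ⊗ f` as a map between the normed groups `B ⊗ V` and `B ⊗ W`. -/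
def gaussTensorMap (ν : AddGroupSeminorm V) (μ : AddGroupSeminorm W) (f : V →ₗ[F] W) :
    GaussTensor (F := F) B ν →+ GaussTensor (F := F) B μ :=
  (f.lTensor B).toAddMonoidHom

theorem gaussTensorMap_eq_sum {f : V →ₗ[F] W} {x : GaussTensor (F := F) B ν} {n : ℕ} {b : Fin n → B}
    {v : Fin n → V} (hx : x = (∑ i, b i ⊗ₜ[F] v i : B ⊗[F] V)) :
    gaussTensorMap ν μ f x = (∑ i, b i ⊗ₜ[F] f (v i) : B ⊗[F] W) := by
  subst hx
  exact (map_sum (f.lTensor B) _ _).trans (by simp)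

theorem uniformContinuous_gaussTensorMap {f : V →ₗ[F] W} (hf : SeminormContinuous ν μ f) :
    UniformContinuous (gaussTensorMap (B := B) ν μ f) := by
  refine uniformContinuous_of_continuousAt_zero _ ?_
  rw [Metric.continuousAt_iff]
  intro ε hε
  obtain ⟨δ, hδ, h⟩ := hf (ε / 2) (by positivity)
  refine ⟨δ, hδ, fun x hx => ?_⟩
  rw [map_zero, dist_zero_right]
  rw [dist_zero_right] at hx
  obtain ⟨n, b, v, hx, hv⟩ := exists_rep_of_norm_lt hx
  exact lt_of_le_of_lt (norm_gaussTensor_le (gaussTensorMap_eq_sum hx) (by positivity)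
    fun i => (h _ (hv i)).le) (by linarith)

theorem norm_gaussTensorMap_le {f : V →ₗ[F] W} {K : ℝ} (hK : 0 ≤ K) (h : ∀ v, μ (f v) ≤ K * ν v)
    (x : GaussTensor (F := F) B ν) : ‖gaussTensorMap (B := B) ν μ f x‖ ≤ K * ‖x‖ := by
  have h1 : ∀ C, ‖x‖ < C → ‖gaussTensorMap (B := B) ν μ f x‖ ≤ K * C := by
    intro C hC
    obtain ⟨n, b, v, hx, hv⟩ := exists_rep_of_norm_lt hC
    exact norm_gaussTensor_le (gaussTensorMap_eq_sum hx)
      (mul_nonneg hK ((norm_nonneg x).trans hC.le))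
      fun i => (h _).trans (mul_le_mul_of_nonneg_left (hv i).le hK)
  -- The infimum in the Gauss norm need not be attained, so the bound is proved for each C > ‖x‖ and
  -- C tends to ‖x‖.
  have h2 : Filter.Tendsto (fun C => K * C) (nhdsWithin ‖x‖ (Set.Ioi ‖x‖)) (nhds (K * ‖x‖)) :=
    ((continuous_const.mul continuous_id).tendsto _).mono_left nhdsWithin_le_nhds
  exact ge_of_tendsto h2 (by filter_upwards [self_mem_nhdsWithin] with C hC using h1 C hC)

theorem continuous_gaussMap (f : V →ₗ[F] W) : Continuous (gaussMap B ν μ f) :=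
  UniformSpace.Completion.continuous_map

theorem norm_toGauss (x : B ⊗[F] V) :
    ‖toGauss B ν x‖ = @norm (GaussTensor (F := F) B ν) _ x :=
  UniformSpace.Completion.norm_coe (E := GaussTensor (F := F) B ν) x

theorem gauss_induction {P : GaussCompletion (F := F) B ν → Prop} (z : GaussCompletion (F := F) B ν)
    (hP : IsClosed {z | P z}) (h : ∀ x : B ⊗[F] V, P (toGauss B ν x)) : P z :=
  UniformSpace.Completion.induction_on (α := GaussTensor (F := F) B ν) z hP h

theorem toGauss_add (x y : B ⊗[F] V) : toGauss B ν (x + y) = toGauss B ν x + toGauss B ν y :=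
  UniformSpace.Completion.coe_add (α := GaussTensor (F := F) B ν) x y

theorem toGauss_zero : toGauss B ν (0 : B ⊗[F] V) = 0 :=
  UniformSpace.Completion.coe_zero (α := GaussTensor (F := F) B ν)

/-- The map `toGauss` as a homomorphism. -/
def toGaussHom (B : Type u) [CommRing B] [Algebra F B] (ν : AddGroupSeminorm V) :
    B ⊗[F] V →+ GaussCompletion (F := F) B ν where
  toFun := toGauss B ν
  map_zero' := toGauss_zero
  map_add' := toGauss_add

theorem smul_toGauss (b : B) (x : B ⊗[F] V) : b • toGauss B ν x = toGauss B ν (b • x) :=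
  (UniformSpace.Completion.coe_smul (X := GaussTensor (F := F) B ν) b x).symm

theorem gaussMap_toGauss {f : V →ₗ[F] W} (hf : SeminormContinuous ν μ f) (x : B ⊗[F] V) :
    gaussMap B ν μ f (toGauss B ν x) = toGauss B μ (f.lTensor B x) :=
  UniformSpace.Completion.map_coe (uniformContinuous_gaussTensorMap hf) x

theorem gaussMap_add {f : V →ₗ[F] W} (hf : SeminormContinuous ν μ f)
    (y z : GaussCompletion (F := F) B ν) :
    gaussMap B ν μ f (y + z) = gaussMap B ν μ f y + gaussMap B ν μ f z := by
  have hc := continuous_gaussMap (B := B) (ν := ν) (μ := μ) f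
  induction y using gauss_induction with
  | hP =>
    exact isClosed_eq (by fun_prop) (by fun_prop)
  | h x =>
    induction z using gauss_induction with
    | hP =>
    exact isClosed_eq (by fun_prop) (by fun_prop)
    | h x' =>
      rw [← toGauss_add, gaussMap_toGauss hf, gaussMap_toGauss hf, gaussMap_toGauss hf, map_add,
        toGauss_add]

/-- `gaussMap` as a homomorphism. -/
def gaussHom (B : Type u) [CommRing B] [Algebra F B] {f : V →ₗ[F] W}
    (hf : SeminormContinuous ν μ f) :
    GaussCompletion (F := F) B ν →+ GaussCompletion (F := F) B μ :=
  AddMonoidHom.mk' (gaussMap B ν μ f) (gaussMap_add hf)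

theorem gaussMap_smul {f : V →ₗ[F] W} (hf : SeminormContinuous ν μ f) (b : B)
    (z : GaussCompletion (F := F) B ν) : gaussMap B ν μ f (b • z) = b • gaussMap B ν μ f z := by
  have hc := continuous_gaussMap (B := B) (ν := ν) (μ := μ) f
  induction z using gauss_induction with
  | hP =>
    exact isClosed_eq (hc.comp (continuous_const_smul b)) (hc.const_smul b)
  | h x =>
    rw [smul_toGauss, gaussMap_toGauss hf, gaussMap_toGauss hf, smul_toGauss]
    congr 1
    induction x using TensorProduct.induction_on with
    | zero => simp
    | tmul a v => simp [TensorProduct.smul_tmul']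
    | add x y hx hy => rw [smul_add, map_add, map_add, hx, hy, smul_add]

theorem gaussMap_comp {f : V →ₗ[F] W} (hf : SeminormContinuous ν μ f) {g : W →ₗ[F] U}
    (hg : SeminormContinuous μ ξ g) (hgf : SeminormContinuous ν ξ (g ∘ₗ f))
    (z : GaussCompletion (F := F) B ν) :
    gaussMap B μ ξ g (gaussMap B ν μ f z) = gaussMap B ν ξ (g ∘ₗ f) z := by
  induction z using gauss_induction with
  | hP =>
    exact isClosed_eq ((continuous_gaussMap g).comp (continuous_gaussMap f)) (continuous_gaussMap _)
  | h x =>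
    rw [gaussMap_toGauss hf, gaussMap_toGauss hg, gaussMap_toGauss hgf, LinearMap.lTensor_comp]
    rfl

theorem gaussMap_id (z : GaussCompletion (F := F) B ν) :
    gaussMap B ν ν (LinearMap.id : V →ₗ[F] V) z = z := by
  have hid : SeminormContinuous ν ν (LinearMap.id : V →ₗ[F] V) := fun ε hε => ⟨ε, hε, fun _ h => h⟩
  induction z using gauss_induction with
  | hP =>
    exact isClosed_eq (continuous_gaussMap _) continuous_id
  | h x =>
    rw [gaussMap_toGauss hid, LinearMap.lTensor_id]
    rfl

theorem gaussMap_linear_add {f g : V →ₗ[F] W} (hf : SeminormContinuous ν μ f)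
    (hg : SeminormContinuous ν μ g) (hfg : SeminormContinuous ν μ (f + g))
    (z : GaussCompletion (F := F) B ν) :
    gaussMap B ν μ (f + g) z = gaussMap B ν μ f z + gaussMap B ν μ g z := by
  induction z using gauss_induction with
  | hP =>
    exact isClosed_eq (continuous_gaussMap _) ((continuous_gaussMap _).add (continuous_gaussMap _))
  | h x =>
    rw [gaussMap_toGauss hf, gaussMap_toGauss hg, gaussMap_toGauss hfg, LinearMap.lTensor_add,
      ← toGauss_add]
    rfl

theorem gaussMap_linear_smul {f : V →ₗ[F] W} (hf : SeminormContinuous ν μ f) (c : F)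
    (hcf : SeminormContinuous ν μ (c • f)) (z : GaussCompletion (F := F) B ν) :
    gaussMap B ν μ (c • f) z = algebraMap F B c • gaussMap B ν μ f z := by
  induction z using gauss_induction with
  | hP =>
    exact isClosed_eq (continuous_gaussMap _)
      ((continuous_const_smul (algebraMap F B c)).comp (continuous_gaussMap f))
  | h x =>
    rw [gaussMap_toGauss hf, gaussMap_toGauss hcf, smul_toGauss, LinearMap.lTensor_smul,
      algebraMap_smul]
    rfl

theorem norm_gaussMap_le {f : V →ₗ[F] W} {K : ℝ} (hK : 0 ≤ K) (h : ∀ v, μ (f v) ≤ K * ν v)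
    (z : GaussCompletion (F := F) B ν) : ‖gaussMap B ν μ f z‖ ≤ K * ‖z‖ := by
  have hc := continuous_gaussMap (B := B) (ν := ν) (μ := μ) f
  induction z using gauss_induction with
  | hP => exact isClosed_le (by fun_prop) (by fun_prop)
  | h x =>
    rw [gaussMap_toGauss (.of_bound h), norm_toGauss, norm_toGauss]
    exact norm_gaussTensorMap_le hK h x

theorem norm_gauss_smul_le (b : B) (z : GaussCompletion (F := F) B ν) : ‖b • z‖ ≤ ‖z‖ := by
  induction z using gauss_induction with
  | hP => exact isClosed_le (continuous_const_smul b).norm continuous_norm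
  | h x =>
    rw [smul_toGauss, norm_toGauss, norm_toGauss]
    exact gauss_norm_smul_le B ν b x

end GaussMap

/-! ### Coefficients of elements of 𝔽[t] ⊗̂ V. -/

section GaussCoeff

variable {F : Type u} [Field F] {V : Type u} [AddCommGroup V] [Module F V] {ν : AddGroupSeminorm V}

/-- The coefficient of `t^n` of an element of `𝔽[t] ⊗ V`. -/
def tensorCoeff (F V : Type u) [Field F] [AddCommGroup V] [Module F V] (n : ℕ) :
    F[X] ⊗[F] V →ₗ[F] V :=
  TensorProduct.lid F V ∘ₗ (Polynomial.lcoeff F n).rTensor V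

@[simp]
theorem tensorCoeff_tmul (n : ℕ) (a : F[X]) (v : V) :
    tensorCoeff F V n (a ⊗ₜ v) = a.coeff n • v := by
  simp [tensorCoeff]

theorem eq_sum_tensorCoeff (x : F[X] ⊗[F] V) :
    ∃ N, (∀ n, N ≤ n → tensorCoeff F V n x = 0) ∧
      x = ∑ n : Fin N, (X ^ (n : ℕ) : F[X]) ⊗ₜ[F] tensorCoeff F V n x := by
  -- Allowing every length m ≥ N lets two such expansions be added.
  suffices h : ∃ N, ∀ m, N ≤ m → tensorCoeff F V m x = 0 ∧
      x = ∑ n ∈ Finset.range m, (X ^ n : F[X]) ⊗ₜ[F] tensorCoeff F V n x by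
    obtain ⟨N, h⟩ := h
    refine ⟨N, fun n hn => (h n hn).1, ?_⟩
    rw [← Finset.sum_range fun n => (X ^ n : F[X]) ⊗ₜ[F] tensorCoeff F V n x]
    exact (h N le_rfl).2
  induction x using TensorProduct.induction_on with
  | zero => exact ⟨0, fun m _ => by simp⟩
  | tmul a v =>
    refine ⟨a.natDegree + 1, fun m hm => ⟨?_, ?_⟩⟩
    · rw [tensorCoeff_tmul, coeff_eq_zero_of_natDegree_lt (by omega), zero_smul]
    · conv_lhs => rw [a.as_sum_range' m (by omega), TensorProduct.sum_tmul]
      refine Finset.sum_congr rfl fun n _ => ?_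
      rw [tensorCoeff_tmul, ← C_mul_X_pow_eq_monomial, ← smul_eq_C_mul, TensorProduct.smul_tmul]
  | add x y hx hy =>
    obtain ⟨N, hN⟩ := hx
    obtain ⟨M, hM⟩ := hy
    refine ⟨max N M, fun m hm => ⟨?_, ?_⟩⟩
    · rw [map_add, (hN m (by omega)).1, (hM m (by omega)).1, add_zero]
    · conv_lhs => rw [(hN m (by omega)).2, (hM m (by omega)).2]
      rw [← Finset.sum_add_distrib]
      simp only [map_add, TensorProduct.tmul_add]

/-- The seminorm `ν` is nonarchimedean and compatible with the trivial absolute value of `𝔽`. -/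
structure IsUltraSeminorm (F : Type u) {V : Type u} [Field F] [AddCommGroup V] [Module F V]
    (ν : AddGroupSeminorm V) : Prop where
  add_le_max : ∀ v w, ν (v + w) ≤ max (ν v) (ν w)
  smul_le : ∀ (c : F) v, ν (c • v) ≤ ν v

theorem IsUltraSeminorm.sum_le (h : IsUltraSeminorm F ν) {ι : Type*} (s : Finset ι) (v : ι → V)
    {C : ℝ} (hC : 0 ≤ C) (hv : ∀ i ∈ s, ν (v i) ≤ C) : ν (∑ i ∈ s, v i) ≤ C := by
  classical
  induction s using Finset.induction_on with
  | empty => simpa using hC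
  | insert i s hi ih =>
    rw [Finset.sum_insert hi]
    exact (h.add_le_max _ _).trans (max_le (hv i (by simp)) (ih fun j hj => hv j (by simp [hj])))

/-- Together with `norm_le_of_tensorCoeff_le` this says that the Gauss norm on 𝔽[t] ⊗ V is the
maximum norm of the coefficients. In any representation a coefficient is an 𝔽-combination of the
v_i, so the ultrametric inequality applies. -/
theorem IsUltraSeminorm.tensorCoeff_le (h : IsUltraSeminorm F ν) (n : ℕ)
    (x : GaussTensor (F := F) F[X] ν) : ν (tensorCoeff F V n x) ≤ ‖x‖ := by
  refine le_of_forall_gt_imp_ge_of_dense fun C hC => ?_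
  obtain ⟨m, b, v, hx, hv⟩ := exists_rep_of_norm_lt hC
  have h0 : 0 ≤ C := (norm_nonneg x).trans hC.le
  subst hx
  rw [map_sum]
  refine h.sum_le _ _ h0 fun i _ => ?_
  rw [tensorCoeff_tmul]
  exact (h.smul_le _ _).trans (hv i).le

theorem norm_le_of_tensorCoeff_le (x : GaussTensor (F := F) F[X] ν) {C : ℝ} (hC : 0 ≤ C)
    (h : ∀ n, ν (tensorCoeff F V n x) ≤ C) : ‖x‖ ≤ C := by
  obtain ⟨N, -, hx⟩ := eq_sum_tensorCoeff (x : F[X] ⊗[F] V)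
  exact norm_gaussTensor_le hx hC fun i => h i

variable {W : Type u} [NormedAddCommGroup W] [CompleteSpace W]

theorem continuous_coord_tensorCoeff (h : IsUltraSeminorm F ν) (c : V →+ W)
    (hc : ∀ v, ‖c v‖ = ν v) (n : ℕ) :
    Continuous (c.comp (tensorCoeff F V n).toAddMonoidHom :
      GaussTensor (F := F) F[X] ν →+ W) :=
  AddMonoidHomClass.continuous_of_bound (c.comp (tensorCoeff F V n).toAddMonoidHom :
      GaussTensor (F := F) F[X] ν →+ W) 1 fun x => by
    rw [one_mul]
    exact (hc _).trans_le (h.tensorCoeff_le n x)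

/-- The coefficient of `t^n` of an element of `𝔽[t] ⊗̂ V`, in the coordinates `c`. -/
def gaussCoeff (h : IsUltraSeminorm F ν) (c : V →+ W) (hc : ∀ v, ‖c v‖ = ν v) (n : ℕ) :
    GaussCompletion (F := F) F[X] ν →+ W :=
  AddMonoidHom.extension _ (continuous_coord_tensorCoeff h c hc n)

variable (h : IsUltraSeminorm F ν) (c : V →+ W) (hc : ∀ v, ‖c v‖ = ν v)

theorem continuous_gaussCoeff (n : ℕ) : Continuous (gaussCoeff h c hc n) :=
  AddMonoidHom.continuous_extension _ (continuous_coord_tensorCoeff h c hc n)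

theorem gaussCoeff_toGauss (n : ℕ) (x : F[X] ⊗[F] V) :
    gaussCoeff h c hc n (toGauss F[X] ν x) = c (tensorCoeff F V n x) :=
  AddMonoidHom.extension_coe _ (continuous_coord_tensorCoeff h c hc n) x

theorem norm_gaussCoeff_le (n : ℕ) (z : GaussCompletion (F := F) F[X] ν) :
    ‖gaussCoeff h c hc n z‖ ≤ ‖z‖ := by
  induction z using gauss_induction with
  | hP => exact isClosed_le (continuous_gaussCoeff h c hc n).norm continuous_norm
  | h x =>
    rw [gaussCoeff_toGauss, hc, norm_toGauss]
    exact h.tensorCoeff_le n x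

theorem exists_toGauss_near (z : GaussCompletion (F := F) F[X] ν) {ε : ℝ} (hε : 0 < ε) :
    ∃ x : F[X] ⊗[F] V, ‖z - toGauss F[X] ν x‖ < ε := by
  obtain ⟨x, hx⟩ := (UniformSpace.Completion.denseRange_coe
    (α := GaussTensor (F := F) F[X] ν)).exists_dist_lt z hε
  exact ⟨x, by rwa [dist_eq_norm] at hx⟩

/-- A tensor close to y − z has small coefficients, hence small Gauss norm, so y − z itself is
arbitrarily small. -/
theorem gauss_ext {y z : GaussCompletion (F := F) F[X] ν}
    (hyz : ∀ n, gaussCoeff h c hc n y = gaussCoeff h c hc n z) : y = z := by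
  rw [← sub_eq_zero, ← norm_le_zero_iff]
  refine le_of_forall_pos_le_add fun ε hε => ?_
  obtain ⟨x, hx⟩ := exists_toGauss_near (y - z) (half_pos hε)
  have h1 : ‖toGauss F[X] ν x‖ ≤ ε / 2 := by
    rw [norm_toGauss]
    refine norm_le_of_tensorCoeff_le _ (by positivity) fun n => ?_
    rw [← hc, ← gaussCoeff_toGauss h c hc]
    have h2 := norm_gaussCoeff_le h c hc n (y - z - toGauss F[X] ν x)
    rw [map_sub, map_sub, hyz n, sub_self, zero_sub, norm_neg] at h2
    exact h2.trans hx.le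
  have h3 := norm_add_le (y - z - toGauss F[X] ν x) (toGauss F[X] ν x)
  rw [sub_add_cancel] at h3
  linarith

theorem tendsto_gaussCoeff (z : GaussCompletion (F := F) F[X] ν) :
    Filter.Tendsto (fun n => gaussCoeff h c hc n z) Filter.atTop (nhds 0) := by
  rw [Metric.tendsto_atTop]
  intro ε hε
  obtain ⟨x, hx⟩ := exists_toGauss_near z hε
  obtain ⟨N, hN, -⟩ := eq_sum_tensorCoeff x
  refine ⟨N, fun n hn => ?_⟩
  rw [dist_zero_right]
  have h2 := norm_gaussCoeff_le h c hc n (z - toGauss F[X] ν x)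
  rw [map_sub, gaussCoeff_toGauss, hN n hn, map_zero, sub_zero] at h2
  exact h2.trans_lt hx

theorem gaussCoeff_X_smul_succ (n : ℕ) (z : GaussCompletion (F := F) F[X] ν) :
    gaussCoeff h c hc (n + 1) ((X : F[X]) • z) = gaussCoeff h c hc n z := by
  induction z using gauss_induction with
  | hP =>
    exact isClosed_eq ((continuous_gaussCoeff h c hc _).comp (continuous_const_smul _))
      (continuous_gaussCoeff h c hc n)
  | h x =>
    rw [smul_toGauss, gaussCoeff_toGauss, gaussCoeff_toGauss]
    congr 1
    induction x using TensorProduct.induction_on with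
    | zero => simp
    | tmul a v => simp [TensorProduct.smul_tmul']
    | add x y hx hy => rw [smul_add, map_add, map_add, hx, hy]

theorem gaussCoeff_X_smul_zero (z : GaussCompletion (F := F) F[X] ν) :
    gaussCoeff h c hc 0 ((X : F[X]) • z) = 0 := by
  induction z using gauss_induction with
  | hP =>
    exact isClosed_eq ((continuous_gaussCoeff h c hc _).comp (continuous_const_smul _))
      continuous_const
  | h x =>
    rw [smul_toGauss, gaussCoeff_toGauss, ← map_zero c]
    congr 1
    induction x using TensorProduct.induction_on with
    | zero => simp
    | tmul a v => simp [TensorProduct.smul_tmul']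
    | add x y hx hy => rw [smul_add, map_add, hx, hy, add_zero]

theorem gaussCoeff_gaussMap {f : V →ₗ[F] V} (hf : SeminormContinuous ν ν f) {f' : W → W}
    (hf' : Continuous f') (hff' : ∀ v, c (f v) = f' (c v)) (n : ℕ)
    (z : GaussCompletion (F := F) F[X] ν) :
    gaussCoeff h c hc n (gaussMap F[X] ν ν f z) = f' (gaussCoeff h c hc n z) := by
  induction z using gauss_induction with
  | hP =>
    exact isClosed_eq ((continuous_gaussCoeff h c hc _).comp (continuous_gaussMap f))
      (hf'.comp (continuous_gaussCoeff h c hc n))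
  | h x =>
    rw [gaussMap_toGauss hf, gaussCoeff_toGauss, gaussCoeff_toGauss, ← hff']
    congr 1
    induction x using TensorProduct.induction_on with
    | zero => simp
    | tmul a v => simp
    | add x y hx hy => rw [map_add, map_add, hx, hy, map_add, map_add]

theorem gaussCoeff_of_hasSum {v : ℕ → V} {z : GaussCompletion (F := F) F[X] ν}
    (hz : HasSum (fun n => toGauss F[X] ν ((X ^ n : F[X]) ⊗ₜ[F] v n)) z) (n : ℕ) :
    gaussCoeff h c hc n z = c (v n) := by
  have h1 := hz.map (gaussCoeff h c hc n) (continuous_gaussCoeff h c hc n)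
  refine h1.unique ?_
  have h2 := hasSum_ite_eq n (c (v n))
  refine hasSum_of_eq h2 fun m => ?_
  rw [Function.comp_apply, gaussCoeff_toGauss, tensorCoeff_tmul, coeff_X_pow]
  by_cases hm : m = n
  · subst hm; simp
  · rw [if_neg (Ne.symm hm), if_neg hm, zero_smul, map_zero]

end GaussCoeff

/-! ### Inverting ∂u and 1 ⊗ ∂u − u ⊗ 1. -/

section Twist

open scoped Matrix.Norms.Elementwise

variable {F : Type u} [Field F] [Fintype F] {L : IntermediateField (RatFunc F) (CInf F)} {d : ℕ}

theorem SeminormContinuous.of_coord {V V' W W' : Type u} [AddCommGroup V] [Module F V]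
    [AddCommGroup V'] [Module F V'] [NormedAddCommGroup W] [NormedAddCommGroup W']
    {ν : AddGroupSeminorm V} {μ : AddGroupSeminorm V'} {f : V →ₗ[F] V'} {c : V → W} {c' : V' → W'}
    (hc : ∀ v, ‖c v‖ = ν v) (hc' : ∀ v, ‖c' v‖ = μ v) {f' : W → W'} (hf : Continuous f')
    (hf0 : f' 0 = 0) (h : ∀ v, c' (f v) = f' (c v)) : SeminormContinuous ν μ f := by
  intro ε hε
  obtain ⟨δ, hδ, h1⟩ := Metric.continuousAt_iff.mp hf.continuousAt ε hε
  refine ⟨δ, hδ, fun v hv => ?_⟩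
  have h2 := h1 (x := c v) (by rwa [dist_zero_right, hc])
  rwa [hf0, dist_zero_right, ← h, hc'] at h2

theorem continuous_twPoly {C : Type u} [NormedField C] [Algebra F C] (N : ℕ)
    (B : ℕ → Matrix (Fin d) (Fin d) C) : Continuous (twPoly F N B) :=
  continuous_finsetSum _ fun n _ => (continuous_mulVec (B n)).comp (continuous_twPow F n)

namespace AndersonModule

variable (M : AndersonModule L d) (κ : M.E ≅ Ga F L d)

/-- The coordinates on `E(ℂ_∞)` as a homomorphism. -/
def coordHom : M.Points →+ (Fin d → CInf F) := AddMonoidHom.mk' (coord κ) (coord_add κ)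

theorem norm_coordHom (x : M.Points) : ‖M.coordHom κ x‖ = M.normPoints κ x := rfl

theorem norm_lieCoord (x : M.LieC) : ‖lieCoord κ x‖ = M.normLie κ x := rfl

theorem algebraMap_inf_smul {ι : Type*} (c : F) (v : ι → CInf F) :
    algebraMap F L c • v = algebraMap F (CInf F) c • v := rfl

theorem isUltraSeminorm_normPoints : IsUltraSeminorm F (M.normPoints κ) where
  add_le_max v w := by
    change ‖coord κ (v + w)‖ ≤ max ‖coord κ v‖ ‖coord κ w‖
    rw [coord_add]
    exact IsUltrametricDist.norm_add_le_max _ _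
  smul_le c v := by
    change ‖coord κ (c • v)‖ ≤ ‖coord κ v‖
    rw [coord_smul, algebraMap_inf_smul, norm_smul]
    exact mul_le_of_le_one_left (norm_nonneg _) (norm_algebraMap_le c)

theorem exists_act_coord (a : F[X]) :
    ∃ f' : (Fin d → CInf F) → (Fin d → CInf F), Continuous f' ∧ f' 0 = 0 ∧
      ∀ x, M.coordHom κ (M.act a x) = f' (M.coordHom κ x) := by
  obtain ⟨N, B, -, -, h, -⟩ := exists_twPoly_coord κ κ (M.φ a)
  exact ⟨_, continuous_twPoly _ _, twPoly_zero _ _, h⟩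

theorem seminormContinuous_act (a : F[X]) :
    SeminormContinuous (M.normPoints κ) (M.normPoints κ) (M.act a) := by
  obtain ⟨f', hf, hf0, h⟩ := M.exists_act_coord κ a
  exact .of_coord (M.norm_coordHom κ) (M.norm_coordHom κ) hf hf0 h

theorem expCoord_continuous : Continuous (M.expCoord κ) := by
  obtain ⟨g, -, hg⟩ := M.exists_isTwSeries_expCoord κ
  exact hg.continuous

theorem expCoord_zero : M.expCoord κ 0 = 0 := by
  obtain ⟨g, -, hg⟩ := M.exists_isTwSeries_expCoord κ
  exact hg.map_zero

theorem seminormContinuous_exp :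
    SeminormContinuous (M.normLie κ) (M.normPoints κ) M.exp :=
  .of_coord (M.norm_lieCoord κ) (M.norm_coordHom κ) (M.expCoord_continuous κ) (M.expCoord_zero κ)
    (M.coord_exp κ)

theorem exists_del_bound (a : F[X]) :
    ∃ K, 0 ≤ K ∧ ∀ v, M.normLie κ (M.del a v) ≤ K * M.normLie κ v := by
  obtain ⟨N, B, -, -, -, h⟩ := exists_twPoly_coord κ κ (M.φ a)
  refine ⟨_, norm_nonneg ((B 0).map (algebraMap L (CInf F))), fun v => ?_⟩
  have h1 : lieCoord κ (M.del a v) = _ := h (CInf F) v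
  rw [← norm_lieCoord, h1]
  exact norm_mulVec_le _ _

theorem seminormContinuous_del (a : F[X]) :
    SeminormContinuous (M.normLie κ) (M.normLie κ) (M.del a) := by
  obtain ⟨K, -, hK⟩ := M.exists_del_bound κ a
  exact .of_bound hK

theorem normLie_lieScalar (c : CInf F) (v : M.LieC) :
    M.normLie κ (lieScalar M.E c v) = ‖c‖ * M.normLie κ v := by
  rw [← norm_lieCoord, lieCoord_lieScalar, norm_smul, norm_lieCoord]

/-- A coordinate-free form of `exists_del_pow_card`, from which the invertibility of ∂u and the size
of the powers of its inverse are read off. -/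
theorem exists_del_pow_eq (u : F[X]) :
    ∃ m, 0 < m ∧ M.del u ^ m = lieScalar M.E (polyInf u ^ m) := by
  obtain ⟨κ⟩ := M.isoGa
  obtain ⟨k, hk⟩ := M.exists_del_pow_card κ u
  refine ⟨Fintype.card F ^ k, card_pow_pos F k, ?_⟩
  rw [← map_pow]
  ext1 x
  apply lieCoord_injective κ
  rw [hk k le_rfl, lieCoord_lieScalar]

theorem lieScalar_mul_lieScalar (c c' : CInf F) (h : c * c' = 1) :
    (lieScalar M.E c : Module.End F M.LieC) * lieScalar M.E c' = 1 := by
  obtain ⟨κ⟩ := M.isoGa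
  ext1 x
  apply lieCoord_injective κ
  rw [Module.End.mul_apply, lieCoord_lieScalar, lieCoord_lieScalar, smul_smul, h, one_smul,
    Module.End.one_apply]

theorem isUnit_del {u : F[X]} (hu : u ≠ 0) : IsUnit (M.del u) := by
  obtain ⟨m, hm, h⟩ := M.exists_del_pow_eq u
  rw [← isUnit_pow_iff hm.ne', h]
  have h0 : polyInf u ^ m ≠ 0 := pow_ne_zero _ (polyInf_ne_zero hu)
  exact ⟨⟨_, lieScalar M.E (polyInf u ^ m)⁻¹, M.lieScalar_mul_lieScalar _ _ (mul_inv_cancel₀ h0),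
    M.lieScalar_mul_lieScalar _ _ (inv_mul_cancel₀ h0)⟩, rfl⟩

/-- The inverse of `∂u`. -/
def delInv (u : F[X]) : Module.End F M.LieC := Ring.inverse (M.del u)

theorem del_mul_delInv {u : F[X]} (hu : u ≠ 0) : M.del u * M.delInv u = 1 :=
  Ring.mul_inverse_cancel _ (M.isUnit_del hu)

theorem delInv_mul_del {u : F[X]} (hu : u ≠ 0) : M.delInv u * M.del u = 1 :=
  Ring.inverse_mul_cancel _ (M.isUnit_del hu)

/-- The formula for the m-th power controls growth under iteration; the formula for ∂u⁻¹ itself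
gives its boundedness. -/
theorem exists_delInv_pow_eq {u : F[X]} (hu : u ≠ 0) :
    ∃ m, 0 < m ∧ M.delInv u ^ m = lieScalar M.E (polyInf u ^ m)⁻¹ ∧
      M.delInv u = lieScalar M.E (polyInf u ^ m)⁻¹ * M.del (u ^ (m - 1)) := by
  obtain ⟨m, hm, h⟩ := M.exists_del_pow_eq u
  have h0 : polyInf u ^ m ≠ 0 := pow_ne_zero _ (polyInf_ne_zero hu)
  have hc : Commute (M.del u) (M.delInv u) := by
    rw [Commute, SemiconjBy, del_mul_delInv M hu, delInv_mul_del M hu]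
  have h1 : M.delInv u ^ m = lieScalar M.E (polyInf u ^ m)⁻¹ := by
    have h2 : M.delInv u ^ m * M.del u ^ m = 1 := by
      rw [← hc.symm.mul_pow, delInv_mul_del M hu, one_pow]
    rw [h] at h2
    rw [← mul_one (M.delInv u ^ m), ← M.lieScalar_mul_lieScalar _ _ (mul_inv_cancel₀ h0),
      ← mul_assoc, h2, one_mul]
  refine ⟨m, hm, h1, ?_⟩
  rw [← h1, map_pow]
  obtain ⟨k, rfl⟩ : ∃ k, m = k + 1 := ⟨m - 1, by omega⟩
  rw [Nat.add_sub_cancel, pow_succ', mul_assoc, ← hc.symm.mul_pow, delInv_mul_del M hu, one_pow,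
    mul_one]

theorem exists_delInv_bound {u : F[X]} (hu : u ≠ 0) :
    ∃ K, 0 ≤ K ∧ ∀ v, M.normLie κ (M.delInv u v) ≤ K * M.normLie κ v := by
  obtain ⟨m, -, -, h⟩ := M.exists_delInv_pow_eq hu
  obtain ⟨K, hK0, hK⟩ := M.exists_del_bound κ (u ^ (m - 1))
  refine ⟨‖(polyInf u ^ m)⁻¹‖ * K, by positivity, fun v => ?_⟩
  rw [h, Module.End.mul_apply, normLie_lieScalar, mul_assoc]
  gcongr
  exact hK v

theorem exists_delInv_pow_bound {u : F[X]} (hu : u ≠ 0) (n : ℕ) :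
    ∃ K, 0 ≤ K ∧ ∀ v, M.normLie κ ((M.delInv u ^ n) v) ≤ K * M.normLie κ v := by
  obtain ⟨K, hK0, hK⟩ := M.exists_delInv_bound κ hu
  induction n with
  | zero => exact ⟨1, zero_le_one, fun v => by simp⟩
  | succ n ih =>
    obtain ⟨K', hK0', hK'⟩ := ih
    refine ⟨K' * K, by positivity, fun v => ?_⟩
    rw [pow_succ, Module.End.mul_apply, mul_assoc]
    exact (hK' _).trans (mul_le_mul_of_nonneg_left (hK v) hK0')

theorem seminormContinuous_delInv_pow {u : F[X]} (hu : u ≠ 0) (n : ℕ) :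
    SeminormContinuous (M.normLie κ) (M.normLie κ) (M.delInv u ^ n) := by
  obtain ⟨K, -, hK⟩ := M.exists_delInv_pow_bound κ hu n
  exact .of_bound hK

/-- The map `1 ⊗ ∂u⁻ⁿ` on `Lie_E(𝕋)`. -/
def delInvT (u : F[X]) (n : ℕ) : M.LieT κ → M.LieT κ :=
  gaussMap F[X] (M.normLie κ) (M.normLie κ) (M.delInv u ^ n)

theorem delInvT_add {u : F[X]} (hu : u ≠ 0) (m n : ℕ) (z : M.LieT κ) :
    M.delInvT κ u m (M.delInvT κ u n z) = M.delInvT κ u (m + n) z := by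
  rw [delInvT, delInvT, delInvT, gaussMap_comp (M.seminormContinuous_delInv_pow κ hu n)
    (M.seminormContinuous_delInv_pow κ hu m) (by
      have := M.seminormContinuous_delInv_pow κ hu (m + n)
      rwa [pow_add] at this), pow_add]
  rfl

theorem delInvT_smul {u : F[X]} (hu : u ≠ 0) (n : ℕ) (a : F[X]) (z : M.LieT κ) :
    M.delInvT κ u n (a • z) = a • M.delInvT κ u n z :=
  gaussMap_smul (M.seminormContinuous_delInv_pow κ hu n) a z

theorem delT_delInvT {u : F[X]} (hu : u ≠ 0) (z : M.LieT κ) :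
    M.delT κ u (M.delInvT κ u 1 z) = z := by
  have h : M.del u ∘ₗ (M.delInv u ^ 1) = LinearMap.id := by
    rw [pow_one]; exact M.del_mul_delInv hu
  rw [delT, delInvT, gaussMap_comp (M.seminormContinuous_delInv_pow κ hu 1)
    (M.seminormContinuous_del κ u) (by rw [h]; exact fun ε hε => ⟨ε, hε, fun _ h => h⟩), h,
    gaussMap_id]

theorem delInvT_delT {u : F[X]} (hu : u ≠ 0) (z : M.LieT κ) :
    M.delInvT κ u 1 (M.delT κ u z) = z := by
  have h : (M.delInv u ^ 1) ∘ₗ M.del u = LinearMap.id := by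
    rw [pow_one]; exact M.delInv_mul_del hu
  rw [delT, delInvT, gaussMap_comp (M.seminormContinuous_del κ u)
    (M.seminormContinuous_delInv_pow κ hu 1) (by rw [h]; exact fun ε hε => ⟨ε, hε, fun _ h => h⟩),
    h, gaussMap_id]

/-- The map `u ⊗ ∂u⁻¹` on `Lie_E(𝕋)`. -/
def twistIter {u : F[X]} (hu : u ≠ 0) : M.LieT κ →+ M.LieT κ :=
  AddMonoidHom.mk' (fun z => u • M.delInvT κ u 1 z) fun y z => by
    rw [delInvT, gaussMap_add (M.seminormContinuous_delInv_pow κ hu 1), smul_add]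

theorem twistIter_iterate {u : F[X]} (hu : u ≠ 0) (n : ℕ) (z : M.LieT κ) :
    (M.twistIter κ hu)^[n] z = u ^ n • M.delInvT κ u n z := by
  induction n with
  | zero =>
    rw [Function.iterate_zero_apply, pow_zero, one_smul, delInvT, pow_zero]
    exact (gaussMap_id z).symm
  | succ n ih =>
    rw [Function.iterate_succ_apply', ih]
    change u • M.delInvT κ u 1 _ = _
    rw [delInvT_smul M κ hu, delInvT_add M κ hu, smul_smul, pow_succ', add_comm]

theorem continuous_twistIter {u : F[X]} (hu : u ≠ 0) : Continuous (M.twistIter κ hu) :=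
  (continuous_const_smul u).comp (continuous_gaussMap _)

/-- A single step need not contract, because the nilpotent part of ∂u may be large. After m steps
∂u⁻ᵐ is a scalar of norm less than 1, and multiplication by uᵐ does not increase the Gauss norm. -/
theorem exists_twistIter_contract {u : F[X]} (hu : u ≠ 0) (hdeg : u.natDegree ≠ 0) :
    ∃ m : ℕ, ∃ c : ℝ, c < 1 ∧ ∀ z, ‖(M.twistIter κ hu)^[m] z‖ ≤ c * ‖z‖ := by
  obtain ⟨m, hm, h, -⟩ := M.exists_delInv_pow_eq hu
  refine ⟨m, ‖(polyInf u ^ m)⁻¹‖, ?_, fun z => ?_⟩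
  · rw [norm_inv, norm_pow]
    exact inv_lt_one_of_one_lt₀ (one_lt_pow₀ (one_lt_norm_polyInf hdeg) hm.ne')
  · rw [twistIter_iterate]
    refine (norm_gauss_smul_le _ _).trans ?_
    rw [delInvT, h]
    exact norm_gaussMap_le (norm_nonneg _) (fun v => (M.normLie_lieScalar κ _ v).le) z

/-- The factorization 1⊗∂u − u⊗1 = (1 − T)(1⊗∂u) with T = u⊗∂u⁻¹, which reduces the inversion to
that of 1 − T. -/
theorem twist_eq {u : F[X]} (hu : u ≠ 0) (z : M.LieT κ) :
    M.twist κ u z = M.delT κ u z - M.twistIter κ hu (M.delT κ u z) := by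
  change _ = M.delT κ u z - u • M.delInvT κ u 1 (M.delT κ u z)
  rw [delInvT_delT M κ hu]
  rfl

/-- The inverse of `1 ⊗ ∂u - u ⊗ 1` is `∑ uⁿ ⊗ ∂u⁻ⁿ⁻¹`. -/
theorem twist_bijective_and_hasSum {u : F[X]} (hdeg : u.natDegree ≠ 0) :
    Function.Bijective (M.twist κ u) ∧
      ∀ x, HasSum (fun n => u ^ n • M.delInvT κ u (n + 1) x) (Function.invFun (M.twist κ u) x) := by
  have hu : u ≠ 0 := by rintro rfl; simp at hdeg
  obtain ⟨m, c, hc, h⟩ := M.exists_twistIter_contract κ hu hdeg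
  have hadd : ∀ y z, M.delT κ u (y - z) = M.delT κ u y - M.delT κ u z :=
    map_sub (gaussHom F[X] (M.seminormContinuous_del κ u))
  have hinj : Function.Injective (M.twist κ u) := by
    intro y z hyz
    rw [twist_eq M κ hu, twist_eq M κ hu] at hyz
    have h1 : M.twistIter κ hu (M.delT κ u (y - z)) = M.delT κ u (y - z) := by
      rw [hadd, map_sub]
      rw [sub_eq_sub_iff_sub_eq_sub] at hyz
      exact hyz.symm
    have h2 := eq_zero_of_map_eq_self _ hc h h1
    rw [← sub_eq_zero, ← M.delInvT_delT κ hu (y - z), h2]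
    exact map_zero (gaussHom F[X] (M.seminormContinuous_delInv_pow κ hu 1))
  have hsol : ∀ x, M.twist κ u (M.delInvT κ u 1 (∑' n, (M.twistIter κ hu)^[n] x)) = x := fun x => by
    rw [twist_eq M κ hu, delT_delInvT M κ hu]
    exact tsum_iterate_sub _ (M.continuous_twistIter κ hu) hc h x
  refine ⟨⟨hinj, fun x => ⟨_, hsol x⟩⟩, fun x => ?_⟩
  -- Injectivity identifies the chosen preimage with the one given by the Neumann series.
  have h1 : Function.invFun (M.twist κ u) x = M.delInvT κ u 1 (∑' n, (M.twistIter κ hu)^[n] x) :=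
    hinj ((Function.invFun_eq ⟨_, hsol x⟩).trans (hsol x).symm)
  rw [h1]
  have h2 := (summable_iterate _ hc h x).hasSum.map
    (gaussHom F[X] (M.seminormContinuous_delInv_pow κ hu 1)) (continuous_gaussMap _)
  refine hasSum_of_eq h2 fun n => ?_
  rw [Function.comp_apply, twistIter_iterate]
  change _ = M.delInvT κ u 1 _
  rw [delInvT_smul M κ hu, delInvT_add M κ hu, add_comm]

end AndersonModule

end Twist

/-! ### Divided differences acting on A ⊗ N. -/

section TensorModule

variable {F : Type u} [Field F]

section GaussTensorHom

variable {B : Type u} [CommRing B] [Algebra F B] {N V W : Type u} [AddCommGroup N] [Module F N]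
  [AddCommGroup V] [Module F V] [AddCommGroup W] [Module F W]

/-- The map `B ⊗ N → B ⊗̂ V` induced by a linear map `N → V`. -/
def gaussOfTensor (B : Type u) [CommRing B] [Algebra F B] (ν : AddGroupSeminorm V) (f : N →ₗ[F] V) :
    B ⊗[F] N →+ GaussCompletion (F := F) B ν :=
  (toGaussHom B ν).comp (f.lTensor B).toAddMonoidHom

theorem gaussOfTensor_apply (ν : AddGroupSeminorm V) (f : N →ₗ[F] V) (w : B ⊗[F] N) :
    gaussOfTensor B ν f w = toGauss B ν (f.lTensor B w) := rfl

theorem lTensor_smul_left (f : N →ₗ[F] V) (b : B) (w : B ⊗[F] N) :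
    f.lTensor B (b • w) = b • f.lTensor B w := by
  induction w using TensorProduct.induction_on with
  | zero => simp
  | tmul a l => simp [TensorProduct.smul_tmul']
  | add x y hx hy => rw [smul_add, map_add, map_add, hx, hy, smul_add]

theorem gaussOfTensor_smul (ν : AddGroupSeminorm V) (f : N →ₗ[F] V) (b : B) (w : B ⊗[F] N) :
    gaussOfTensor B ν f (b • w) = b • gaussOfTensor B ν f w := by
  rw [gaussOfTensor_apply, gaussOfTensor_apply, smul_toGauss, lTensor_smul_left]

theorem gaussMap_gaussOfTensor {ν : AddGroupSeminorm V} {μ : AddGroupSeminorm W} {h : V →ₗ[F] W}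
    (hh : SeminormContinuous ν μ h) (f : N →ₗ[F] V) (w : B ⊗[F] N) :
    gaussMap B ν μ h (gaussOfTensor B ν f w) = gaussOfTensor B μ (h ∘ₗ f) w := by
  rw [gaussOfTensor_apply, gaussOfTensor_apply, gaussMap_toGauss hh, LinearMap.lTensor_comp]
  rfl

theorem gaussOfTensor_lTensor (ν : AddGroupSeminorm V) (f : N →ₗ[F] V) (g : N →ₗ[F] N)
    (w : B ⊗[F] N) : gaussOfTensor B ν f (g.lTensor B w) = gaussOfTensor B ν (f ∘ₗ g) w := by
  rw [gaussOfTensor_apply, gaussOfTensor_apply, LinearMap.lTensor_comp]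
  rfl

theorem gaussOfTensor_zero (ν : AddGroupSeminorm V) (w : B ⊗[F] N) :
    gaussOfTensor B ν (0 : N →ₗ[F] V) w = 0 := by
  rw [gaussOfTensor_apply, LinearMap.lTensor_zero, LinearMap.zero_apply, toGauss_zero]

end GaussTensorHom

variable {N : Type u} [AddCommGroup N] [Module F N] [Module F[X] N] [IsScalarTower F F[X] N]

/-- The action of `1 ⊗ a` on `A ⊗ N`. -/
def tensorRight (N : Type u) [AddCommGroup N] [Module F N] [Module F[X] N] [IsScalarTower F F[X] N]
    (a : F[X]) : F[X] ⊗[F] N →ₗ[F] F[X] ⊗[F] N :=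
  ((LinearMap.lsmul F[X] N a).restrictScalars F).lTensor F[X]

theorem tensorRight_tmul (a b : F[X]) (l : N) :
    tensorRight N a (b ⊗ₜ l) = b ⊗ₜ[F] (a • l) := rfl

/-- The multiplication map `A ⊗ N → N`. -/
def tensorMul (N : Type u) [AddCommGroup N] [Module F N] [Module F[X] N] [IsScalarTower F F[X] N] :
    F[X] ⊗[F] N →ₗ[F] N :=
  TensorProduct.lift (LinearMap.mk₂ F (fun (a : F[X]) (l : N) => a • l)
    (fun a b l => add_smul a b l) (fun c a l => smul_assoc c a l)
    (fun a l m => smul_add a l m) (fun c a l => smul_algebra_smul_comm c a l))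

theorem tensorMul_tmul (a : F[X]) (l : N) : tensorMul N (a ⊗ₜ l) = a • l := rfl

theorem tensorMul_smul (a : F[X]) (w : F[X] ⊗[F] N) :
    tensorMul N (a • w) = a • tensorMul N w := by
  induction w using TensorProduct.induction_on with
  | zero => simp
  | tmul b l => rw [TensorProduct.smul_tmul', tensorMul_tmul, tensorMul_tmul, smul_eq_mul, mul_smul]
  | add x y hx hy => rw [smul_add, map_add, map_add, hx, hy, smul_add]

theorem tensorMul_right (a : F[X]) (w : F[X] ⊗[F] N) :
    tensorMul N (tensorRight N a w) = a • tensorMul N w := by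
  induction w using TensorProduct.induction_on with
  | zero => simp
  | tmul b l => rw [tensorRight_tmul, tensorMul_tmul, tensorMul_tmul, smul_comm]
  | add x y hx hy => rw [map_add, map_add, map_add, hx, hy, smul_add]

theorem tensorRight_smul (a b : F[X]) (w : F[X] ⊗[F] N) :
    tensorRight N a (b • w) = b • tensorRight N a w := by
  induction w using TensorProduct.induction_on with
  | zero => simp
  | tmul b l => rfl
  | add x y hx hy => rw [smul_add, map_add, map_add, hx, hy, smul_add]

theorem tensorRight_mul (a b : F[X]) (w : F[X] ⊗[F] N) :
    tensorRight N (a * b) w = tensorRight N a (tensorRight N b w) := by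
  induction w using TensorProduct.induction_on with
  | zero => simp
  | tmul c l => simp only [tensorRight_tmul, mul_smul]
  | add x y hx hy => rw [map_add, map_add, map_add, hx, hy]

theorem tensorRight_add (a b : F[X]) (w : F[X] ⊗[F] N) :
    tensorRight N (a + b) w = tensorRight N a w + tensorRight N b w := by
  induction w using TensorProduct.induction_on with
  | zero => simp
  | tmul c l => simp only [tensorRight_tmul, add_smul, TensorProduct.tmul_add]
  | add x y hx hy => rw [map_add, map_add, map_add, hx, hy]; abel

theorem tensorRight_C (c : F) (w : F[X] ⊗[F] N) :
    tensorRight N (C c) w = (C c : F[X]) • w := by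
  induction w using TensorProduct.induction_on with
  | zero => simp
  | tmul b l =>
    rw [tensorRight_tmul, TensorProduct.smul_tmul', smul_eq_mul, ← smul_eq_C_mul,
      TensorProduct.smul_tmul]
    congr 1
    rw [← algebraMap_eq, algebraMap_smul]
  | add x y hx hy => rw [map_add, smul_add, hx, hy]

/-- Comparing coefficients gives t·w_{n+1} = w_n. As w_n = 0 for large n, descending induction kills
all coefficients, even if N has torsion. -/
theorem eq_zero_of_tensorRight_X {w : F[X] ⊗[F] N}
    (h : tensorRight N X w - (X : F[X]) • w = 0) : w = 0 := by
  obtain ⟨m, hm, hw⟩ := eq_sum_tensorCoeff w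
  have h1 : ∀ n, (X : F[X]) • tensorCoeff F N (n + 1) w = tensorCoeff F N n w := by
    intro n
    have h2 := congrArg (tensorCoeff F N (n + 1)) (sub_eq_zero.mp h)
    have h3 : ∀ w, tensorCoeff F N (n + 1) ((X : F[X]) • w) =
        tensorCoeff F N n w := fun w => by
      induction w using TensorProduct.induction_on with
      | zero => simp
      | tmul b l => simp [TensorProduct.smul_tmul']
      | add x y hx hy => rw [smul_add, map_add, map_add, hx, hy]
    have h4 : ∀ w, tensorCoeff F N (n + 1) (tensorRight N X w) =
        (X : F[X]) • tensorCoeff F N (n + 1) w := fun w => by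
      induction w using TensorProduct.induction_on with
      | zero => simp
      | tmul b l =>
        rw [tensorRight_tmul, tensorCoeff_tmul, tensorCoeff_tmul]
        exact (smul_algebra_smul_comm _ _ _).symm
      | add x y hx hy => rw [map_add, map_add, map_add, hx, hy, smul_add]
    rwa [h3, h4] at h2
  have h5 : ∀ k n, m ≤ n + k → tensorCoeff F N n w = 0 := by
    intro k
    induction k with
    | zero => exact fun n hn => hm n hn
    | succ k ih => exact fun n hn => by rw [← h1, ih (n + 1) (by omega), smul_zero]
  rw [hw]
  exact Finset.sum_eq_zero fun n _ => by rw [h5 m n (by omega), TensorProduct.tmul_zero]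

/-- The divided difference `(1 ⊗ u - u ⊗ 1) / (1 ⊗ t - t ⊗ 1)` acting on `A ⊗ N`. -/
theorem exists_dividedDifference {Y : Type*} [AddCommGroup Y] [Module F[X] Y] {D : F[X] → Y → Y}
    (hDC : ∀ c z, D (C c) z = (C c : F[X]) • z) (hDp : ∀ p q z, D (p + q) z = D p z + D q z)
    (hDm : ∀ p q z, D (p * q) z = D p (D q z)) (hDa : ∀ p y z, D p (y + z) = D p y + D p z)
    (hDs : ∀ (p q : F[X]) z, D p (q • z) = q • D p z) (ι : F[X] ⊗[F] N →+ Y)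
    (hιs : ∀ (a : F[X]) w, ι (a • w) = a • ι w) (hιr : ∀ a w, ι (tensorRight N a w) = D a (ι w))
    {z : F[X] ⊗[F] N → Y} (hz : ∀ w, D X (z w) = ι w + (X : F[X]) • z w) (u : F[X]) :
    ∃ g : F[X] ⊗[F] N → F[X] ⊗[F] N, ∀ w,
      tensorRight N X (g w) - (X : F[X]) • g w = tensorRight N u w - u • w ∧
      tensorMul N (g w) = derivative u • tensorMul N w ∧
      D u (z w) - u • z w = ι (g w) := by
  -- In the application Y is Lie_E(𝕋), D is a ↦ 1⊗∂a, ι is the inclusion of A⊗Λ, and z is (1⊗∂t −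
  -- t⊗1)⁻¹ after ι.
  induction u using Polynomial.induction_on with
  | C c =>
    refine ⟨fun _ => 0, fun w => ⟨?_, ?_, ?_⟩⟩
    · rw [tensorRight_C, map_zero, smul_zero, sub_self, sub_self]
    · rw [map_zero, derivative_C, zero_smul]
    · rw [hDC, sub_self, map_zero]
  | add p q hp hq =>
    obtain ⟨g, hg⟩ := hp
    obtain ⟨g', hg'⟩ := hq
    refine ⟨fun w => g w + g' w, fun w => ⟨?_, ?_, ?_⟩⟩
    · rw [map_add, smul_add, tensorRight_add, add_smul, add_sub_add_comm, (hg w).1, (hg' w).1,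
        add_sub_add_comm]
    · rw [map_add, (hg w).2.1, (hg' w).2.1, derivative_add, add_smul]
    · rw [map_add, ← (hg w).2.2, ← (hg' w).2.2, hDp, add_smul, add_sub_add_comm]
  | monomial n c h =>
    obtain ⟨g, hg⟩ := h
    have hpX : C c * X ^ (n + 1) = X * (C c * X ^ n : F[X]) := by rw [pow_succ]; ring
    rw [hpX]
    generalize (C c * X ^ n : F[X]) = p at hg
    -- From 1⊗tp − tp⊗1 = (1⊗t)(1⊗p − p⊗1) + (p⊗1)(1⊗t − t⊗1): the divided difference of tp is
    -- (1⊗t)g_p + p⊗1. Under multiplication this is the product rule.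
    refine ⟨fun w => tensorRight N X (g w) + p • w, fun w => ⟨?_, ?_, ?_⟩⟩
    · have h1 := congrArg (tensorRight N X) (hg w).1
      rw [map_sub, map_sub, tensorRight_smul, tensorRight_smul] at h1
      rw [map_add, smul_add, tensorRight_smul, tensorRight_mul X p w, mul_smul X p w,
        add_sub_add_comm, h1, smul_comm X p w]
      abel
    · rw [map_add, tensorMul_right, (hg w).2.1, tensorMul_smul, derivative_mul (f := X) (g := p),
        derivative_X, add_smul, one_mul, mul_smul, add_comm]
    · have h2 := (hg w).2.2
      rw [sub_eq_iff_eq_add] at h2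
      rw [map_add, hιr, hDm, h2, hDa, hDs, hz, smul_add, hιs, smul_smul, mul_comm p X]
      abel

/-- The elements 1 ⊗ l generate A ⊗ N over the left factor, so a left-linear map that is A-linear in
l there factors through multiplication. -/
theorem eq_comp_tensorMul {Y : Type*} [AddCommGroup Y] [Module F[X] Y] (Φ : F[X] ⊗[F] N →+ Y)
    (hΦ : ∀ (a : F[X]) w, Φ (a • w) = a • Φ w) {δ : N → Y} (hδ : ∀ l m, δ (l + m) = δ l + δ m)
    (hδs : ∀ (a : F[X]) l, δ (a • l) = a • δ l) (h : ∀ l, Φ (1 ⊗ₜ l) = δ l) (w : F[X] ⊗[F] N) :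
    Φ w = δ (tensorMul N w) := by
  induction w using TensorProduct.induction_on with
  | zero =>
    have h0 := hδs 0 0
    rw [zero_smul, zero_smul] at h0
    rw [map_zero, map_zero, h0]
  | tmul a l =>
    have h1 : (a ⊗ₜ l : F[X] ⊗[F] N) = a • (1 ⊗ₜ l) := by
      rw [TensorProduct.smul_tmul', smul_eq_mul, mul_one]
    rw [tensorMul_tmul, h1, hΦ, h, hδs]
  | add x y hx hy => rw [map_add, map_add, hx, hy, hδ]

end TensorModule

/-! ### Generating functions of periods. -/

section Periods

variable {F : Type u} [Field F] [Fintype F] {L : IntermediateField (RatFunc F) (CInf F)} {d : ℕ}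

namespace AndersonModule

variable (M : AndersonModule L d) (κ : M.E ≅ Ga F L d)

theorem coe_smul_periods (a : F[X]) (l : M.periods) : ((a • l : M.periods) : M.LieC) = M.del a l :=
  rfl

theorem act_C (c : F) : M.act (C c) = c • LinearMap.id := by
  have h : M.φ (C c) = c • 𝟙 M.E := M.φ.commutes c
  rw [act, h]
  rfl

theorem del_C (c : F) : M.del (C c) = c • LinearMap.id := by
  have h : M.φ (C c) = c • 𝟙 M.E := M.φ.commutes c
  change lieMap (M.φ (C c)) (CInf F) = _
  rw [h]
  rfl

theorem act_add (a b : F[X]) : M.act (a + b) = M.act a + M.act b := by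
  rw [act, map_add]
  rfl

theorem act_mul (a b : F[X]) : M.act (a * b) = M.act a ∘ₗ M.act b := by
  rw [act, map_mul]
  rfl

instance : IsScalarTower F F[X] M.periods := ⟨fun c a l => Subtype.ext (by
  rw [smul_eq_C_mul, coe_smul_periods, map_mul, del_C]
  rfl)⟩

theorem actT_add (a b : F[X]) (z : M.ET κ) :
    M.actT κ (a + b) z = M.actT κ a z + M.actT κ b z := by
  have h := M.seminormContinuous_act κ (a + b)
  rw [act_add] at h
  rw [actT, act_add]
  exact gaussMap_linear_add (M.seminormContinuous_act κ a) (M.seminormContinuous_act κ b) h z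

theorem actT_mul (a b : F[X]) (z : M.ET κ) :
    M.actT κ (a * b) z = M.actT κ a (M.actT κ b z) := by
  have h := M.seminormContinuous_act κ (a * b)
  rw [act_mul] at h
  rw [actT, act_mul]
  exact (gaussMap_comp (M.seminormContinuous_act κ b) (M.seminormContinuous_act κ a) h z).symm

theorem seminormContinuous_id {V : Type u} [AddCommGroup V] [Module F V] (ν : AddGroupSeminorm V) :
    SeminormContinuous ν ν (LinearMap.id : V →ₗ[F] V) := fun ε hε => ⟨ε, hε, fun _ h => h⟩

theorem actT_C (c : F) (z : M.ET κ) : M.actT κ (C c) z = C c • z := by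
  have h := M.seminormContinuous_act κ (C c)
  rw [act_C] at h
  rw [actT, act_C, gaussMap_linear_smul (seminormContinuous_id _) c h, gaussMap_id]
  rfl

theorem delT_add_poly (a b : F[X]) (z : M.LieT κ) :
    M.delT κ (a + b) z = M.delT κ a z + M.delT κ b z := by
  have h := M.seminormContinuous_del κ (a + b)
  rw [map_add] at h
  rw [delT, map_add]
  exact gaussMap_linear_add (M.seminormContinuous_del κ a) (M.seminormContinuous_del κ b) h z

theorem delT_mul (a b : F[X]) (z : M.LieT κ) :
    M.delT κ (a * b) z = M.delT κ a (M.delT κ b z) := by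
  have h := M.seminormContinuous_del κ (a * b)
  rw [map_mul] at h
  rw [delT, map_mul]
  exact (gaussMap_comp (M.seminormContinuous_del κ b) (M.seminormContinuous_del κ a) h z).symm

theorem delT_C (c : F) (z : M.LieT κ) : M.delT κ (C c) z = C c • z := by
  have h := M.seminormContinuous_del κ (C c)
  rw [del_C] at h
  rw [delT, del_C, gaussMap_linear_smul (seminormContinuous_id _) c h, gaussMap_id]
  rfl

theorem delT_add (a : F[X]) (y z : M.LieT κ) :
    M.delT κ a (y + z) = M.delT κ a y + M.delT κ a z :=
  gaussMap_add (M.seminormContinuous_del κ a) y z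

theorem delT_smul (a b : F[X]) (z : M.LieT κ) : M.delT κ a (b • z) = b • M.delT κ a z :=
  gaussMap_smul (M.seminormContinuous_del κ a) b z

theorem expT_add (y z : M.LieT κ) : M.expT κ (y + z) = M.expT κ y + M.expT κ z :=
  gaussMap_add (M.seminormContinuous_exp κ) y z

theorem expT_smul (a : F[X]) (z : M.LieT κ) : M.expT κ (a • z) = a • M.expT κ z :=
  gaussMap_smul (M.seminormContinuous_exp κ) a z

theorem actT_expT (a : F[X]) (z : M.LieT κ) :
    M.actT κ a (M.expT κ z) = M.expT κ (M.delT κ a z) := by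
  have h : M.act a ∘ₗ M.exp = M.exp ∘ₗ M.del a := LinearMap.ext fun x => (M.exp_del a x).symm
  have hc : SeminormContinuous (M.normLie κ) (M.normPoints κ) (M.act a ∘ₗ M.exp) := by
    intro ε hε
    obtain ⟨δ, hδ, h1⟩ := M.seminormContinuous_act κ a ε hε
    obtain ⟨δ', hδ', h2⟩ := M.seminormContinuous_exp κ δ hδ
    exact ⟨δ', hδ', fun v hv => h1 _ (h2 v hv)⟩
  have hc' := hc
  rw [h] at hc'
  rw [actT, expT, delT, gaussMap_comp (M.seminormContinuous_exp κ) (M.seminormContinuous_act κ a)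
    hc,
    gaussMap_comp (M.seminormContinuous_del κ a) (M.seminormContinuous_exp κ) hc', h]

/-- The inclusion `A ⊗ Λ_E → Lie_E(𝕋)`. -/
def periodsT : F[X] ⊗[F] M.periods →+ M.LieT κ :=
  gaussOfTensor F[X] (M.normLie κ) M.periods.subtype

theorem periodsT_tmul (a : F[X]) (l : M.periods) : M.periodsT κ (a ⊗ₜ l) = M.periodT κ a l := rfl

theorem periodsT_smul (a : F[X]) (w : F[X] ⊗[F] M.periods) :
    M.periodsT κ (a • w) = a • M.periodsT κ w :=
  gaussOfTensor_smul _ _ a w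

theorem periodsT_right (a : F[X]) (w : F[X] ⊗[F] M.periods) :
    M.periodsT κ (tensorRight M.periods a w) = M.delT κ a (M.periodsT κ w) :=
  (gaussOfTensor_lTensor (M.normLie κ) M.periods.subtype _ w).trans
    (gaussMap_gaussOfTensor (M.seminormContinuous_del κ a) M.periods.subtype w).symm

theorem expT_periodsT (w : F[X] ⊗[F] M.periods) : M.expT κ (M.periodsT κ w) = 0 := by
  have h : M.exp ∘ₗ M.periods.subtype = 0 := LinearMap.ext fun l => l.2
  refine (gaussMap_gaussOfTensor (M.seminormContinuous_exp κ) M.periods.subtype w).trans ?_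
  rw [h]
  exact gaussOfTensor_zero _ w

/-- The inverse of `1 ⊗ ∂u - u ⊗ 1`. -/
def twistInv (u : F[X]) (x : M.LieT κ) : M.LieT κ := Function.invFun (M.twist κ u) x

theorem twist_twistInv {u : F[X]} (hu : u.natDegree ≠ 0) (x : M.LieT κ) :
    M.twist κ u (M.twistInv κ u x) = x :=
  Function.rightInverse_invFun (M.twist_bijective_and_hasSum κ hu).1.surjective x

theorem twistInv_twist {u : F[X]} (hu : u.natDegree ≠ 0) (z : M.LieT κ) :
    M.twistInv κ u (M.twist κ u z) = z :=
  Function.leftInverse_invFun (M.twist_bijective_and_hasSum κ hu).1.injective z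

theorem twist_add (u : F[X]) (y z : M.LieT κ) :
    M.twist κ u (y + z) = M.twist κ u y + M.twist κ u z := by
  simp only [twist, delT_add, smul_add]
  abel

theorem twist_smul (u a : F[X]) (z : M.LieT κ) :
    M.twist κ u (a • z) = a • M.twist κ u z := by
  simp only [twist, delT_smul, smul_sub, smul_smul, mul_comm]

theorem twistInv_add {u : F[X]} (hu : u.natDegree ≠ 0) (x y : M.LieT κ) :
    M.twistInv κ u (x + y) = M.twistInv κ u x + M.twistInv κ u y := by
  apply (M.twist_bijective_and_hasSum κ hu).1.injective
  rw [twist_add, twist_twistInv M κ hu, twist_twistInv M κ hu, twist_twistInv M κ hu]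

theorem twistInv_smul {u : F[X]} (hu : u.natDegree ≠ 0) (a : F[X]) (x : M.LieT κ) :
    M.twistInv κ u (a • x) = a • M.twistInv κ u x := by
  apply (M.twist_bijective_and_hasSum κ hu).1.injective
  rw [twist_smul, twist_twistInv M κ hu, twist_twistInv M κ hu]

theorem twistInv_delT {u : F[X]} (hu : u.natDegree ≠ 0) (a : F[X]) (x : M.LieT κ) :
    M.twistInv κ u (M.delT κ a x) = M.delT κ a (M.twistInv κ u x) := by
  apply (M.twist_bijective_and_hasSum κ hu).1.injective
  rw [twist_twistInv M κ hu]
  conv_lhs => rw [← M.twist_twistInv κ hu x]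
  simp only [twist]
  rw [sub_eq_add_neg, delT_add, ← delT_mul, mul_comm, delT_mul, ← neg_smul, delT_smul, neg_smul,
    ← sub_eq_add_neg]

theorem natDegree_X_ne_zero : (X : F[X]).natDegree ≠ 0 := by simp

/-- The Anderson generating function of a period. -/
def genFun (l : M.periods) : M.ET κ := M.expTwistInv κ X (M.periodT κ 1 l)

theorem periodsT_one_smul (a : F[X]) (l : M.periods) :
    M.periodT κ 1 (a • l) = M.delT κ a (M.periodT κ 1 l) := by
  exact M.periodsT_right κ a (1 ⊗ₜ l)

theorem genFun_add (l m : M.periods) : M.genFun κ (l + m) = M.genFun κ l + M.genFun κ m := by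
  have h : M.periodT κ 1 (l + m) = M.periodT κ 1 l + M.periodT κ 1 m := by
    rw [← periodsT_tmul, TensorProduct.tmul_add, map_add]
    rfl
  have h2 := M.twistInv_add κ natDegree_X_ne_zero (M.periodT κ 1 l) (M.periodT κ 1 m)
  rw [genFun, h]
  exact (congrArg (M.expT κ) h2).trans (M.expT_add κ _ _)

/-- For z = (1⊗∂t − t⊗1)⁻¹(1⊗λ) one has (1⊗∂t)z = 1⊗λ + tz, and exp kills 1⊗λ. So 1⊗t and t⊗1 agree
on exp(z), and induction extends this to all of A. -/
theorem genFun_smul_and_actT (a : F[X]) : ∀ l : M.periods,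
    M.genFun κ (a • l) = a • M.genFun κ l ∧ M.actT κ a (M.genFun κ l) = a • M.genFun κ l := by
  have h1 : ∀ (a : F[X]) (l : M.periods), M.genFun κ (a • l) = M.actT κ a (M.genFun κ l) := by
    intro a l
    rw [genFun, periodsT_one_smul]
    exact (congrArg (M.expT κ) (M.twistInv_delT κ natDegree_X_ne_zero a _)).trans
      (M.actT_expT κ a _).symm
  have hX : ∀ l : M.periods, M.actT κ X (M.genFun κ l) = (X : F[X]) • M.genFun κ l := by
    intro l
    have h2 := M.twist_twistInv κ natDegree_X_ne_zero (M.periodT κ 1 l)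
    rw [twist, sub_eq_iff_eq_add] at h2
    refine (M.actT_expT κ X _).trans ?_
    change M.expT κ (M.delT κ X (M.twistInv κ X _)) = _
    rw [h2, expT_add, ← periodsT_tmul, expT_periodsT, zero_add, expT_smul]
    rfl
  have h2 : ∀ l, M.actT κ a (M.genFun κ l) = a • M.genFun κ l := by
    induction a using Polynomial.induction_on with
    | C c => exact fun l => M.actT_C κ c _
    | add p q hp hq => exact fun l => by rw [actT_add, hp, hq, add_smul]
    -- The function t·ω_l is again a generating function, that of tl, so the induction hypothesis
    -- for all periods applies to it.
    | monomial n c h =>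
      intro l
      rw [pow_succ, ← mul_assoc, actT_mul, hX, ← hX, ← h1, h, h1, hX, smul_smul]
  exact fun l => ⟨(h1 a l).trans (h2 l), h2 l⟩

theorem genFun_smul (a : F[X]) (l : M.periods) : M.genFun κ (a • l) = a • M.genFun κ l :=
  (M.genFun_smul_and_actT κ a l).1

theorem genFun_mem_sf (l : M.periods) : M.genFun κ l ∈ M.sf κ := fun a =>
  ((M.genFun_smul_and_actT κ a l).2).symm

theorem expTwistInv_add {u : F[X]} (hu : u.natDegree ≠ 0) (x y : M.LieT κ) :
    M.expTwistInv κ u (x + y) = M.expTwistInv κ u x + M.expTwistInv κ u y :=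
  (congrArg (M.expT κ) (M.twistInv_add κ hu x y)).trans (M.expT_add κ _ _)

theorem expTwistInv_smul {u : F[X]} (hu : u.natDegree ≠ 0) (a : F[X]) (x : M.LieT κ) :
    M.expTwistInv κ u (a • x) = a • M.expTwistInv κ u x :=
  (congrArg (M.expT κ) (M.twistInv_smul κ hu a x)).trans (M.expT_smul κ a _)

/-- The A-linearity of l ↦ ω_l makes the value on a tensor depend only on its product in Λ. -/
theorem expTwistInv_X_periodsT (w : F[X] ⊗[F] M.periods) :
    M.expTwistInv κ X (M.periodsT κ w) = M.genFun κ (tensorMul M.periods w) :=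
  eq_comp_tensorMul ((AddMonoidHom.mk' (M.expTwistInv κ X)
      (M.expTwistInv_add κ natDegree_X_ne_zero)).comp (M.periodsT κ))
    (fun a w => (congrArg (M.expTwistInv κ X) (M.periodsT_smul κ a w)).trans
      (M.expTwistInv_smul κ natDegree_X_ne_zero a _))
    (M.genFun_add κ) (M.genFun_smul κ) (fun _ => rfl) w

/-- By the last clause, inverting the twist by u on g(w) gives the same as inverting the twist by t
on w. This is where the dependence on u disappears. -/
theorem exists_periods_dividedDifference (u : F[X]) :
    ∃ g : F[X] ⊗[F] M.periods → F[X] ⊗[F] M.periods, ∀ w,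
      tensorRight M.periods X (g w) - (X : F[X]) • g w = tensorRight M.periods u w - u • w ∧
      tensorMul M.periods (g w) = derivative u • tensorMul M.periods w ∧
      M.twist κ u (M.twistInv κ X (M.periodsT κ w)) = M.periodsT κ (g w) := by
  have hz : ∀ w, M.delT κ X (M.twistInv κ X (M.periodsT κ w)) = M.periodsT κ w +
      (X : F[X]) • M.twistInv κ X (M.periodsT κ w) := fun w => by
    have := M.twist_twistInv κ natDegree_X_ne_zero (M.periodsT κ w)
    rwa [twist, sub_eq_iff_eq_add] at this
  exact exists_dividedDifference (M.delT_C κ) (M.delT_add_poly κ) (M.delT_mul κ) (M.delT_add κ)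
    (M.delT_smul κ) (M.periodsT κ) (M.periodsT_smul κ) (M.periodsT_right κ) hz u

/-- Λ is torsion-free because ∂a is invertible on the ambient tangent space. -/
theorem smul_periods_eq_zero {a : F[X]} (ha : a ≠ 0) {l : M.periods} (h : a • l = 0) : l = 0 := by
  have h1 : M.del a l = 0 := congrArg Subtype.val h
  apply Subtype.ext
  have h2 := LinearMap.congr_fun (M.delInv_mul_del ha) (l : M.LieC)
  rw [Module.End.mul_apply, h1, map_zero] at h2
  exact h2.symm

end AndersonModule

end Periods

/-! ### Separating elements and the relative different. -/

section Different

variable {F : Type u} [Field F]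

/-- Up to a unit, the minimal polynomial of t over 𝔽(u) is u(T) − u, and separability means that its
derivative u'(T) is nonzero. -/
theorem IsSeparating.derivative_ne_zero {u : F[X]} (hu : IsSeparating u) : derivative u ≠ 0 := by
  obtain ⟨hfin, hsep⟩ := hu
  set f : RatFunc F := algebraMap F[X] (RatFunc F) u with hf
  -- For constant u the degree formula would give degree 0, against finiteness.
  have hC : ¬∃ c, f = RatFunc.C c := by
    rintro ⟨c, hc⟩
    have h1 := RatFunc.finrank_eq_max_natDegree f
    rw [hc, RatFunc.num_C, RatFunc.denom_C, natDegree_C, natDegree_one, max_self, ← hc] at h1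
    exact (Module.finrank_pos (R := IntermediateField.adjoin F {f}) (M := RatFunc F)).ne' h1
  have hirr := RatFunc.irreducible_minpolyX f hC
  have h1 := (hsep.isSeparable' (RatFunc.X : RatFunc F))
  have h2 := minpoly.eq_of_irreducible hirr (RatFunc.minpolyX_aeval_X f)
  rw [IsSeparable, ← h2] at h1
  have h3 := (separable_iff_derivative_ne_zero hirr).mp h1.of_mul_left
  intro h0
  apply h3
  rw [RatFunc.minpolyX, derivative_sub, derivative_map, hf, RatFunc.num_algebraMap,
    RatFunc.denom_algebraMap, h0]
  simp

theorem isSeparating_X : IsSeparating (X : F[X]) := by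
  have h : IntermediateField.adjoin F {algebraMap F[X] (RatFunc F) X} = ⊤ := by
    rw [RatFunc.algebraMap_X]
    exact RatFunc.adjoin_X
  have hs : Function.Surjective
      (algebraMap (⊤ : IntermediateField F (RatFunc F)) (RatFunc F)) :=
    fun x => ⟨⟨x, trivial⟩, rfl⟩
  rw [IsSeparating, h]
  refine ⟨Module.Finite.of_surjective (Algebra.linearMap _ _) hs, ⟨fun x => ?_⟩⟩
  obtain ⟨y, rfl⟩ := hs x
  exact isSeparable_algebraMap y

variable {u : F[X]}

theorem natDegree_ne_zero_of_derivative_ne_zero (hu : derivative u ≠ 0) : u.natDegree ≠ 0 :=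
  fun h => hu (derivative_of_natDegree_zero h)

/-- The generator of `𝔽[u]`. -/
def polySubring.gen (u : F[X]) : polySubring u := ⟨u, Algebra.self_mem_adjoin_singleton F u⟩

/-- `𝔽[u]` is a polynomial ring. -/
def polySubring.equiv (hu : u.natDegree ≠ 0) : F[X] ≃ₐ[F] polySubring u :=
  Polynomial.algEquivOfTranscendental F u <| by
    have h := (transcendental_X F).aeval u hu
      (mem_nonZeroDivisors_of_ne_zero (leadingCoeff_ne_zero.mpr fun h0 =>
        hu ((congrArg natDegree h0).trans natDegree_zero)))
    rwa [aeval_X_left_apply] at h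

/-- The minimal polynomial `(u(T) - u) / lc(u)` of `t` over `𝔽[u]`. -/
def polySubring.minpolyT (u : F[X]) : (polySubring u)[X] :=
  C (algebraMap F (polySubring u) u.leadingCoeff⁻¹) *
    (u.map (algebraMap F (polySubring u)) - C (polySubring.gen u))

theorem polySubring.monic_minpolyT (hu : u.natDegree ≠ 0) : (polySubring.minpolyT u).Monic := by
  have h0 : u.leadingCoeff ≠ 0 := fun h => hu (by rw [leadingCoeff_eq_zero.mp h, natDegree_zero])
  have h1 : (u.map (algebraMap F (polySubring u)) - C (polySubring.gen u)).leadingCoeff =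
      algebraMap F (polySubring u) u.leadingCoeff := by
    rw [leadingCoeff_sub_of_degree_lt, leadingCoeff_map]
    refine degree_C_le.trans_lt ?_
    rw [degree_map]
    exact natDegree_pos_iff_degree_pos.mp (Nat.pos_of_ne_zero hu)
  rw [Monic, polySubring.minpolyT, leadingCoeff_mul, leadingCoeff_C, h1, ← map_mul,
    inv_mul_cancel₀ h0, map_one]

theorem polySubring.aeval_minpolyT : aeval (X : F[X]) (polySubring.minpolyT u) = 0 := by
  rw [polySubring.minpolyT, map_mul, aeval_sub, aeval_map_algebraMap, aeval_C, aeval_C,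
    aeval_X_left_apply]
  have h : algebraMap (polySubring u) F[X] (polySubring.gen u) = u := rfl
  rw [h, sub_self, mul_zero]

/-- As a polynomial in u over 𝔽[T], u(T) − u is linear with unit leading coefficient. Exchanging the
two variables turns this into irreducibility over 𝔽[u]. -/
theorem polySubring.irreducible_minpolyT (hu : u.natDegree ≠ 0) :
    Irreducible (polySubring.minpolyT u) := by
  have h0 : u.leadingCoeff ≠ 0 := fun h => hu (by rw [leadingCoeff_eq_zero.mp h, natDegree_zero])
  have hunit : IsUnit (C (algebraMap F (polySubring u) u.leadingCoeff⁻¹)) :=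
    ((IsUnit.mk0 _ (inv_ne_zero h0)).map _).map _
  rw [polySubring.minpolyT, irreducible_isUnit_mul hunit]
  let e := polySubring.equiv hu
  have h1 : (u.map C - C X : F[X][X]).mapEquiv e.toRingEquiv =
      u.map (algebraMap F (polySubring u)) - C (polySubring.gen u) := by
    rw [mapEquiv_apply, Polynomial.map_sub, Polynomial.map_map, map_C]
    congr 2
    · exact RingHom.ext fun c => e.commutes c
    · exact aeval_X (polySubring.gen u)
  rw [← h1, MulEquiv.irreducible_iff]
  have h2 : (u.map C - C X : F[X][X]) = Bivariate.swap (C u - X) := by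
    rw [map_sub, Bivariate.swap_C, Bivariate.swap_Y]
  rw [h2, MulEquiv.irreducible_iff]
  have h3 : (C u - X : F[X][X]) = C (-1) * X + C u := by
    rw [C_neg, C_1]
    ring
  rw [h3]
  exact irreducible_C_mul_X_add_C (by simp) (IsUnit.isRelPrime_left (by simp))

theorem polySubring.adjoin_X (u : F[X]) : Algebra.adjoin (polySubring u) {(X : F[X])} = ⊤ := by
  refine eq_top_iff.mpr fun p _ => ?_
  have h := aeval_map_algebraMap (polySubring u) (X : F[X]) p
  rw [aeval_X_left_apply] at h
  rw [← h]
  exact aeval_mem_adjoin_singleton _ _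

theorem polySubring.isIntegral_X (hu : u.natDegree ≠ 0) : IsIntegral (polySubring u) (X : F[X]) :=
  ⟨_, polySubring.monic_minpolyT hu, polySubring.aeval_minpolyT⟩

theorem polySubring.isIntegrallyClosed (hu : u.natDegree ≠ 0) :
    IsIntegrallyClosed (polySubring u) :=
  IsIntegrallyClosed.of_equiv (polySubring.equiv hu).toRingEquiv

theorem polySubring.minpoly_X (hu : u.natDegree ≠ 0) :
    minpoly (polySubring u) (X : F[X]) = polySubring.minpolyT u := by
  have := polySubring.isIntegrallyClosed hu
  have hint := polySubring.isIntegral_X hu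
  have h1 := minpoly.isIntegrallyClosed_dvd hint (polySubring.aeval_minpolyT (u := u))
  have h2 : Associated (minpoly (polySubring u) (X : F[X])) (polySubring.minpolyT u) :=
    (minpoly.irreducible hint).associated_of_dvd (polySubring.irreducible_minpolyT hu) h1
  exact eq_of_monic_of_associated (minpoly.monic hint) (polySubring.monic_minpolyT hu) h2

theorem polySubring.aeval_derivative_minpolyT (u : F[X]) :
    aeval (X : F[X]) (derivative (polySubring.minpolyT u)) =
      C u.leadingCoeff⁻¹ * derivative u := by
  rw [polySubring.minpolyT, derivative_C_mul, derivative_sub, derivative_C, sub_zero, map_mul,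
    derivative_map, aeval_map_algebraMap, aeval_C, aeval_X_left_apply]
  rfl

/-- A = 𝔽[u][t] is generated by one element, so its conductor is trivial and the different is
generated by the derivative of the minimal polynomial at t, namely lc(u)⁻¹u'. -/
theorem differentIdeal_polySubring (hu : derivative u ≠ 0) :
    differentIdeal (polySubring u) F[X] = Ideal.span {derivative u} := by
  have hdeg := natDegree_ne_zero_of_derivative_ne_zero hu
  have h0' : u.leadingCoeff ≠ 0 := fun h => hdeg (by rw [leadingCoeff_eq_zero.mp h, natDegree_zero])
  have := polySubring.isIntegrallyClosed hdeg
  have hint := polySubring.isIntegral_X hdeg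
  have hfin : Module.Finite (polySubring u) F[X] := by
    have h := Algebra.finite_adjoin_simple_of_isIntegral hint
    rw [polySubring.adjoin_X] at h
    exact Module.Finite.equiv (Subalgebra.topEquiv (R := polySubring u) (A := F[X])).toLinearEquiv
  let K := FractionRing (polySubring u)
  let L := FractionRing F[X]
  let _ : Algebra K L := FractionRing.liftAlgebra (polySubring u) L
  have hmin := minpoly.isIntegrallyClosed_eq_field_fractions K L hint
  have hintK : IsIntegral K (algebraMap F[X] L X) :=
    (hint.map (IsScalarTower.toAlgHom (polySubring u) F[X] L)).tower_top
  have hpoly : ∀ p : F[X], algebraMap F[X] L p ∈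
      IntermediateField.adjoin K {algebraMap F[X] L X} := by
    intro p
    have h := aeval_map_algebraMap (polySubring u) (X : F[X]) p
    rw [aeval_X_left_apply] at h
    rw [← h, ← aeval_algebraMap_apply, ← aeval_map_algebraMap K]
    exact IntermediateField.algebra_adjoin_le_adjoin _ _ (aeval_mem_adjoin_singleton _ _)
  have htop : IntermediateField.adjoin K {algebraMap F[X] L X} = ⊤ := by
    refine eq_top_iff.mpr fun z _ => ?_
    obtain ⟨p, q, -, rfl⟩ := IsFractionRing.div_surjective (A := F[X]) z
    exact div_mem (hpoly p) (hpoly q)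
  have hgen : Algebra.adjoin K {algebraMap F[X] L X} = ⊤ := by
    rw [← IntermediateField.adjoin_simple_toSubalgebra_of_isAlgebraic hintK.isAlgebraic, htop,
      IntermediateField.top_toSubalgebra]
  -- The derivative of the minimal polynomial takes the nonzero value lc(u)⁻¹u' at t.
  have hX : IsSeparable K (algebraMap F[X] L X) := by
    rw [IsSeparable, separable_iff_derivative_ne_zero (minpoly.irreducible hintK)]
    intro h0
    have h1 := congrArg (aeval (algebraMap F[X] L X)) h0
    rw [hmin, derivative_map, aeval_map_algebraMap, aeval_algebraMap_apply,
      polySubring.minpoly_X hdeg, polySubring.aeval_derivative_minpolyT, map_zero] at h1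
    exact mul_ne_zero (C_ne_zero.mpr (inv_ne_zero h0')) hu
      (IsFractionRing.injective F[X] L (h1.trans (map_zero _).symm))
  have hsep : Algebra.IsSeparable K L := by
    have := (IntermediateField.isSeparable_adjoin_simple_iff_isSeparable K L).mpr hX
    refine ⟨fun z => ?_⟩
    have hz : z ∈ IntermediateField.adjoin K {algebraMap F[X] L X} := htop ▸ trivial
    exact IntermediateField.isSeparable_of_mem_isSeparable K L hz
  have key := conductor_mul_differentIdeal (polySubring u) K L (X : F[X]) hgen
  rw [conductor_eq_top_of_adjoin_eq_top (polySubring.adjoin_X u), Ideal.top_mul] at key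
  rw [key, polySubring.minpoly_X hdeg, polySubring.aeval_derivative_minpolyT,
    Ideal.span_singleton_mul_left_unit]
  exact (IsUnit.mk0 _ (inv_ne_zero h0')).map C

end Different

/-! ### Invariants of A ⊗_{𝔽[u]} N. -/

section RelativeTensor

variable {F : Type u} [Field F] {N : Type u} [AddCommGroup N] [Module F N] [Module F[X] N]
  [IsScalarTower F F[X] N] {u : F[X]}

/-- The action of `1 ⊗ b` on `A ⊗_{𝔽[u]} N`. -/
def relRight (u : F[X]) (N : Type u) [AddCommGroup N] [Module F[X] N] (b : F[X]) :
    F[X] ⊗[polySubring u] N →ₗ[polySubring u] F[X] ⊗[polySubring u] N :=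
  ((LinearMap.lsmul F[X] N b).restrictScalars (polySubring u)).lTensor F[X]

/-- The multiplication map `A ⊗_{𝔽[u]} N → N`. -/
def relMul (u : F[X]) (N : Type u) [AddCommGroup N] [Module F[X] N] :
    F[X] ⊗[polySubring u] N →ₗ[polySubring u] N :=
  TensorProduct.lift <| LinearMap.mk₂ (polySubring u) (fun (a : F[X]) (l : N) => a • l)
    (fun a b l => add_smul a b l) (fun c a l => smul_assoc c a l)
    (fun a l m => smul_add a l m) (fun c a l => smul_comm a c l)

/-- The canonical map `A ⊗ N → A ⊗_{𝔽[u]} N`. -/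
def toRel (u : F[X]) (N : Type u) [AddCommGroup N] [Module F N] [Module F[X] N]
    [IsScalarTower F F[X] N] : F[X] ⊗[F] N →+ F[X] ⊗[polySubring u] N :=
  TensorProduct.liftAddHom
    (AddMonoidHom.mk' (fun a => AddMonoidHom.mk' (fun l : N => a ⊗ₜ[polySubring u] l)
      fun l m => TensorProduct.tmul_add a l m)
      fun a b => AddMonoidHom.ext fun l => TensorProduct.add_tmul a b l)
    (fun c a l => by
      have h := TensorProduct.smul_tmul (R := polySubring u) (algebraMap F (polySubring u) c) a l
      rw [algebraMap_smul, algebraMap_smul] at h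
      exact h)

theorem toRel_surjective (x : F[X] ⊗[polySubring u] N) : ∃ w, toRel u N w = x := by
  induction x using TensorProduct.induction_on with
  | zero => exact ⟨0, map_zero _⟩
  | tmul b l => exact ⟨b ⊗ₜ l, rfl⟩
  | add x y hx hy =>
    obtain ⟨w, rfl⟩ := hx
    obtain ⟨z, rfl⟩ := hy
    exact ⟨w + z, map_add _ _ _⟩

theorem toRel_smul (a : F[X]) (w : F[X] ⊗[F] N) : toRel u N (a • w) = a • toRel u N w := by
  induction w using TensorProduct.induction_on with
  | zero => rw [smul_zero, map_zero, smul_zero]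
  | tmul b l => rfl
  | add x y hx hy => rw [smul_add, map_add, map_add, smul_add, hx, hy]

theorem toRel_right (a : F[X]) (w : F[X] ⊗[F] N) :
    toRel u N (tensorRight N a w) = relRight u N a (toRel u N w) := by
  induction w using TensorProduct.induction_on with
  | zero => rw [map_zero, map_zero, map_zero]
  | tmul b l => rfl
  | add x y hx hy => rw [map_add, map_add, map_add, map_add, hx, hy]

theorem relMul_toRel (w : F[X] ⊗[F] N) : relMul u N (toRel u N w) = tensorMul N w := by
  induction w using TensorProduct.induction_on with
  | zero => rw [map_zero, map_zero, map_zero]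
  | tmul b l => rfl
  | add x y hx hy => rw [map_add, map_add, map_add, hx, hy]

theorem toRel_right_gen (w : F[X] ⊗[F] N) : toRel u N (tensorRight N u w) = toRel u N (u • w) := by
  induction w using TensorProduct.induction_on with
  | zero => rw [map_zero, smul_zero]
  | tmul b l => exact (TensorProduct.smul_tmul (polySubring.gen u) b l).symm
  | add x y hx hy => rw [map_add, map_add, smul_add, map_add, hx, hy]

/-- The relations of 𝔽[u]-balancedness all follow from the one for u, so A ⊗_{𝔽[u]} N is the
cokernel of 1⊗u − u⊗1. The proof maps the relative tensor product back to this cokernel. -/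
theorem exists_of_toRel_eq_zero {w : F[X] ⊗[F] N} (h : toRel u N w = 0) :
    ∃ z : F[X] ⊗[F] N, w = tensorRight N u z - u • z := by
  let D : F[X] ⊗[F] N →+ F[X] ⊗[F] N :=
    AddMonoidHom.mk' (fun z => tensorRight N u z - u • z) fun x y => by
      rw [map_add, smul_add, add_sub_add_comm]
  have hbal : ∀ c ∈ polySubring u, ∀ (a : F[X]) (l : N),
      ((c * a) ⊗ₜ[F] l - a ⊗ₜ[F] (c • l) : F[X] ⊗[F] N) ∈ D.range := by
    intro c hc
    induction hc using Algebra.adjoin_induction with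
    | mem c hc =>
      rw [Set.mem_singleton_iff] at hc
      subst hc
      exact fun a l => ⟨-(a ⊗ₜ l), by
        rw [map_neg, ← neg_sub]
        rfl⟩
    | algebraMap c =>
      intro a l
      rw [algebraMap_smul, ← Algebra.smul_def, TensorProduct.smul_tmul, sub_self]
      exact zero_mem _
    | add x y _ _ hx hy =>
      intro a l
      rw [add_mul, add_smul, TensorProduct.add_tmul, TensorProduct.tmul_add, add_sub_add_comm]
      exact add_mem (hx a l) (hy a l)
    | mul x y _ _ hx hy =>
      intro a l
      have h := add_mem (hx (y * a) l) (hy a (x • l))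
      rwa [sub_add_sub_cancel, ← mul_assoc, smul_smul, mul_comm y x] at h
  let ψ : F[X] ⊗[polySubring u] N →+ (F[X] ⊗[F] N) ⧸ D.range :=
    TensorProduct.liftAddHom
      (AddMonoidHom.mk' (fun a => AddMonoidHom.mk'
        (fun l : N => QuotientAddGroup.mk' D.range (a ⊗ₜ[F] l))
        fun l m => by rw [TensorProduct.tmul_add, map_add])
        fun a b => AddMonoidHom.ext fun l => by
          change QuotientAddGroup.mk' D.range ((a + b) ⊗ₜ[F] l) = _
          rw [TensorProduct.add_tmul, map_add]
          rfl)
      (fun c a l => by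
        refine (QuotientAddGroup.eq_iff_sub_mem).mpr ?_
        exact hbal c c.2 a l)
  have hψ : ∀ w, ψ (toRel u N w) = QuotientAddGroup.mk' D.range w := by
    intro w
    induction w using TensorProduct.induction_on with
    | zero => rw [map_zero, map_zero, map_zero]
    | tmul b l => rfl
    | add x y hx hy => rw [map_add, map_add, map_add, hx, hy]
  have h1 := hψ w
  rw [h, map_zero] at h1
  obtain ⟨z, hz⟩ := (QuotientAddGroup.eq_zero_iff w).mp h1.symm
  exact ⟨z, hz.symm⟩

/-- The two actions commute and t generates A over 𝔽, so agreement at t is enough. -/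
theorem smul_eq_relRight {x : F[X] ⊗[polySubring u] N} (h : (X : F[X]) • x = relRight u N X x)
    (b : F[X]) : b • x = relRight u N b x := by
  obtain ⟨w, rfl⟩ := toRel_surjective x
  have hmul : ∀ p q : F[X], p • toRel u N w = relRight u N p (toRel u N w) →
      q • toRel u N w = relRight u N q (toRel u N w) →
      (p * q) • toRel u N w = relRight u N (p * q) (toRel u N w) := by
    intro p q hp hq
    rw [← toRel_right, tensorRight_mul, toRel_right, toRel_right, ← hq,
      ← toRel_smul q w, ← toRel_right p, tensorRight_smul, toRel_smul q, toRel_right, ← hp,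
      smul_smul, mul_comm]
  have hC : ∀ c : F, (C c : F[X]) • toRel u N w = relRight u N (C c) (toRel u N w) := fun c => by
    rw [← toRel_right, tensorRight_C, toRel_smul]
  induction b using Polynomial.induction_on with
  | C c => exact hC c
  | add p q hp hq =>
    rw [← toRel_right] at hp hq
    rw [← toRel_right, tensorRight_add, add_smul, map_add, hp, hq]
  | monomial n c hn =>
    rw [pow_succ, ← mul_assoc]
    exact hmul _ _ hn h

/-- A lift w of an invariant class satisfies (1⊗t − t⊗1)w = (1⊗u − u⊗1)z = (1⊗t − t⊗1)g(z), and 1⊗t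
− t⊗1 can be cancelled. -/
theorem exists_dividedDifference_eq {w : F[X] ⊗[F] N}
    (h : (X : F[X]) • toRel u N w = relRight u N X (toRel u N w))
    {g : F[X] ⊗[F] N → F[X] ⊗[F] N}
    (hg : ∀ z, tensorRight N X (g z) - (X : F[X]) • g z = tensorRight N u z - u • z) :
    ∃ z, w = g z := by
  have h1 : toRel u N (tensorRight N X w - (X : F[X]) • w) = 0 := by
    rw [map_sub, toRel_smul, toRel_right, h, sub_self]
  obtain ⟨z, hz⟩ := exists_of_toRel_eq_zero h1
  refine ⟨z, sub_eq_zero.mp (eq_zero_of_tensorRight_X ?_)⟩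
  rw [map_sub, smul_sub, sub_sub_sub_comm, hz, hg, sub_self]

theorem smul_toRel_eq_relRight {w z : F[X] ⊗[F] N}
    (h : tensorRight N X w - (X : F[X]) • w = tensorRight N u z - u • z) (b : F[X]) :
    b • toRel u N w = relRight u N b (toRel u N w) := by
  refine smul_eq_relRight (sub_eq_zero.mp ?_).symm b
  rw [← toRel_right, ← toRel_smul, ← map_sub, h, map_sub, toRel_right_gen, sub_self]

/-- The lifts of invariant classes are exactly the tensors g(z). On these both the product and the
value Ψ depend only on the product of z, which is the parameter l. -/
theorem exists_tensor_iff_exists_derivative_smul {Y : Type*} {g : F[X] ⊗[F] N → F[X] ⊗[F] N}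
    (hg : ∀ w, tensorRight N X (g w) - (X : F[X]) • g w = tensorRight N u w - u • w)
    (hgm : ∀ w, tensorMul N (g w) = derivative u • tensorMul N w) {Ψ : F[X] ⊗[F] N → Y} {G : N → Y}
    (hΨ : ∀ w, Ψ (g w) = G (tensorMul N w)) (y : N) (ω : Y) :
    (∃ w, (∀ b : F[X], b • toRel u N w = relRight u N b (toRel u N w)) ∧ tensorMul N w = y ∧
      ω = Ψ w) ↔ ∃ l, y = derivative u • l ∧ ω = G l := by
  constructor
  · rintro ⟨w, hx, rfl, rfl⟩
    obtain ⟨z, rfl⟩ := exists_dividedDifference_eq (hx X) hg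
    exact ⟨tensorMul N z, hgm z, hΨ z⟩
  · rintro ⟨l, rfl, rfl⟩
    have h1 : tensorMul N ((1 : F[X]) ⊗ₜ[F] l) = l := one_smul F[X] l
    refine ⟨g ((1 : F[X]) ⊗ₜ[F] l), smul_toRel_eq_relRight (hg _), ?_, ?_⟩
    · rw [hgm, h1]
    · rw [hΨ, h1]

theorem exists_eq_sum_tmul (w : F[X] ⊗[F] N) :
    ∃ (n : ℕ) (a : Fin n → F[X]) (l : Fin n → N), w = ∑ i, a i ⊗ₜ[F] l i := by
  -- The seminorm plays no role; only the existence of a representation is used.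
  obtain ⟨-, n, a, l, h, -⟩ := gaussValues_nonempty F[X] (0 : AddGroupSeminorm N) w
  exact ⟨n, a, l, h⟩

end RelativeTensor

/-! ### The graph of δ_u. -/

section Delta

variable {F : Type u} [Field F] [Fintype F] {L : IntermediateField (RatFunc F) (CInf F)} {d : ℕ}

namespace AndersonModule

variable (M : AndersonModule L d) (κ : M.E ≅ Ga F L d) {u : F[X]}

/-- Trades the explicit finite sums for lifts to A ⊗ Λ, where additivity is available. -/
theorem isDeltaTilde_iff (x : F[X] ⊗[polySubring u] M.periods) (ω : M.ET κ) :
    M.IsDeltaTilde κ u x ω ↔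
      ∃ w, toRel u M.periods w = x ∧ ω = M.expTwistInv κ u (M.periodsT κ w) := by
  constructor
  · rintro ⟨n, a, l, hx, hω⟩
    refine ⟨∑ i, a i ⊗ₜ[F] l i, ?_, ?_⟩
    · rw [map_sum, hx]
      rfl
    · rw [map_sum, hω]
      rfl
  · rintro ⟨w, hx, hω⟩
    obtain ⟨n, a, l, hw⟩ := exists_eq_sum_tmul w
    refine ⟨n, a, l, ?_, ?_⟩
    · rw [← hx, hw, map_sum]
      rfl
    · rw [hω, hw, map_sum]
      rfl

theorem mulMap_toRel (w : F[X] ⊗[F] M.periods) :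
    M.mulMap u (toRel u M.periods w) = tensorMul M.periods w := relMul_toRel w

/-- `IsDelta` in terms of elements of `A ⊗ Λ_E`. -/
theorem isDelta_iff_exists_tensor (y : M.periods) (ω : M.ET κ) :
    M.IsDelta κ u y ω ↔ ∃ w : F[X] ⊗[F] M.periods,
      (∀ b : F[X], b • toRel u M.periods w = relRight u M.periods b (toRel u M.periods w)) ∧
      tensorMul M.periods w = y ∧ ω = M.expTwistInv κ u (M.periodsT κ w) := by
  constructor
  · rintro ⟨x, hx, hy, hxω⟩
    obtain ⟨w, rfl, hwω⟩ := (M.isDeltaTilde_iff κ x ω).mp hxω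
    exact ⟨w, hx, (M.mulMap_toRel w).symm.trans hy, hwω⟩
  · rintro ⟨w, hx, hy, hω⟩
    exact ⟨toRel u M.periods w, hx, (M.mulMap_toRel w).trans hy,
      (M.isDeltaTilde_iff κ (toRel u M.periods w) ω).mpr ⟨w, rfl, hω⟩⟩

/-- All invariant x and all their representatives are treated at once, so the well-definedness of
δ_u needs no separate argument. -/
theorem isDelta_iff (hu : derivative u ≠ 0) (y : M.periods) (ω : M.ET κ) :
    M.IsDelta κ u y ω ↔ ∃ l, y = derivative u • l ∧ ω = M.genFun κ l := by
  have hdeg := natDegree_ne_zero_of_derivative_ne_zero hu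
  obtain ⟨g, hg⟩ := M.exists_periods_dividedDifference κ u
  have hω : ∀ w, M.expTwistInv κ u (M.periodsT κ (g w)) =
      M.genFun κ (tensorMul M.periods w) := by
    intro w
    rw [← expTwistInv_X_periodsT, ← (hg w).2.2]
    exact congrArg (M.expT κ) (M.twistInv_twist κ hdeg _)
  exact (M.isDelta_iff_exists_tensor κ y ω).trans
    (exists_tensor_iff_exists_derivative_smul (fun w => (hg w).1) (fun w => (hg w).2.1) hω y ω)

theorem isDelta_derivative_smul (hu : derivative u ≠ 0) (l : M.periods) (ω : M.ET κ) :
    M.IsDelta κ u (derivative u • l) ω ↔ ω = M.genFun κ l := by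
  rw [isDelta_iff M κ hu]
  refine ⟨?_, fun h => ⟨l, rfl, h⟩⟩
  rintro ⟨m, hm, h⟩
  have h0 : derivative u • (l - m) = 0 := by rw [smul_sub, hm, sub_self]
  rw [h, sub_eq_zero.mp (M.smul_periods_eq_zero hu h0)]

theorem delta_derivative_smul (hu : derivative u ≠ 0) (l : M.periods) :
    M.delta κ u (derivative u • l) = M.genFun κ l :=
  (M.isDelta_derivative_smul κ hu l _).mp
    (Classical.epsilon_spec ⟨_, (M.isDelta_derivative_smul κ hu l _).mpr rfl⟩)

theorem mem_differentPeriods (hu : derivative u ≠ 0) (y : M.periods) :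
    y ∈ M.differentPeriods u ↔ ∃ l, y = derivative u • l := by
  rw [differentPeriods, differentIdeal_polySubring hu, Submodule.ideal_span_singleton_smul,
    Submodule.mem_smul_pointwise_iff_exists]
  exact ⟨fun ⟨l, _, h⟩ => ⟨l, h.symm⟩, fun ⟨l, h⟩ => ⟨l, trivial, h.symm⟩⟩

theorem derivative_X_ne_zero : derivative (X : F[X]) ≠ 0 := by
  rw [derivative_X]
  exact one_ne_zero

theorem delta_X (l : M.periods) : M.delta κ X l = M.genFun κ l := by
  have h := M.delta_derivative_smul κ derivative_X_ne_zero l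
  rwa [derivative_X, one_smul] at h

theorem differentPeriods_X : M.differentPeriods X = ⊤ := by
  refine eq_top_iff.mpr fun l _ => (M.mem_differentPeriods derivative_X_ne_zero l).mpr ⟨l, ?_⟩
  rw [derivative_X, one_smul]

end AndersonModule

end Delta

/-! ### Every special function comes from a unique period. -/

section Uniformization

variable {F : Type u} [Field F] [Fintype F] {L : IntermediateField (RatFunc F) (CInf F)} {d : ℕ}

namespace AndersonModule

variable (M : AndersonModule L d) (κ : M.E ≅ Ga F L d)

/-- The series of exp starts with x, so near 0 it differs from the identity by a contraction. -/
theorem exists_exp_local :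
    ∃ ρ : ℝ, 0 < ρ ∧ (∀ x, M.normLie κ x ≤ ρ → M.exp x = 0 → x = 0) ∧
      ∀ y, M.normPoints κ y ≤ ρ → ∃ x, M.normLie κ x ≤ M.normPoints κ y ∧ M.exp x = y := by
  obtain ⟨g, hg0, hg⟩ := M.exists_isTwSeries_expCoord κ
  obtain ⟨ρ, hρ0, hρ⟩ := hg.exists_norm_sub_le hg0
  refine ⟨ρ, hρ0, fun x hx h0 => ?_, fun y hy => ?_⟩
  · have h1 := hρ (lieCoord κ x) hx
    rw [← coord_exp, h0, coord_zero, sub_zero] at h1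
    have h2 : lieCoord κ x = 0 := by
      rw [← norm_le_zero_iff]
      linarith
    exact lieCoord_injective κ (h2.trans (lieCoord_zero κ).symm)
  · obtain ⟨v, hv, hvy⟩ := hg.exists_eq_of_norm_le hρ (y := coord κ y) hy
    refine ⟨lieCoordInv κ v, ?_, coord_injective κ hvy⟩
    rw [← norm_lieCoord, lieCoord_lieCoordInv]
    exact hv

theorem exists_delInv_pow_le {u : F[X]} (hu : u.natDegree ≠ 0) (x : M.LieC) {ρ : ℝ} (hρ : 0 < ρ) :
    ∃ n, M.normLie κ ((M.delInv u ^ (n + 1)) x) ≤ ρ := by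
  have hu0 : u ≠ 0 := by
    rintro rfl
    exact hu natDegree_zero
  obtain ⟨m, hm, hpow, -⟩ := M.exists_delInv_pow_eq hu0
  have hc : ‖(polyInf u ^ m)⁻¹‖ < 1 := by
    rw [norm_inv, norm_pow]
    exact inv_lt_one_of_one_lt₀ (one_lt_pow₀ (one_lt_norm_polyInf hu) hm.ne')
  have hk : ∀ k, M.normLie κ (((M.delInv u ^ m) ^ k) x) =
      ‖(polyInf u ^ m)⁻¹‖ ^ k * M.normLie κ x := by
    intro k
    induction k with
    | zero => rw [pow_zero, pow_zero, one_mul, Module.End.one_apply]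
    | succ k ih =>
      rw [pow_succ' (M.delInv u ^ m), Module.End.mul_apply]
      nth_rw 1 [hpow]
      rw [normLie_lieScalar, ih, pow_succ', mul_assoc]
  have hlim := (tendsto_pow_atTop_nhds_zero_of_lt_one (norm_nonneg _) hc).mul_const
    (M.normLie κ x)
  rw [zero_mul] at hlim
  obtain ⟨k, hk1, hk2⟩ := ((hlim.eventually_le_const hρ).and
    (Filter.eventually_ge_atTop 1)).exists
  -- The condition k ≥ 1 is there to make the exponent a successor, as in the coefficients of the
  -- generating function.
  obtain ⟨n, hn⟩ : ∃ n, m * k = n + 1 :=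
    ⟨m * k - 1, (Nat.sub_add_cancel (Nat.mul_pos hm hk2)).symm⟩
  refine ⟨n, ?_⟩
  rw [← hn, pow_mul, hk]
  exact hk1

theorem hasSum_genFun (l : M.periods) :
    HasSum (fun n : ℕ => toGauss F[X] (M.normPoints κ)
      (((X : F[X]) ^ n) ⊗ₜ[F] M.exp ((M.delInv X ^ (n + 1)) (l : M.LieC)))) (M.genFun κ l) := by
  have h := ((M.twist_bijective_and_hasSum κ natDegree_X_ne_zero).2 (M.periodT κ 1 l)).map
    (gaussHom F[X] (M.seminormContinuous_exp κ)) (continuous_gaussMap _)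
  refine hasSum_of_eq h fun n => ?_
  have h1 : M.delInvT κ X (n + 1) (M.periodT κ 1 l) = toGauss F[X] (M.normLie κ)
      ((1 : F[X]) ⊗ₜ[F] (M.delInv X ^ (n + 1)) (l : M.LieC)) :=
    gaussMap_toGauss (M.seminormContinuous_delInv_pow κ X_ne_zero (n + 1)) _
  rw [Function.comp_apply, h1, smul_toGauss, TensorProduct.smul_tmul', smul_eq_mul, mul_one]
  have h2 : M.expT κ (toGauss F[X] (M.normLie κ)
      ((X ^ n : F[X]) ⊗ₜ[F] (M.delInv X ^ (n + 1)) (l : M.LieC))) = _ :=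
    gaussMap_toGauss (M.seminormContinuous_exp κ) _
  exact h2.symm

/-- The coefficient of `t^n` of an element of `E(𝕋)`. -/
def coeffT (n : ℕ) (ω : M.ET κ) : M.Points :=
  coordInv κ (gaussCoeff (M.isUltraSeminorm_normPoints κ) (M.coordHom κ) (M.norm_coordHom κ) n ω)

theorem coord_coeffT (n : ℕ) (ω : M.ET κ) : coord κ (M.coeffT κ n ω) =
    gaussCoeff (M.isUltraSeminorm_normPoints κ) (M.coordHom κ) (M.norm_coordHom κ) n ω :=
  coord_coordInv κ _

theorem coeffT_genFun (n : ℕ) (l : M.periods) :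
    M.coeffT κ n (M.genFun κ l) = M.exp ((M.delInv X ^ (n + 1)) (l : M.LieC)) := by
  apply coord_injective κ
  rw [coord_coeffT]
  exact gaussCoeff_of_hasSum _ _ _ (M.hasSum_genFun κ l) n

theorem ext_coeffT {ω η : M.ET κ} (h : ∀ n, M.coeffT κ n ω = M.coeffT κ n η) : ω = η :=
  gauss_ext _ _ _ fun n => by rw [← coord_coeffT, h, coord_coeffT]

theorem coeffT_actT (a : F[X]) (n : ℕ) (ω : M.ET κ) :
    M.coeffT κ n (M.actT κ a ω) = M.act a (M.coeffT κ n ω) := by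
  obtain ⟨f', hf', -, h⟩ := M.exists_act_coord κ a
  apply coord_injective κ
  have h1 : coord κ (M.act a (M.coeffT κ n ω)) = f' (coord κ (M.coeffT κ n ω)) := h _
  rw [h1, coord_coeffT, coord_coeffT]
  exact gaussCoeff_gaussMap _ _ _ (M.seminormContinuous_act κ a) hf' h n ω

theorem coeffT_X_smul_succ (n : ℕ) (ω : M.ET κ) :
    M.coeffT κ (n + 1) ((X : F[X]) • ω) = M.coeffT κ n ω := by
  rw [coeffT, gaussCoeff_X_smul_succ, coeffT]

theorem coeffT_X_smul_zero (ω : M.ET κ) : M.coeffT κ 0 ((X : F[X]) • ω) = 0 := by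
  apply coord_injective κ
  rw [coord_coeffT, gaussCoeff_X_smul_zero, coord_zero]

theorem tendsto_coeffT (ω : M.ET κ) :
    Filter.Tendsto (fun n => M.normPoints κ (M.coeffT κ n ω)) Filter.atTop (nhds 0) := by
  have h := (tendsto_gaussCoeff (M.isUltraSeminorm_normPoints κ) (M.coordHom κ)
    (M.norm_coordHom κ) ω).norm
  rw [norm_zero] at h
  refine h.congr fun n => ?_
  rw [← coord_coeffT]
  rfl

/-- If ω_l = 0, then exp(∂t^{−n−1}l) = 0 for all n; for some n the argument lies in the ball on
which exp is injective. -/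
theorem genFun_injective : Function.Injective (M.genFun κ) := by
  have h0 : ∀ l : M.periods, M.genFun κ l = 0 → l = 0 := by
    intro l hl
    obtain ⟨ρ, hρ0, hρ, -⟩ := M.exists_exp_local κ
    obtain ⟨n, hn⟩ := M.exists_delInv_pow_le κ natDegree_X_ne_zero (l : M.LieC) hρ0
    have h1 : M.exp ((M.delInv X ^ (n + 1)) (l : M.LieC)) = 0 := by
      rw [← coeffT_genFun M κ, hl]
      apply coord_injective κ
      rw [coord_coeffT, map_zero, coord_zero]
    have h2 := hρ _ hn h1
    have hunit : IsUnit (M.delInv X ^ (n + 1)) :=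
      ((M.isUnit_del X_ne_zero).ringInverse).pow _
    exact Subtype.ext (((Module.End.isUnit_iff _).mp hunit).injective (h2.trans (map_zero _).symm))
  intro l m hlm
  have h1 := M.genFun_add κ (l - m) m
  rw [sub_add_cancel, hlm, right_eq_add] at h1
  exact sub_eq_zero.mp (h0 _ h1)

/-- The coefficients tend to 0, so from some index N on they lift along the local inverse of exp,
and injectivity makes the lifts compatible with ∂t. Applying ∂t^N then lifts the whole sequence. -/
theorem exists_eq_genFun {ω : M.ET κ} (hω : ω ∈ M.sf κ) : ∃ l, M.genFun κ l = ω := by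
  set e : ℕ → M.Points := fun n => M.coeffT κ n ω with he
  have hsucc : ∀ n, M.act X (e (n + 1)) = e n := fun n => by
    simp only [he]
    rw [← coeffT_actT, ← hω X, coeffT_X_smul_succ]
  have hzero : M.act X (e 0) = 0 := by
    simp only [he]
    rw [← coeffT_actT, ← hω X, coeffT_X_smul_zero]
  have hpow : ∀ k n, M.act (X ^ k) (e (n + k)) = e n := by
    intro k
    induction k with
    | zero =>
      intro n
      rw [pow_zero, ← C_1, act_C, one_smul]
      rfl
    | succ k ih =>
      intro n
      rw [pow_succ, act_mul, LinearMap.comp_apply, ← add_assoc, hsucc, ih]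
  obtain ⟨ρ, hρ0, hinj, hsurj⟩ := M.exists_exp_local κ
  obtain ⟨K, hK0, hK⟩ := M.exists_del_bound κ X
  -- With this radius r one has Kr + r = ρ, so ∂t x_{n+1} − x_n stays in the ball on which exp is
  -- injective.
  have hδ : 0 < ρ / (K + 1) := by positivity
  have hδρ : ρ / (K + 1) ≤ ρ := div_le_self hρ0.le (by linarith)
  obtain ⟨N, hN⟩ := Filter.eventually_atTop.mp ((M.tendsto_coeffT κ ω).eventually_le_const hδ)
  have hex : ∀ n, ∃ x, M.normLie κ x ≤ ρ / (K + 1) ∧ M.exp x = e (n + N) := fun n => by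
    have h1 := hN (n + N) (Nat.le_add_left N n)
    obtain ⟨x, hx, hxe⟩ := hsurj _ (h1.trans hδρ)
    exact ⟨x, hx.trans h1, hxe⟩
  choose x hx hxe using hex
  have hdel : ∀ n, M.del X (x (n + 1)) = x n := by
    intro n
    refine sub_eq_zero.mp (hinj _ ?_ ?_)
    · refine (map_sub_le_add (M.normLie κ) _ _).trans ?_
      have h1 := (hK (x (n + 1))).trans (mul_le_mul_of_nonneg_left (hx (n + 1)) hK0)
      have h2 : K * (ρ / (K + 1)) + ρ / (K + 1) = ρ := by
        field_simp
      linarith [hx n]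
    · rw [map_sub, exp_del, hxe, hxe, add_right_comm, hsucc, sub_self]
  let y : ℕ → M.LieC := fun n => M.del (X ^ N) (x n)
  have hy : ∀ n, M.exp (y n) = e n := fun n => by
    rw [exp_del, hxe, hpow]
  have hydel : ∀ n, M.del X (y (n + 1)) = y n := fun n => by
    simp only [y]
    rw [← hdel n, ← Module.End.mul_apply, ← Module.End.mul_apply, ← map_mul, ← map_mul, mul_comm]
  -- The vector ∂t y_0 is the period sought: it lies in the kernel of exp because φ_t e_0 = 0, and
  -- ∂t^{−n−1} takes it to y_n.
  have hper : M.exp (M.del X (y 0)) = 0 := by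
    rw [exp_del, hy, hzero]
  have hyinv : ∀ n, (M.delInv X ^ (n + 1)) (M.del X (y 0)) = y n := by
    have hcancel : ∀ z, M.delInv X (M.del X z) = z := fun z =>
      LinearMap.congr_fun (M.delInv_mul_del X_ne_zero) z
    intro n
    induction n with
    | zero => rw [zero_add, pow_one, hcancel]
    | succ n ih => rw [pow_succ', Module.End.mul_apply, ih, ← hydel n, hcancel]
  refine ⟨⟨M.del X (y 0), hper⟩, M.ext_coeffT κ fun n => ?_⟩
  rw [coeffT_genFun, hyinv, hy]

theorem bijOn_genFun : Set.BijOn (M.genFun κ) Set.univ (M.sf κ) :=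
  ⟨fun l _ => M.genFun_mem_sf κ l, (M.genFun_injective κ).injOn, fun _ hω =>
    let ⟨l, hl⟩ := M.exists_eq_genFun κ hω
    ⟨l, trivial, hl⟩⟩

end AndersonModule

end Uniformization
end AndersonT

end

theorem proposition3p11 {F : Type u} [Field F] [Fintype F]
    (L : IntermediateField (RatFunc F) (AndersonT.CInf F)) (d : ℕ) (hd : 0 < d)
    (M : AndersonT.AndersonModule L d) (κ : M.E ≅ AndersonT.Ga F L d) :
    -- for every separating `u`, the map `δ_u : 𝔡_{A/𝔽[u]} · Λ_E → 𝔰𝔣(E)` is well defined, and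
    -- `l ↦ δ_u(u' l)` is a map on all of `Λ_E` which does not depend on `u`: it is `δ_t`
    (∀ u : F[X], AndersonT.IsSeparating u →
      Function.Bijective (M.twist κ u) ∧
      (∀ y ∈ M.differentPeriods u, (∃! ω, M.IsDelta κ u y ω) ∧ M.delta κ u y ∈ M.sf κ) ∧
      ∀ l : M.periods, derivative u • l ∈ M.differentPeriods u ∧
        M.delta κ u (derivative u • l) = M.delta κ X l) ∧
    -- `δ_t` is an isomorphism of `A`-modules `Λ_E → 𝔰𝔣(E)`
    AndersonT.IsSeparating (X : F[X]) ∧ M.differentPeriods X = ⊤ ∧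
    IsLinearMap F[X] (M.delta κ X) ∧ Set.BijOn (M.delta κ X) Set.univ (M.sf κ) ∧
    -- `δ_t` sends a period to its Anderson generating function
    IsUnit (M.del X) ∧
    ∀ l : M.periods,
      M.delta κ X l = M.expTwistInv κ X (M.periodT κ 1 l) ∧
      HasSum (fun n : ℕ => AndersonT.toGauss F[X] (M.normPoints κ)
        (((X : F[X]) ^ n) ⊗ₜ[F] M.exp ((Ring.inverse (M.del X) ^ (n + 1)) (l : M.LieC))))
        (M.delta κ X l) := by
  have hdelta : M.delta κ X = M.genFun κ := funext (M.delta_X κ)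
  refine ⟨fun u hu => ?_, AndersonT.isSeparating_X, M.differentPeriods_X, ?_, ?_,
    M.isUnit_del X_ne_zero, fun l => ?_⟩
  · have hu' := hu.derivative_ne_zero
    refine ⟨(M.twist_bijective_and_hasSum κ
      (AndersonT.natDegree_ne_zero_of_derivative_ne_zero hu')).1, fun y hy => ?_, fun l => ?_⟩
    -- Every element of the domain is of the form u'l, where the graph of δ_u has the single value
    -- ω_l.
    · obtain ⟨l, rfl⟩ := (M.mem_differentPeriods hu' y).mp hy
      refine ⟨⟨_, (M.isDelta_derivative_smul κ hu' l _).mpr rfl, fun ω hω =>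
        (M.isDelta_derivative_smul κ hu' l ω).mp hω⟩, ?_⟩
      rw [M.delta_derivative_smul κ hu']
      exact M.genFun_mem_sf κ l
    · exact ⟨(M.mem_differentPeriods hu' _).mpr ⟨l, rfl⟩, by
        rw [M.delta_derivative_smul κ hu', M.delta_X]⟩
  · rw [hdelta]
    exact ⟨M.genFun_add κ, M.genFun_smul κ⟩
  · rw [hdelta]
    exact M.bijOn_genFun κ
  · rw [hdelta]
    exact ⟨rfl, M.hasSum_genFun κ l⟩
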